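/- **Setting.** Let $F$ be a finite field with $q$ elements and characteristic $p$, and let $s,d,\ell,n$ be natural numbers with $n,\ell\ge 1$. For pairwise distinct $a_1,\dots,a_n\in F$, the univariate multiplicity code $\mathrm{MULT}^{(1)}_{q,s}(n,d)\subseteq (F^s)^n$ consists of all words $$\Big(\big(P^{(0)}(a_i),P^{(1)}(a_i),\dots,P^{(s-1)}(a_i)\big)\Big)_{1\le i\le n},\qquad P\in F[X],\ \deg P\le d,$$ where $P^{(j)}$ is the $j$-th Hasse derivative, i.e. $P(X+Z)=\sum_j P^{(j)}(X)Z^j$. For $S=(S_1,\dots,S_n)$ with $S_i\subseteq F^s$ and $|S_i|=\ell$, put $\mathrm{dist}(c,S)=\frac1n|\{i: c_i\notin S_i\}|$. A code $\mathcal C\subseteq (F^s)^n$ is $(\alpha,\ell,L)$-list-recoverable if for every such $S$ at most $L$ codewords $c\in \mathcal C$ satisfy $\mathrm{dist}(c,S)\le\alpha$. **Machine model.** Randomized algorithms are programs of a fixed first-order language whose data are binary trees with natural numbers at the leaves. Forming a pair, taking a component, testing, and accessing a variable or a constant take unit time; $+$, truncated $-$, $\times$, integer division, remainder, $<$, $=$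 and bit length are charged the bit lengths of their operands plus one; one can draw a uniformly random element of $\{0,\dots,k-1\}$ in time the bit length of $k$ plus one; the control structures are conditionals, local definitions, and loops whose number of rounds is computed before the loop is entered, at a cost of at least one unit per round. The field $F$ is presented as $\mathbb F_p[\theta]$, with $1,\theta,\dots,\theta^{m-1}$ a basis of $F$ over $\mathbb F_p$, by $p$, $m$ and the coefficients of the minimal polynomial of $\theta$; elements of $F$ are given by their $m$ coordinates in $\{0,\dots,p-1\}$. **Theorem 4.1.** There are an absolute constant $C>0$, a randomized program $A$ and a natural number $k$ such that the following holds for all $F,q,p,s,d,\ell,n,a_1,\dots,a_n$ as above and all real $\varepsilon>0$ with $$d<p,\qquad n<p/s,\qquad s\ge 16\ell/\varepsilon^2 .$$ Put $$\alpha=1-\frac{d}{sn}-\varepsilon,\qquad L=\Big\lfloor (\ell/\varepsilon)^{C\cdot\frac1\varepsilon\log_2(\ell/\varepsilon)}\Big\rfloor,\qquad T=\Big(\log_2 q+s+d+n+(\ell/\varepsilon)^{\log_2(\ell/\varepsilon)/\varepsilon}\Big)^{k}.$$ 1. The code $\mathrm{MULT}^{(1)}_{q,s}(n,d)$ is $(\alpha,\ell,L)$-list-recoverable.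 2. For every such presentation of $F$ and every $S$ as above (each $S_i$ listed in any order without repetitions), given the presentation of $F$, the numbers $s,d,n,\ell$, the points $a_1,\dots,a_n$, the lists $S_1,\dots,S_n$, and the number $\max(0,\lfloor\alpha n\rfloor+1)$ (a word $c$ satisfies $\mathrm{dist}(c,S)\le\alpha$ if and only if it disagrees with $S$ in fewer coordinates than this), the program $A$ in every run stops in time at most $T$ and outputs a list of at most $L$ codewords of $\mathrm{MULT}^{(1)}_{q,s}(n,d)$; and with probability at least $0.99$ the output lists, without repetitions, exactly the codewords $c$ with $\mathrm{dist}(c,S)\le\alpha$. -/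

import Mathlib

open Polynomial

noncomputable section

namespace ListRec

/-! ### Codes and list recovery -/

/-- The relative distance of a string from a sequence of input lists: the fraction of the
coordinates `i` with `x i ∉ S i`. -/
def listDist {n : ℕ} {A : Type*} (x : Fin n → A) (S : Fin n → Finset A) : ℝ :=
  ({i | x i ∉ S i} : Set (Fin n)).ncard / n

/-- The codewords of `C` within relative distance `α` of the input lists `S`. -/
def closeCodewords {n : ℕ} {A : Type*} (C : Set (Fin n → A)) (α : ℝ) (S : Fin n → Finset A) :
    Set (Fin n → A) :=
  {c | c ∈ C ∧ listDist c S ≤ α}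

/-- `C` is `(α, ℓ, L)`-list-recoverable: for all input lists of size `ℓ` there are at most `L`
codewords within relative distance `α`. -/
def IsListRecoverable {n : ℕ} {A : Type*} (C : Set (Fin n → A)) (α : ℝ) (ℓ L : ℕ) : Prop :=
  ∀ S : Fin n → Finset A, (∀ i, (S i).card = ℓ) → (closeCodewords C α S).encard ≤ L

/-- The encoding of a polynomial by its Hasse derivatives of order less than `s` at the
points `a 0, …, a (n - 1)`. -/
def multEnc {F : Type*} [Field F] {n : ℕ} (s : ℕ) (a : Fin n → F) (P : F[X]) :
    Fin n → (Fin s → F) :=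
  fun i j => (hasseDeriv (j : ℕ) P).eval (a i)

/-- The univariate multiplicity code with multiplicity `s`, degree bound `d` and evaluation
points `a 0, …, a (n - 1)`, over the alphabet `F ^ s`. -/
def multCode {F : Type*} [Field F] {n : ℕ} (s d : ℕ) (a : Fin n → F) :
    Set (Fin n → (Fin s → F)) :=
  {c | ∃ P : F[X], P.natDegree ≤ d ∧ c = multEnc s a P}

/-! ### Randomized programs with a cost semantics

Programs of a small first-order language work on binary trees whose leaves are natural numbers.
Pairing, projections, tests and variable accesses take one step (trees are shared, as in a pointer
machine); an arithmetical operation is charged the bit lengths of its operands (the logarithmic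
cost criterion).  The only loop runs for a number of rounds computed before the loop is
entered, so every program halts on every input. -/

/-- The data of the programs. -/
inductive Val : Type
  | num : ℕ → Val
  | pair : Val → Val → Val

namespace Val

/-- The number at a leaf (`0` at a pair). -/
def toNat : Val → ℕ
  | num k => k
  | pair _ _ => 0

/-- First component (`num 0` at a leaf). -/
def left : Val → Val
  | num _ => num 0
  | pair v _ => v

/-- Second component (`num 0` at a leaf). -/
def right : Val → Val
  | num _ => num 0
  | pair _ w => w

/-- Truth value of a datum: only the leaf `0` counts as false. -/
def isTrue : Val → Bool
  | num 0 => false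
  | _ => true

/-- Lists as data; the empty list is the leaf `0`. -/
def ofList : List Val → Val
  | [] => num 0
  | v :: vs => pair v (ofList vs)

end Val

/-- Binary operations on natural numbers: sum, truncated difference, product, quotient,
remainder, and the tests `<` and `=` (with value `1` for true and `0` for false). -/
inductive BinOp : Type
  | add | sub | mul | div | mod | lt | eq

/-- The meaning of the binary operations. -/
def BinOp.eval : BinOp → ℕ → ℕ → ℕ
  | add, x, y => x + y
  | sub, x, y => x - y
  | mul, x, y => x * y
  | div, x, y => x / y
  | mod, x, y => x % y
  | lt, x, y => if x < y then 1 else 0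
  | eq, x, y => if x = y then 1 else 0

/-- Randomized programs; variables are de Bruijn indices into the environment. -/
inductive Prog : Type
  /-- the value of a variable -/
  | var (i : ℕ)
  /-- a numerical constant -/
  | lit (k : ℕ)
  /-- pairing -/
  | pair (e₁ e₂ : Prog)
  /-- first component -/
  | fst (e : Prog)
  /-- second component -/
  | snd (e : Prog)
  /-- a binary operation on numbers -/
  | op (o : BinOp) (e₁ e₂ : Prog)
  /-- the bit length of a number -/
  | size (e : Prog)
  /-- a uniformly random number less than the value of `e` -/
  | rand (e : Prog)
  /-- conditional -/
  | ite (e₀ e₁ e₂ : Prog)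
  /-- local definition: `body` is run with the value of `e` as its variable `0` -/
  | letIn (e body : Prog)
  /-- starting from the value of `init`, run `body` repeatedly, for as many rounds as the value
  of `count`, each time on the current value as its variable `0` -/
  | loop (count init body : Prog)

/-- A randomized computation: the joint distribution of its result and its running time. -/
abbrev Comp : Type := PMF (Val × ℕ)

namespace Comp

/-- Return `v` after `t` steps. -/
def ret (v : Val) (t : ℕ) : Comp := PMF.pure (v, t)

/-- Sequential composition, with fresh randomness; running times add up. -/
def seq (m : Comp) (f : Val → Comp) : Comp :=
  m.bind fun x => (f x.1).bind fun y => PMF.pure (y.1, x.2 + y.2)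

/-- Draw a uniformly random number less than `k`, in time the bit length of `k` plus one
(the result is `0` if `k = 0`). -/
def draw (k : ℕ) : Comp :=
  match k with
  | 0 => ret (.num 0) 1
  | k + 1 => (PMF.uniformOfFintype (Fin (k + 1))).bind
      fun i => ret (.num (i : ℕ)) (Nat.size (k + 1) + 1)

/-- Run `step` for the given number of rounds; every round costs one step more than its body. -/
def iter (step : Val → Comp) : ℕ → Val → Comp
  | 0, v => ret v 1
  | k + 1, v => seq (seq (step v) fun w => ret w 1) (iter step k)

end Comp

open ListRec.Comp in
/-- The semantics of programs: result and running time in a given environment. -/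
def Prog.eval : Prog → List Val → Comp
  | var i, env => ret (env.getD i (.num 0)) 1
  | lit k, _ => ret (.num k) 1
  | pair e₁ e₂, env => seq (e₁.eval env) fun v => seq (e₂.eval env) fun w => ret (.pair v w) 1
  | fst e, env => seq (e.eval env) fun v => ret v.left 1
  | snd e, env => seq (e.eval env) fun v => ret v.right 1
  | op o e₁ e₂, env => seq (e₁.eval env) fun v => seq (e₂.eval env) fun w =>
      ret (.num (o.eval v.toNat w.toNat)) (Nat.size v.toNat + Nat.size w.toNat + 1)
  | size e, env => seq (e.eval env) fun v => ret (.num (Nat.size v.toNat)) (Nat.size v.toNat + 1)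
  | rand e, env => seq (e.eval env) fun v => draw v.toNat
  | ite e₀ e₁ e₂, env => seq (seq (e₀.eval env) fun v => ret v 1) fun v =>
      if v.isTrue then e₁.eval env else e₂.eval env
  | letIn e body, env => seq (seq (e.eval env) fun v => ret v 1) fun v => body.eval (v :: env)
  | loop count init body, env => seq (count.eval env) fun k => seq (init.eval env) fun v =>
      iter (fun w => body.eval (w :: env)) k.toNat v

/-! ### Inputs and outputs

A finite field of characteristic `p` is presented to a program in the usual way, as
`𝔽_p[θ]` with `θ` a root of a given irreducible polynomial: an element is the list of its
coordinates in the basis `1, θ, …, θ ^ (m - 1)`, each a number less than `p`. -/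

section Encoding

variable {p : ℕ} {F : Type*} [Field F] [Algebra (ZMod p) F] (B : PowerBasis (ZMod p) F)

/-- A field element as the list of its coordinates. -/
def encElem (x : F) : Val :=
  .ofList (List.ofFn fun i : Fin B.dim => .num (B.basis.repr x i).val)

/-- The minimal polynomial of the generator, as the list of its coefficients, from the constant
one to the leading one. -/
def encModulus : Val :=
  .ofList (List.ofFn fun i : Fin (B.dim + 1) => .num ((minpoly (ZMod p) B.gen).coeff i).val)

/-- A symbol of the alphabet `F ^ s`. -/
def encSymbol {s : ℕ} (y : Fin s → F) : Val :=
  .ofList (List.ofFn fun j => encElem B (y j))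

/-- A word over the alphabet `F ^ s`. -/
def encWord {n s : ℕ} (c : Fin n → (Fin s → F)) : Val :=
  .ofList (List.ofFn fun i => encSymbol B (c i))

/-- A list of words. -/
def encWords {n s : ℕ} (out : List (Fin n → (Fin s → F))) : Val :=
  .ofList (out.map (encWord B))

/-- The input of the list-recovery problem: a number `e` (a word is to be found if it disagrees
with the input lists in fewer than `e` coordinates), the field, the parameters of the code, the
evaluation points, and the input lists, in any order. -/
def encInput {n s : ℕ} (e d ℓ : ℕ) (a : Fin n → F) (S : Fin n → List (Fin s → F)) : Val :=
  .ofList [.num e, .num p, .num B.dim, encModulus B, .num s, .num d, .num n, .num ℓ,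
    .ofList (List.ofFn fun i => encElem B (a i)),
    .ofList (List.ofFn fun i => .ofList ((S i).map (encSymbol B)))]

end Encoding

/-- A number `e` such that a word of length `n > 0` is within relative distance `α` of the input
lists if and only if it disagrees with them in fewer than `e` coordinates: it is
`⌊α n⌋ + 1` for `α ≥ 0`, and `0` for `α < 0`. -/
def errorBound (n : ℕ) (α : ℝ) : ℕ := ⌊α * n + 1⌋₊

open Classical in
/-- The program `A` list-recovers the univariate multiplicity code from relative distance `α` and
input lists of size `ℓ`, with output lists of size at most `L`, in time `T`, when the field is
presented by `B`.  In every run it stops within `T` steps with a list of at most `L` codewords;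
with probability at least `0.99` this is a list, without repetitions, of exactly the codewords
within relative distance `α` of the input lists. -/
def ListRecovers (A : Prog) {p : ℕ} {F : Type*} [Field F] [Algebra (ZMod p) F]
    (B : PowerBasis (ZMod p) F) {n : ℕ} (s d : ℕ) (a : Fin n → F) (α : ℝ) (ℓ L : ℕ) (T : ℝ) :
    Prop :=
  ∀ S : Fin n → List (Fin s → F), (∀ i, (S i).Nodup ∧ (S i).length = ℓ) →
    (∀ x ∈ (A.eval [encInput B (errorBound n α) d ℓ a S]).support, (x.2 : ℝ) ≤ T ∧
      ∃ out : List (Fin n → (Fin s → F)), x.1 = encWords B out ∧ out.length ≤ L ∧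
        ∀ c ∈ out, c ∈ multCode s d a) ∧
    99 / 100 ≤ (A.eval [encInput B (errorBound n α) d ℓ a S]).toOuterMeasure
      {x | ∃ out : List (Fin n → (Fin s → F)), x.1 = encWords B out ∧ out.Nodup ∧
        ∀ c, c ∈ out ↔ c ∈ closeCodewords (multCode s d a) α fun i => (S i).toFinset}

end ListRec

end

/-! Write A for the required number of agreements (`agr`), g = `gapInv` (about 1/ε), r = `ord` =
2ℓg, m = `mult` = s + 1 - r, t = `samples`. For α ≥ 0 the definition of the error bound gives sA - d
≥ εsn.

Confinement. There are more unknown coefficients than conditions, so some nonzero operator Σ_{j<r}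
B_j ∂^(j) (Hasse derivatives, deg B_j < `deg`) takes, formally, values vanishing to order m on all
nℓ list entries. Applied to a polynomial that agrees with the lists in A coordinates, it gives a
polynomial with A zeros of order m and degree less than `deg` + d ≤ mA, that is, zero
(`diffOp_eq_zero`, `deg_add_le`). Hence all polynomials sought lie in the space W = `solSpace`.
Moreover dim W < r (`finrank_lt_of_sum_hasseDeriv_eq_zero`): the degree of a nonzero solution is a
root of the indicial polynomial at infinity, a nonzero combination of binomial coefficients of
degree less than r, and degrees below p stay distinct mod p.

Sampling. The same fact shows that Wronskians of independent polynomials of degree at most d < p do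
not vanish. Counting their zeros gives a subspace design (`sum_finrank_inf_vanish_le`): requiring
vanishing to order s at one random agreeing coordinate shrinks a subspace of W on average by the
factor d/(mA) ≤ 1 - 1/(2g). After t such coordinates the expected dimension is at most 1/2
(`pow_agr_le`). So if t pairs (coordinate, list entry) are drawn uniformly, then with probability at
least 1/`bound`, where `bound` = r^t, all entries agree with a given close P and the coordinates
determine P inside W (`pow_le_bound_mul`). No sample is good for two polynomials; therefore at most
`bound` polynomials are close (`card_le_bound`), which is (ℓ/ε)^(O(log(ℓ/ε)/ε)) when ℓ/ε ≥ 2. If ℓ/ε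
< 2, the claimed L may be 1, and unique decoding is used instead (`eq_of_isClose`).

Algorithm. Each of 100·`bound`² trials solves a linear system that determines P from a good sample
(`trialPoly_eq`). Words that are not close or not new are discarded, so every run outputs a correct
sublist, and a union bound makes it complete with probability 0.99 (`card_fail_le`). All samples are
the digits of one random number: the program draws once and then evaluates a deterministic function
(`exists_prog_of_polyTime`). That function is never written out as a program; it is assembled from
closure properties of `PolyTime`. -/

noncomputable section

namespace ListRec

/-! ### Polynomially bounded functions -/

/-- `f` is bounded by a power of `M + 2`. -/
def PolyBdd {X : Type*} (M f : X → ℕ) : Prop := ∃ k, ∀ x, f x ≤ (M x + 2) ^ k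

namespace PolyBdd

variable {X Y : Type*} {M f g : X → ℕ}

theorem mono (hf : PolyBdd M f) (h : ∀ x, g x ≤ f x) : PolyBdd M g := by
  obtain ⟨k, hk⟩ := hf
  exact ⟨k, fun x => (h x).trans (hk x)⟩

theorem const (c : ℕ) : PolyBdd M fun _ => c :=
  ⟨c, fun x => Nat.lt_two_pow_self.le.trans (Nat.pow_le_pow_left (by omega) c)⟩

theorem add (hf : PolyBdd M f) (hg : PolyBdd M g) : PolyBdd M fun x => f x + g x := by
  obtain ⟨k, hk⟩ := hf
  obtain ⟨l, hl⟩ := hg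
  refine ⟨k + l + 1, fun x => ?_⟩
  have h1 : f x ≤ (M x + 2) ^ (k + l) :=
    (hk x).trans (Nat.pow_le_pow_right (by omega) (by omega))
  have h2 : g x ≤ (M x + 2) ^ (k + l) :=
    (hl x).trans (Nat.pow_le_pow_right (by omega) (by omega))
  rw [pow_succ]
  nlinarith [Nat.zero_le (M x)]

theorem mul (hf : PolyBdd M f) (hg : PolyBdd M g) : PolyBdd M fun x => f x * g x := by
  obtain ⟨k, hk⟩ := hf
  obtain ⟨l, hl⟩ := hg
  exact ⟨k + l, fun x => by rw [pow_add]; exact Nat.mul_le_mul (hk x) (hl x)⟩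

theorem comap (φ : Y → X) (hf : PolyBdd M f) : PolyBdd (fun y => M (φ y)) fun y => f (φ y) := by
  obtain ⟨k, hk⟩ := hf
  exact ⟨k, fun y => hk (φ y)⟩

end PolyBdd

theorem size_add_le (a b : ℕ) : Nat.size (a + b) ≤ Nat.size a + Nat.size b + 1 := by
  rw [Nat.size_le]
  have ha := Nat.lt_size_self a
  have hb := Nat.lt_size_self b
  have h1 : 2 ^ Nat.size a ≤ 2 ^ (Nat.size a + Nat.size b) :=
    Nat.pow_le_pow_right (by omega) (by omega)
  have h2 : 2 ^ Nat.size b ≤ 2 ^ (Nat.size a + Nat.size b) :=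
    Nat.pow_le_pow_right (by omega) (by omega)
  rw [pow_succ]
  omega

theorem size_mul_le (a b : ℕ) : Nat.size (a * b) ≤ Nat.size a + Nat.size b := by
  rw [Nat.size_le, pow_add]
  exact Nat.mul_lt_mul'' (Nat.lt_size_self a) (Nat.lt_size_self b)

theorem size_le_self (a : ℕ) : Nat.size a ≤ a := by
  rw [Nat.size_le]
  exact Nat.lt_two_pow_self

theorem size_pow_le (a b : ℕ) : Nat.size (a ^ b) ≤ b * Nat.size a + 1 := by
  induction b with
  | zero => simp
  | succ b ih =>
    rw [pow_succ, Nat.succ_mul]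
    have := size_mul_le (a ^ b) a
    omega

/-! ### Functions computed by programs in polynomial time -/

namespace Comp

theorem ret_seq (v : Val) (t : ℕ) (f : Val → Comp) :
    seq (ret v t) f = (f v).bind fun y => PMF.pure (y.1, t + y.2) := by
  simp [seq, ret]

theorem ret_seq_ret {v w : Val} {t u : ℕ} {f : Val → Comp} (h : f v = ret w u) :
    seq (ret v t) f = ret w (t + u) := by
  rw [ret_seq, h]
  simp [ret]

end Comp

open ListRec.Comp

/-- Some program computes `f x` from `I x`, in time bounded by a power of `M x + 2`,
uniformly in `x`. -/
def PolyTime {X : Type*} (M : X → ℕ) (I f : X → Val) : Prop :=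
  ∃ (e : Prog) (k : ℕ), ∀ x env, ∃ t ≤ (M x + 2) ^ k, e.eval (I x :: env) = ret (f x) t

namespace PolyTime

variable {X Y : Type*} {M : X → ℕ} {I f g h : X → Val}

theorem of_bdd (e : Prog) {T : X → ℕ} (hT : PolyBdd M T)
    (h : ∀ x env, ∃ t ≤ T x, e.eval (I x :: env) = ret (f x) t) : PolyTime M I f := by
  obtain ⟨k, hk⟩ := hT
  refine ⟨e, k, fun x env => ?_⟩
  obtain ⟨t, ht, he⟩ := h x env
  exact ⟨t, ht.trans (hk x), he⟩

theorem exists_bdd (hf : PolyTime M I f) : ∃ (e : Prog) (T : X → ℕ), PolyBdd M T ∧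
    ∀ x env, ∃ t ≤ T x, e.eval (I x :: env) = ret (f x) t := by
  obtain ⟨e, k, h⟩ := hf
  exact ⟨e, fun x => (M x + 2) ^ k, ⟨k, fun _ => le_rfl⟩, h⟩

theorem congr (hf : PolyTime M I f) (h : ∀ x, f x = g x) : PolyTime M I g := by
  rwa [← funext h]

theorem id : PolyTime M I I :=
  of_bdd (.var 0) (PolyBdd.const 1) fun _ _ => ⟨1, le_rfl, rfl⟩

theorem num (c : ℕ) : PolyTime M I fun _ => .num c :=
  of_bdd (.lit c) (PolyBdd.const 1) fun _ _ => ⟨1, le_rfl, rfl⟩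

/-- The second program sees only its variable 0. Since `PolyTime` quantifies over the rest of the
environment, the extra binding left by the first one is harmless. -/
theorem comp (hg : PolyTime M I g) (hf : PolyTime M g f) : PolyTime M I f := by
  obtain ⟨e, T, hT, he⟩ := hg.exists_bdd
  obtain ⟨e', T', hT', he'⟩ := hf.exists_bdd
  refine of_bdd (.letIn e e') ((hT.add (.const 1)).add hT') fun x env => ?_
  obtain ⟨t, ht, h⟩ := he x env
  obtain ⟨t', ht', h'⟩ := he' x (I x :: env)
  refine ⟨t + 1 + t', by omega, ?_⟩
  rw [Prog.eval, h, ret_seq_ret (t := t) rfl, ret_seq_ret h']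

theorem pair (hf : PolyTime M I f) (hg : PolyTime M I g) :
    PolyTime M I fun x => .pair (f x) (g x) := by
  obtain ⟨e, T, hT, he⟩ := hf.exists_bdd
  obtain ⟨e', T', hT', he'⟩ := hg.exists_bdd
  refine of_bdd (.pair e e') (hT.add (hT'.add (.const 1))) fun x env => ?_
  obtain ⟨t, ht, h⟩ := he x env
  obtain ⟨t', ht', h'⟩ := he' x env
  refine ⟨t + (t' + 1), by omega, ?_⟩
  rw [Prog.eval, h]
  refine ret_seq_ret ?_
  rw [h']
  exact ret_seq_ret rfl

theorem left (hf : PolyTime M I f) : PolyTime M I fun x => (f x).left := by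
  obtain ⟨e, T, hT, he⟩ := hf.exists_bdd
  refine of_bdd (.fst e) (hT.add (.const 1)) fun x env => ?_
  obtain ⟨t, ht, h⟩ := he x env
  refine ⟨t + 1, by omega, ?_⟩
  rw [Prog.eval, h]
  exact ret_seq_ret rfl

theorem right (hf : PolyTime M I f) : PolyTime M I fun x => (f x).right := by
  obtain ⟨e, T, hT, he⟩ := hf.exists_bdd
  refine of_bdd (.snd e) (hT.add (.const 1)) fun x env => ?_
  obtain ⟨t, ht, h⟩ := he x env
  refine ⟨t + 1, by omega, ?_⟩
  rw [Prog.eval, h]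
  exact ret_seq_ret rfl

theorem comap (φ : Y → X) (hf : PolyTime M I f) :
    PolyTime (fun y => M (φ y)) (fun y => I (φ y)) fun y => f (φ y) := by
  obtain ⟨e, k, h⟩ := hf
  exact ⟨e, k, fun y env => h (φ y) env⟩

/-- Computable functions stay computable when the input is extended by further data. -/
theorem lift {φ : Y → X} {J : Y → Val} (hf : PolyTime M I f) :
    PolyTime (fun y => M (φ y)) (fun y => .pair (J y) (I (φ y))) fun y => f (φ y) :=
  (PolyTime.id (I := fun y => Val.pair (J y) (I (φ y)))).right.comp (hf.comap φ)

theorem head {J : X → Val} : PolyTime M (fun x => .pair (J x) (I x)) J :=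
  (PolyTime.id (I := fun x => Val.pair (J x) (I x))).left

theorem op (o : BinOp) {u v : X → ℕ} (hu : PolyTime M I fun x => .num (u x))
    (hv : PolyTime M I fun x => .num (v x)) (bu : PolyBdd M fun x => (u x).size)
    (bv : PolyBdd M fun x => (v x).size) :
    PolyTime M I fun x => .num (o.eval (u x) (v x)) := by
  obtain ⟨e, T, hT, he⟩ := hu.exists_bdd
  obtain ⟨e', T', hT', he'⟩ := hv.exists_bdd
  refine of_bdd (.op o e e') (hT.add (hT'.add ((bu.add bv).add (.const 1)))) fun x env => ?_
  obtain ⟨t, ht, h⟩ := he x env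
  obtain ⟨t', ht', h'⟩ := he' x env
  refine ⟨t + (t' + ((u x).size + (v x).size + 1)), by omega, ?_⟩
  rw [Prog.eval, h]
  refine ret_seq_ret ?_
  rw [h']
  exact ret_seq_ret rfl

theorem size {u : X → ℕ} (hu : PolyTime M I fun x => .num (u x))
    (bu : PolyBdd M fun x => (u x).size) : PolyTime M I fun x => .num (u x).size := by
  obtain ⟨e, T, hT, he⟩ := hu.exists_bdd
  refine of_bdd (.size e) (hT.add (bu.add (.const 1))) fun x env => ?_
  obtain ⟨t, ht, h⟩ := he x env
  refine ⟨t + ((u x).size + 1), by omega, ?_⟩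
  rw [Prog.eval, h]
  exact ret_seq_ret rfl

open Classical in
theorem ite {P : X → Prop} (hP : PolyTime M I fun x => .num (if P x then 1 else 0))
    (hf : PolyTime M I f) (hg : PolyTime M I g) :
    PolyTime M I fun x => if P x then f x else g x := by
  obtain ⟨e₀, T₀, hT₀, he₀⟩ := hP.exists_bdd
  obtain ⟨e, T, hT, he⟩ := hf.exists_bdd
  obtain ⟨e', T', hT', he'⟩ := hg.exists_bdd
  refine of_bdd (.ite e₀ e e') ((hT₀.add (.const 1)).add (hT.add hT')) fun x env => ?_
  obtain ⟨t₀, ht₀, h₀⟩ := he₀ x env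
  obtain ⟨t, ht, h⟩ := he x env
  obtain ⟨t', ht', h'⟩ := he' x env
  rw [Prog.eval, h₀, ret_seq_ret (t := t₀) rfl]
  by_cases hp : P x
  · refine ⟨t₀ + 1 + t, by omega, ?_⟩
    rw [if_pos hp, if_pos hp]
    exact ret_seq_ret (by simpa [Val.isTrue] using h)
  · refine ⟨t₀ + 1 + t', by omega, ?_⟩
    rw [if_neg hp, if_neg hp]
    exact ret_seq_ret (by simpa [Val.isTrue] using h')

theorem iter_ret {step : Val → Comp} {T : ℕ} (k : ℕ) (u : ℕ → Val)
    (hstep : ∀ i < k, ∃ t ≤ T, step (u i) = ret (u (i + 1)) t) :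
    ∃ t ≤ k * (T + 1) + 1, iter step k (u 0) = ret (u k) t := by
  induction k generalizing u with
  | zero => exact ⟨1, by omega, rfl⟩
  | succ k ih =>
    obtain ⟨t, ht, h⟩ := hstep 0 (by omega)
    obtain ⟨t', ht', h'⟩ := ih (fun i => u (i + 1)) fun i hi => hstep (i + 1) (by omega)
    refine ⟨t + 1 + t', ?_, ?_⟩
    · rw [Nat.succ_mul]; omega
    · rw [iter, h, ret_seq_ret (t := t) rfl]
      exact ret_seq_ret h'

/-- The step is required only on the states actually reached. Treating it as a computation over
pairs (x, i) with i < K x yields one time bound valid for all rounds. -/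
theorem loop {K : X → ℕ} {st : X → ℕ → Val} (hK : PolyTime M I fun x => .num (K x))
    (bK : PolyBdd M K) (h0 : PolyTime M I fun x => st x 0)
    (hs : PolyTime (X := (x : X) × Fin (K x)) (fun y => M y.1)
      (fun y => .pair (.pair (.num y.2) (st y.1 y.2)) (I y.1)) fun y => st y.1 (y.2 + 1)) :
    PolyTime M I fun x => st x (K x) := by
  obtain ⟨e₀, T₀, hT₀, he₀⟩ := hK.exists_bdd
  obtain ⟨e, T, hT, he⟩ := h0.exists_bdd
  obtain ⟨e', k, he'⟩ := hs
  have hB : PolyBdd M fun x => (M x + 2) ^ k := ⟨k, fun _ => le_rfl⟩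
  -- The language does not expose the round number, so the loop carries the pair (round, state);
  -- inside the body, variable 1 is still the input.
  refine of_bdd (.snd (.loop e₀ (.pair (.lit 0) e)
    (.pair (.op .add (.fst (.var 0)) (.lit 1)) (.letIn (.pair (.var 0) (.var 1)) e'))))
    (((hT₀.add ((hT.add (.const 2)).add ((bK.mul ((bK.add hB).add (.const 20))).add
      (.const 1)))).add (.const 1))) fun x env => ?_
  obtain ⟨t₀, ht₀, h₀⟩ := he₀ x env
  obtain ⟨t, ht, h⟩ := he x env
  have key := iter_ret (step := fun w => (Prog.pair (.op .add (.fst (.var 0)) (.lit 1))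
    (.letIn (.pair (.var 0) (.var 1)) e')).eval (w :: I x :: env))
    (T := K x + (M x + 2) ^ k + 19) (K x) (fun i => Val.pair (.num i) (st x i)) (by
      intro i hi
      obtain ⟨t', ht', h'⟩ := he' ⟨x, i, hi⟩ (Val.pair (.num i) (st x i) :: I x :: env)
      refine ⟨(1 + 1) + (1 + (i.size + Nat.size 1 + 1)) + (((1 + (1 + 1)) + 1 + t') + 1), ?_, ?_⟩
      · have := size_le_self i
        have h1 : Nat.size 1 = 1 := by simp
        have h2 : t' ≤ (M x + 2) ^ k := ht'
        rw [h1]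
        omega
      · have h1 : (Prog.op .add (.fst (.var 0)) (.lit 1)).eval
            (Val.pair (.num i) (st x i) :: I x :: env) =
            ret (.num (i + 1)) ((1 + 1) + (1 + (i.size + Nat.size 1 + 1))) := by
          rw [Prog.eval, Prog.eval, Prog.eval, Prog.eval]
          rw [ret_seq_ret (t := 1) (u := 1) (w := .num i) rfl]
          exact ret_seq_ret (ret_seq_ret rfl)
        have h2 : (Prog.letIn (.pair (.var 0) (.var 1)) e').eval
            (Val.pair (.num i) (st x i) :: I x :: env) =
            ret (st x (i + 1)) ((1 + (1 + 1)) + 1 + t') := by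
          rw [Prog.eval, Prog.eval, Prog.eval, Prog.eval]
          rw [ret_seq_ret (t := 1) (u := 1 + 1)
            (w := .pair (.pair (.num i) (st x i)) (I x)) (ret_seq_ret rfl),
            ret_seq_ret (u := 1) rfl]
          exact ret_seq_ret h'
        rw [Prog.eval, h1]
        refine ret_seq_ret ?_
        rw [h2]
        exact ret_seq_ret rfl)
  obtain ⟨t', ht', h'⟩ := key
  refine ⟨t₀ + ((1 + (t + 1)) + t') + 1, ?_, ?_⟩
  · have h3 : K x * (K x + (M x + 2) ^ k + 19 + 1) = K x * (K x + (M x + 2) ^ k + 20) := rfl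
    omega
  · rw [Prog.eval, Prog.eval, h₀, ret_seq_ret (t := t₀) (u := 1 + (t + 1) + t')
      (w := Val.pair (.num (K x)) (st x (K x)))]
    · exact ret_seq_ret rfl
    · rw [Prog.eval, Prog.eval, ret_seq_ret (t := 1) (u := t + 1)
        (w := Val.pair (.num 0) (st x 0))]
      · exact ret_seq_ret h'
      · rw [h]; exact ret_seq_ret rfl

end PolyTime

end ListRec

end

/-! ### Numbers, predicates and tables computable in polynomial time -/

noncomputable section

namespace ListRec

/-- The list `f 0, …, f (K - 1)`. -/
def Val.tab (K : ℕ) (f : ℕ → Val) : Val := .ofList ((List.range K).map f)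

theorem Val.ofList_ofFn {n : ℕ} (f : Fin n → Val) (g : ℕ → Val) (h : ∀ i : Fin n, f i = g i) :
    Val.ofList (List.ofFn f) = Val.tab n g := by
  rw [Val.tab, funext h]
  congr 1
  apply List.ext_getElem <;> simp

theorem Val.tab_congr {n : ℕ} {f g : ℕ → Val} (h : ∀ i < n, f i = g i) :
    Val.tab n f = Val.tab n g := by
  rw [Val.tab, Val.tab, List.map_congr_left fun i hi => h i (List.mem_range.1 hi)]

/-- Running time parameter of a computation that depends on a further index `i < K x`. -/
abbrev idxM {X : Type*} (K M : X → ℕ) : (x : X) × Fin (K x) → ℕ := fun y => M y.1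

/-- Input of a computation that depends on a further index `i < K x`. -/
abbrev idxI {X : Type*} (K : X → ℕ) (I : X → Val) : (x : X) × Fin (K x) → Val :=
  fun y => .pair (.num y.2) (I y.1)

/-- A number computable in polynomial time and of polynomially bounded length. -/
structure PolyNat {X : Type*} (M : X → ℕ) (I : X → Val) (f : X → ℕ) : Prop where
  time : PolyTime M I fun x => .num (f x)
  bdd : PolyBdd M fun x => (f x).size

/-- A polynomially bounded number computable in polynomial time. -/
structure PolyCount {X : Type*} (M : X → ℕ) (I : X → Val) (f : X → ℕ) : Prop where
  time : PolyTime M I fun x => .num (f x)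
  bdd : PolyBdd M f

open Classical in
/-- A truth value as a datum. -/
def Val.ofProp (P : Prop) : Val := .num (if P then 1 else 0)

/-- A property decidable in polynomial time. -/
def PolyBool {X : Type*} (M : X → ℕ) (I : X → Val) (P : X → Prop) : Prop :=
  PolyTime M I fun x => .ofProp (P x)

section

variable {X Y : Type*} {M : X → ℕ} {I : X → Val} {f g : X → ℕ} {P Q : X → Prop} {K : X → ℕ}

theorem PolyTime.under {f : X → Val} (hf : PolyTime M I f) :
    PolyTime (idxM K M) (idxI K I) fun y => f y.1 := hf.lift (φ := Sigma.fst)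

namespace PolyCount

theorem toNat (hf : PolyCount M I f) : PolyNat M I f :=
  ⟨hf.time, hf.bdd.mono fun _ => size_le_self _⟩

theorem const (c : ℕ) : PolyCount M I fun _ => c := ⟨.num c, .const c⟩

theorem lift {φ : Y → X} {J : Y → Val} (hf : PolyCount M I f) :
    PolyCount (fun y => M (φ y)) (fun y => .pair (J y) (I (φ y))) fun y => f (φ y) :=
  ⟨hf.time.lift, hf.bdd.comap φ⟩

theorem under (hf : PolyCount M I f) : PolyCount (idxM K M) (idxI K I) fun y => f y.1 :=
  hf.lift (φ := Sigma.fst)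

theorem idx (bK : PolyBdd M K) : PolyCount (idxM K M) (idxI K I) fun y => y.2 :=
  ⟨.head (I := fun y : (x : X) × Fin (K x) => I y.1), (bK.comap Sigma.fst).mono fun y => y.2.2.le⟩

theorem of_le (hf : PolyTime M I fun x => .num (f x)) (hg : PolyBdd M g) (h : ∀ x, f x ≤ g x) :
    PolyCount M I f := ⟨hf, hg.mono h⟩

theorem add (hf : PolyCount M I f) (hg : PolyCount M I g) :
    PolyCount M I fun x => f x + g x :=
  ⟨.op .add hf.time hg.time hf.toNat.bdd hg.toNat.bdd, hf.bdd.add hg.bdd⟩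

theorem sub (hf : PolyCount M I f) (hg : PolyCount M I g) :
    PolyCount M I fun x => f x - g x :=
  ⟨.op .sub hf.time hg.time hf.toNat.bdd hg.toNat.bdd, hf.bdd.mono fun _ => Nat.sub_le _ _⟩

theorem mul (hf : PolyCount M I f) (hg : PolyCount M I g) :
    PolyCount M I fun x => f x * g x :=
  ⟨.op .mul hf.time hg.time hf.toNat.bdd hg.toNat.bdd, hf.bdd.mul hg.bdd⟩

theorem div (hf : PolyCount M I f) (hg : PolyCount M I g) :
    PolyCount M I fun x => f x / g x :=
  ⟨.op .div hf.time hg.time hf.toNat.bdd hg.toNat.bdd, hf.bdd.mono fun _ => Nat.div_le_self _ _⟩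

theorem mod (hf : PolyCount M I f) (hg : PolyCount M I g) :
    PolyCount M I fun x => f x % g x :=
  ⟨.op .mod hf.time hg.time hf.toNat.bdd hg.toNat.bdd, hf.bdd.mono fun _ => Nat.mod_le _ _⟩

theorem congr (hf : PolyCount M I f) (h : ∀ x, f x = g x) : PolyCount M I g := by
  rwa [← funext h]

theorem ite [∀ x, Decidable (P x)] (hP : PolyBool M I P) (hf : PolyCount M I f)
    (hg : PolyCount M I g) : PolyCount M I fun x => if P x then f x else g x := by
  refine ⟨(PolyTime.ite hP hf.time hg.time).congr fun x => ?_, (hf.bdd.add hg.bdd).mono fun x => ?_⟩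
  · split_ifs <;> rfl
  · split_ifs <;> omega

theorem sum {f : X → ℕ → ℕ} (hK : PolyCount M I K)
    (hf : PolyCount (idxM K M) (idxI K I) fun y => f y.1 y.2) :
    PolyCount M I fun x => ∑ i ∈ Finset.range (K x), f x i := by
  obtain ⟨k, hk⟩ := hf.bdd
  have hB : PolyBdd M fun x => (M x + 2) ^ k := ⟨k, fun _ => le_rfl⟩
  have hle : ∀ x, ∀ j ≤ K x, ∑ i ∈ Finset.range j, f x i ≤ K x * (M x + 2) ^ k := by
    intro x j hj
    refine (Finset.sum_le_card_nsmul _ _ ((M x + 2) ^ k) fun i hi =>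
      hk ⟨x, i, (Finset.mem_range.1 hi).trans_le hj⟩).trans ?_
    rw [Finset.card_range, smul_eq_mul]
    exact Nat.mul_le_mul_right _ hj
  refine ⟨PolyTime.loop (st := fun x j => .num (∑ i ∈ Finset.range j, f x i)) hK.time hK.bdd
    (.num 0) ?_, (hK.bdd.mul hB).mono fun x => hle x _ le_rfl⟩
  have h1 : PolyTime (fun y : (x : X) × Fin (K x) => M y.1)
      (fun y => .pair (.pair (.num y.2) (.num (∑ i ∈ Finset.range y.2, f y.1 i))) (I y.1))
      fun y => Val.pair (.num y.2) (I y.1) := PolyTime.head.left.pair PolyTime.id.right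
  refine (PolyTime.op .add (PolyTime.head.right) (h1.comp hf.time) ?_ ?_).congr fun y => ?_
  · exact ((hK.bdd.mul hB).comap Sigma.fst).mono fun y =>
      (size_le_self _).trans (hle y.1 _ y.2.2.le)
  · exact hf.toNat.bdd
  · rw [Finset.sum_range_succ]; rfl

end PolyCount

namespace PolyNat

theorem const (c : ℕ) : PolyNat M I fun _ => c := (PolyCount.const c).toNat

theorem lift {φ : Y → X} {J : Y → Val} (hf : PolyNat M I f) :
    PolyNat (fun y => M (φ y)) (fun y => .pair (J y) (I (φ y))) fun y => f (φ y) :=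
  ⟨hf.time.lift, hf.bdd.comap φ⟩

theorem under (hf : PolyNat M I f) : PolyNat (idxM K M) (idxI K I) fun y => f y.1 :=
  hf.lift (φ := Sigma.fst)

theorem add (hf : PolyNat M I f) (hg : PolyNat M I g) : PolyNat M I fun x => f x + g x :=
  ⟨.op .add hf.time hg.time hf.bdd hg.bdd,
    ((hf.bdd.add hg.bdd).add (.const 1)).mono fun _ => size_add_le _ _⟩

theorem sub (hf : PolyNat M I f) (hg : PolyNat M I g) : PolyNat M I fun x => f x - g x :=
  ⟨.op .sub hf.time hg.time hf.bdd hg.bdd, hf.bdd.mono fun _ => Nat.size_le_size (Nat.sub_le _ _)⟩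

theorem mul (hf : PolyNat M I f) (hg : PolyNat M I g) : PolyNat M I fun x => f x * g x :=
  ⟨.op .mul hf.time hg.time hf.bdd hg.bdd, (hf.bdd.add hg.bdd).mono fun _ => size_mul_le _ _⟩

theorem div (hf : PolyNat M I f) (hg : PolyNat M I g) : PolyNat M I fun x => f x / g x :=
  ⟨.op .div hf.time hg.time hf.bdd hg.bdd,
    hf.bdd.mono fun _ => Nat.size_le_size (Nat.div_le_self _ _)⟩

theorem mod (hf : PolyNat M I f) (hg : PolyNat M I g) : PolyNat M I fun x => f x % g x :=
  ⟨.op .mod hf.time hg.time hf.bdd hg.bdd,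
    hf.bdd.mono fun _ => Nat.size_le_size (Nat.mod_le _ _)⟩

theorem size (hf : PolyNat M I f) : PolyCount M I fun x => (f x).size :=
  ⟨hf.time.size hf.bdd, hf.bdd⟩

theorem ite [∀ x, Decidable (P x)] (hP : PolyBool M I P) (hf : PolyNat M I f)
    (hg : PolyNat M I g) : PolyNat M I fun x => if P x then f x else g x := by
  refine ⟨(PolyTime.ite hP hf.time hg.time).congr fun x => ?_, (hf.bdd.add hg.bdd).mono fun x => ?_⟩
  · split_ifs <;> rfl
  · split_ifs <;> omega

theorem pow (hf : PolyNat M I f) (hK : PolyCount M I K) : PolyNat M I fun x => f x ^ K x := by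
  have hB : PolyBdd M fun x => K x * (f x).size + 1 := (hK.bdd.mul hf.bdd).add (.const 1)
  refine ⟨PolyTime.loop (st := fun x j => .num (f x ^ j)) hK.time hK.bdd (.num 1) ?_,
    hB.mono fun x => size_pow_le _ _⟩
  refine (PolyTime.op .mul (PolyTime.head.right)
    (hf.time.lift (φ := fun y : (x : X) × Fin (K x) => y.1)) ?_ ?_).congr fun y => ?_
  · refine (hB.comap Sigma.fst).mono fun y => (size_pow_le _ _).trans ?_
    exact Nat.succ_le_succ (Nat.mul_le_mul_right _ y.2.2.le)
  · exact hf.bdd.comap Sigma.fst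
  · rw [pow_succ]; rfl

/-- Uses C(n, j+1) = C(n, j)(n - j)/(j + 1): the division is exact, and C(n, j) ≤ 2^n bounds the
length of all intermediate values. -/
theorem choose (hf : PolyCount M I f) (hg : PolyCount M I g) :
    PolyNat M I fun x => (f x).choose (g x) := by
  have hb : ∀ x j, Nat.size ((f x).choose j) ≤ f x + 1 := fun x j =>
    (Nat.size_le_size (Nat.choose_le_two_pow _ _)).trans (by rw [Nat.size_pow])
  have hB : PolyBdd M fun x => f x + 1 := hf.bdd.add (.const 1)
  refine ⟨PolyTime.loop (st := fun x j => .num ((f x).choose j)) hg.time hg.bdd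
    ((PolyTime.num 1).congr fun x => by simp) ?_, hB.mono fun x => hb _ _⟩
  have h1 : PolyNat (fun y : (x : X) × Fin (g x) => M y.1)
      (fun y => .pair (.pair (.num y.2) (.num ((f y.1).choose y.2))) (I y.1))
      fun y => (f y.1).choose y.2 :=
    ⟨PolyTime.head.right, (hB.comap Sigma.fst).mono fun y => hb _ _⟩
  have h2 : PolyNat (fun y : (x : X) × Fin (g x) => M y.1)
      (fun y => .pair (.pair (.num y.2) (.num ((f y.1).choose y.2))) (I y.1))
      fun y => (y.2 : ℕ) :=
    ⟨PolyTime.head.left, (hg.bdd.comap Sigma.fst).mono fun y =>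
      (size_le_self _).trans y.2.2.le⟩
  refine ((h1.mul (hf.toNat.lift.sub h2)).div (h2.add (.const 1))).time.congr fun y => ?_
  congr 1
  rw [← Nat.choose_succ_right_eq, Nat.mul_div_cancel _ (Nat.succ_pos _)]

end PolyNat

namespace PolyBool

theorem congr (hP : PolyBool M I P) (h : ∀ x, P x ↔ Q x) : PolyBool M I Q := by
  rwa [← funext fun x => propext (h x)]

theorem lift {φ : Y → X} {J : Y → Val} (hP : PolyBool M I P) :
    PolyBool (fun y => M (φ y)) (fun y => .pair (J y) (I (φ y))) fun y => P (φ y) :=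
  PolyTime.lift hP

theorem under (hP : PolyBool M I P) : PolyBool (idxM K M) (idxI K I) fun y => P y.1 :=
  hP.lift (φ := Sigma.fst)

theorem eq (hf : PolyNat M I f) (hg : PolyNat M I g) : PolyBool M I fun x => f x = g x :=
  (PolyTime.op .eq hf.time hg.time hf.bdd hg.bdd).congr fun x => by
    simp only [BinOp.eval, Val.ofProp]; congr

theorem lt (hf : PolyNat M I f) (hg : PolyNat M I g) : PolyBool M I fun x => f x < g x :=
  (PolyTime.op .lt hf.time hg.time hf.bdd hg.bdd).congr fun x => by
    simp only [BinOp.eval, Val.ofProp]; congr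

theorem not (hP : PolyBool M I P) : PolyBool M I fun x => ¬ P x :=
  (PolyTime.ite hP (.num 0) (.num 1)).congr fun x => by
    by_cases h : P x <;> simp [Val.ofProp, h]

theorem and (hP : PolyBool M I P) (hQ : PolyBool M I Q) : PolyBool M I fun x => P x ∧ Q x :=
  (PolyTime.ite hP hQ (.num 0)).congr fun x => by
    by_cases h : P x <;> by_cases h' : Q x <;> simp [Val.ofProp, h, h']

theorem forall_lt {P : X → ℕ → Prop} (hK : PolyCount M I K)
    (hP : PolyBool (idxM K M) (idxI K I) fun y => P y.1 y.2) :
    PolyBool M I fun x => ∀ i < K x, P x i := by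
  refine PolyTime.loop (st := fun x j => .ofProp (∀ i < j, P x i)) hK.time hK.bdd
    ((PolyTime.num 1).congr fun x => by simp [Val.ofProp]) ?_
  have h1 : PolyTime (fun y : (x : X) × Fin (K x) => M y.1)
      (fun y => .pair (.pair (.num y.2) (.ofProp (∀ i < (y.2 : ℕ), P y.1 i))) (I y.1))
      fun y => Val.pair (.num y.2) (I y.1) := PolyTime.head.left.pair PolyTime.id.right
  have h2 : PolyBool (fun y : (x : X) × Fin (K x) => M y.1)
      (fun y => .pair (.pair (.num y.2) (.ofProp (∀ i < (y.2 : ℕ), P y.1 i))) (I y.1))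
      fun y => ∀ i < (y.2 : ℕ), P y.1 i :=
    PolyTime.head.right
  refine (h2.and (h1.comp hP)).congr fun y => ?_
  constructor
  · rintro ⟨h, h'⟩ i hi
    rcases Nat.lt_succ_iff_lt_or_eq.1 hi with h1 | h1
    · exact h i h1
    · rw [h1]; exact h'
  · exact fun h => ⟨fun i hi => h i (by omega), h _ (by omega)⟩

theorem exists_lt {P : X → ℕ → Prop} (hK : PolyCount M I K)
    (hP : PolyBool (idxM K M) (idxI K I) fun y => P y.1 y.2) :
    PolyBool M I fun x => ∃ i < K x, P x i :=
  (forall_lt (P := fun x i => ¬ P x i) hK hP.not).not.congr fun x => by push Not; rfl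

end PolyBool

open Classical in
/-- The largest `i < k` with `P i`, or `0` if there is none. -/
def lastIdx (P : ℕ → Prop) : ℕ → ℕ
  | 0 => 0
  | k + 1 => if P k then k else lastIdx P k

theorem lastIdx_spec {P : ℕ → Prop} {k i : ℕ} (hi : i < k) (h : P i) : P (lastIdx P k) := by
  induction k with
  | zero => omega
  | succ k ih =>
    rw [lastIdx]
    split_ifs with hk
    · exact hk
    · refine ih (lt_of_le_of_ne (by omega) ?_)
      rintro rfl
      exact hk h

theorem lastIdx_lt (P : ℕ → Prop) {k : ℕ} (hk : 0 < k) : lastIdx P k < k := by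
  induction k with
  | zero => omega
  | succ k ih =>
    rw [lastIdx]
    split_ifs
    · omega
    · rcases Nat.eq_zero_or_pos k with rfl | h
      · simp [lastIdx]
      · exact (ih h).trans (by omega)

theorem lastIdx_le (P : ℕ → Prop) (k : ℕ) : lastIdx P k ≤ k := by
  rcases Nat.eq_zero_or_pos k with rfl | h
  · simp [lastIdx]
  · exact (lastIdx_lt P h).le

theorem PolyCount.lastIdx {P : X → ℕ → Prop} (hK : PolyCount M I K)
    (hP : PolyBool (idxM K M) (idxI K I) fun y => P y.1 y.2) :
    PolyCount M I fun x => lastIdx (P x) (K x) := by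
  refine ⟨PolyTime.loop (st := fun x j => .num (ListRec.lastIdx (P x) j)) hK.time hK.bdd
    (.num 0) ?_, hK.bdd.mono fun x => lastIdx_le _ _⟩
  have h1 : PolyTime (fun y : (x : X) × Fin (K x) => M y.1)
      (fun y => .pair (.pair (.num y.2) (.num (ListRec.lastIdx (P y.1) y.2))) (I y.1))
      fun y => Val.pair (.num y.2) (I y.1) := PolyTime.head.left.pair PolyTime.id.right
  refine (PolyTime.ite (h1.comp hP) PolyTime.head.left PolyTime.head.right).congr fun y => ?_
  rw [ListRec.lastIdx]
  split_ifs <;> rfl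

theorem Val.right_iterate_ofList (l : List Val) (i : ℕ) :
    Val.right^[i] (.ofList l) = .ofList (l.drop i) := by
  induction i generalizing l with
  | zero => rfl
  | succ i ih => cases l with
    | nil => rw [Function.iterate_succ_apply]; exact (ih []).trans (by simp)
    | cons v l => rw [Function.iterate_succ_apply]; exact ih l

namespace PolyTime

theorem nth {f : X → ℕ → Val} {i : X → ℕ} (hf : PolyTime M I fun x => Val.tab (K x) (f x))
    (hi : PolyCount M I i) (h : ∀ x, i x < K x) : PolyTime M I fun x => f x (i x) := by
  have := PolyTime.loop (st := fun x j => Val.right^[j] (Val.tab (K x) (f x))) hi.time hi.bdd hf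
    (PolyTime.head.right.right.congr fun y => by rw [Function.iterate_succ_apply']; rfl)
  refine this.left.congr fun x => ?_
  rw [Val.tab, Val.right_iterate_ofList, List.drop_eq_getElem_cons (by simpa using h x)]
  simp [Val.ofList, Val.left]

-- Lists grow at the head, so round j treats the index K - 1 - j, and the state after j rounds is
-- the filtered list of the last j indices. The map `φ` in the proof is this reversal.
open Classical in
theorem filterTab {f : X → ℕ → Val} {P : X → ℕ → Prop} (hK : PolyCount M I K)
    (hP : PolyBool (idxM K M) (idxI K I) fun y => P y.1 y.2)
    (hf : PolyTime (idxM K M) (idxI K I) fun y => f y.1 y.2) :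
    PolyTime M I fun x => Val.ofList (((List.range (K x)).filter (P x)).map (f x)) := by
  have hmain := PolyTime.loop (M := M) (I := I) (K := K)
    (st := fun x j => Val.ofList (((List.range' (K x - j) j).filter (P x)).map (f x)))
    hK.time hK.bdd ((PolyTime.num 0).congr fun x => by simp [Val.ofList]) ?_
  · refine hmain.congr fun x => ?_
    rw [Nat.sub_self, ← List.range_eq_range']
  let J : (x : X) × Fin (K x) → Val := fun y => .pair (.pair (.num y.2) (Val.ofList
    (((List.range' (K y.1 - y.2) y.2).filter (P y.1)).map (f y.1)))) (I y.1)
  let φ : (x : X) × Fin (K x) → (x : X) × Fin (K x) := fun y =>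
    ⟨y.1, K y.1 - (y.2 + 1), by omega⟩
  have hidx : PolyCount (fun y : (x : X) × Fin (K x) => M y.1) J fun y => (y.2 : ℕ) :=
    ⟨PolyTime.head.left, (hK.bdd.comap Sigma.fst).mono fun y => y.2.2.le⟩
  have h1 : PolyTime (fun y : (x : X) × Fin (K x) => M y.1) J
      fun y => Val.pair (.num ((φ y).2 : ℕ)) (I (φ y).1) :=
    ((hK.lift (φ := fun y : (x : X) × Fin (K x) => y.1)).sub (hidx.add (.const 1))).time.pair
      PolyTime.id.right
  have h2 := h1.comp (PolyTime.comap φ hP)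
  have h3 := h1.comp (PolyTime.comap φ hf)
  refine (PolyTime.ite h2 (h3.pair PolyTime.head.right) PolyTime.head.right).congr fun y => ?_
  have h4 : K y.1 - ((y.2 : ℕ) + 1) + 1 = K y.1 - y.2 := by have := y.2.2; omega
  rw [List.range'_succ, h4, List.filter_cons]
  show (if P y.1 (K y.1 - ((y.2 : ℕ) + 1)) then _ else _) = _
  by_cases hp : P y.1 (K y.1 - ((y.2 : ℕ) + 1))
  · simp only [hp, if_true, decide_true]; rfl
  · simp only [hp, if_false, decide_false]; rfl

theorem tab {f : X → ℕ → Val} (hK : PolyCount M I K)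
    (hf : PolyTime (idxM K M) (idxI K I) fun y => f y.1 y.2) :
    PolyTime M I fun x => Val.tab (K x) (f x) :=
  (filterTab (P := fun _ _ => True) hK ((PolyTime.num 1).congr fun _ => by simp [Val.ofProp]) hf).congr
    fun x => by simp [Val.tab]

end PolyTime

end

end ListRec

end

noncomputable section

namespace ListRec

universe u

/-! ### Arithmetic in a presented finite field -/

/-- A field presented by a power basis over a prime field. -/
structure FieldData : Type (u + 1) where
  /-- the characteristic -/
  p : ℕ
  /-- the field -/
  F : Type u
  [prime : Fact p.Prime]
  [field : Field F]
  [algebra : Algebra (ZMod p) F]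
  /-- the presentation -/
  B : PowerBasis (ZMod p) F

attribute [instance] FieldData.prime FieldData.field FieldData.algebra

section Coord

variable {p : ℕ} {F : Type*} [Field F] [Algebra (ZMod p) F] (B : PowerBasis (ZMod p) F)

/-- The `i`-th coordinate of a field element. -/
def coord (x : F) (i : ℕ) : ℕ := if h : i < B.dim then (B.basis.repr x ⟨i, h⟩).val else 0

theorem coord_of_lt (x : F) {i : ℕ} (h : i < B.dim) : coord B x i = (B.basis.repr x ⟨i, h⟩).val :=
  dif_pos h

theorem encElem_eq (x : F) : encElem B x = .tab B.dim fun i => .num (coord B x i) :=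
  Val.ofList_ofFn _ _ fun i => by rw [coord_of_lt B x i.2]

theorem encModulus_eq : encModulus B =
    .tab (B.dim + 1) fun i => .num ((minpoly (ZMod p) B.gen).coeff i).val :=
  Val.ofList_ofFn _ _ fun _ => rfl

theorem coord_zero (i : ℕ) : coord B 0 i = 0 := by simp [coord]

theorem coord_injective [NeZero p] {x y : F} (h : ∀ i < B.dim, coord B x i = coord B y i) :
    x = y := by
  apply B.basis.repr.injective
  ext i
  have := h i i.2
  rw [coord_of_lt B x i.2, coord_of_lt B y i.2] at this
  exact ZMod.val_injective p this

theorem dim_pos : 0 < B.dim := B.dim_pos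

variable [Fact p.Prime]

theorem coord_lt (x : F) (i : ℕ) : coord B x i < p := by
  rw [coord]
  split_ifs
  · exact ZMod.val_lt _
  · exact (Fact.out : p.Prime).pos

theorem coord_add (x y : F) {i : ℕ} (h : i < B.dim) :
    coord B (x + y) i = (coord B x i + coord B y i) % p := by
  simp only [coord_of_lt B _ h, map_add, Finsupp.add_apply, ZMod.val_add]

theorem coord_neg (x : F) {i : ℕ} (h : i < B.dim) :
    coord B (-x) i = (p - coord B x i) % p := by
  simp only [coord_of_lt B _ h, map_neg, Finsupp.neg_apply, ZMod.neg_val']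

theorem coord_natCast_mul (c : ℕ) (x : F) {i : ℕ} (h : i < B.dim) :
    coord B (c * x) i = (c * coord B x i) % p := by
  have h1 : (c : F) * x = (c : ZMod p) • x := by
    rw [Algebra.smul_def, map_natCast]
  simp only [coord_of_lt B _ h, h1, map_smul, Finsupp.smul_apply, smul_eq_mul, ZMod.val_mul,
    ZMod.val_natCast, Nat.mod_mul_mod]

theorem coord_one {i : ℕ} (h : i < B.dim) : coord B 1 i = if i = 0 then 1 else 0 := by
  have h1 : (1 : F) = B.basis ⟨0, dim_pos B⟩ := by simp
  rw [coord_of_lt B _ h, h1, B.basis.repr_self, Finsupp.single_apply]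
  have : Fact (1 < p) := ⟨(Fact.out : p.Prime).one_lt⟩
  by_cases hi : i = 0
  · subst hi; simp [ZMod.val_one]
  · have : ¬ ((⟨0, dim_pos B⟩ : Fin B.dim) = ⟨i, h⟩) := by
      intro h2; exact hi (Fin.ext_iff.1 h2).symm
    simp [this, hi]

theorem sum_coord (x : F) : ∑ i ∈ Finset.range B.dim, (coord B x i : F) * B.gen ^ i = x := by
  conv_rhs => rw [← B.basis.sum_repr x]
  rw [Finset.sum_range]
  refine Finset.sum_congr rfl fun i _ => ?_
  rw [coord_of_lt B x i.2, B.basis_eq_pow, Algebra.smul_def]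
  congr 1
  rw [← map_natCast (algebraMap (ZMod p) F), ZMod.natCast_zmod_val]

theorem repr_gen_pow (j : ℕ) (hj : j < B.dim) (i : Fin B.dim) :
    B.basis.repr (B.gen ^ j) i = if (i : ℕ) = j then 1 else 0 := by
  have : B.gen ^ j = B.basis ⟨j, hj⟩ := by rw [B.basis_eq_pow]
  rw [this, B.basis.repr_self, Finsupp.single_apply]
  simp only [Fin.ext_iff, eq_comm]

theorem repr_gen_pow_dim (i : Fin B.dim) :
    B.basis.repr (B.gen ^ B.dim) i = - (minpoly (ZMod p) B.gen).coeff i := by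
  have hdeg : (minpoly (ZMod p) B.gen).natDegree = B.dim := B.natDegree_minpoly
  have hm : (minpoly (ZMod p) B.gen).coeff B.dim = 1 := by
    have := (minpoly.monic B.isIntegral_gen).coeff_natDegree
    rwa [hdeg] at this
  have h0 := minpoly.aeval (ZMod p) B.gen
  rw [aeval_eq_sum_range, hdeg, Finset.sum_range_succ, hm, one_smul] at h0
  rw [eq_neg_of_add_eq_zero_right h0, map_neg, map_sum, Finsupp.neg_apply, Finset.sum_range,
    Finsupp.finsetSum_apply]
  congr 1
  rw [Finset.sum_eq_single i]
  · simp [repr_gen_pow]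
  · intro j _ hj
    have : ¬ ((i : ℕ) = (j : ℕ)) := fun h => hj (Fin.ext h.symm)
    simp [repr_gen_pow, this]
  · simp

/-- Multiplication by θ shifts the coordinates, and the top one re-enters through the relation given
by the minimal polynomial. Its negated coefficients are written p - c to stay within natural
numbers. -/
theorem coord_gen_mul (x : F) {i : ℕ} (h : i < B.dim) : coord B (B.gen * x) i =
    ((if i = 0 then 0 else coord B x (i - 1)) +
      coord B x (B.dim - 1) * (p - ((minpoly (ZMod p) B.gen).coeff i).val)) % p := by
  have hd := dim_pos B
  rw [coord_of_lt B _ h]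
  have h1 : B.gen * x = ∑ j ∈ Finset.range B.dim, (coord B x j : ZMod p) • B.gen ^ (j + 1) := by
    conv_lhs => rw [← sum_coord B x, Finset.mul_sum]
    refine Finset.sum_congr rfl fun j _ => ?_
    rw [Algebra.smul_def, map_natCast, pow_succ]
    ring
  have h2 : B.basis.repr (B.gen * x) ⟨i, h⟩ =
      (if i = 0 then 0 else (coord B x (i - 1) : ZMod p)) -
        coord B x (B.dim - 1) * (minpoly (ZMod p) B.gen).coeff i := by
    obtain ⟨m, hm⟩ : ∃ m, B.dim = m + 1 := ⟨B.dim - 1, by omega⟩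
    rw [h1, map_sum, Finsupp.finsetSum_apply]
    have h3 : Finset.range B.dim = insert (B.dim - 1) (Finset.range (B.dim - 1)) := by
      rw [← Finset.range_add_one]; congr 1; omega
    rw [h3, Finset.sum_insert (by simp), add_comm, sub_eq_add_neg]
    congr 1
    · split_ifs with hi
      · refine Finset.sum_eq_zero fun j hj => ?_
        rw [Finset.mem_range] at hj
        rw [map_smul, Finsupp.smul_apply, repr_gen_pow B (j + 1) (by omega), if_neg (by simp [hi]),
          smul_zero]
      · rw [Finset.sum_eq_single (i - 1)]
        · rw [map_smul, Finsupp.smul_apply, repr_gen_pow B _ (by omega),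
            if_pos (by show i = _; omega)]
          simp
        · intro j hj hne
          rw [Finset.mem_range] at hj
          rw [map_smul, Finsupp.smul_apply, repr_gen_pow B (j + 1) (by omega),
            if_neg (by show ¬ (i = _); omega), smul_zero]
        · intro hi'
          exfalso
          apply hi'
          rw [Finset.mem_range]
          omega
    · rw [Nat.sub_add_cancel hd, map_smul, Finsupp.smul_apply, repr_gen_pow_dim, smul_eq_mul]
      ring
  rw [h2]
  have hle : ((minpoly (ZMod p) B.gen).coeff i).val ≤ p := (ZMod.val_lt _).le
  rw [← ZMod.val_natCast]
  congr 1
  push_cast [Nat.cast_sub hle]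
  rw [ZMod.natCast_self, ZMod.natCast_zmod_val]
  ring

end Coord

/-! ### Field operations in polynomial time -/

section

variable {X Y : Type*} {M : X → ℕ} {I : X → Val} {Φ : X → FieldData.{u}} {K : X → ℕ}

/-- The description of a field can be computed from the input. -/
structure FieldCtx (M : X → ℕ) (I : X → Val) (Φ : X → FieldData.{u}) : Prop where
  p : PolyNat M I fun x => (Φ x).p
  dim : PolyCount M I fun x => (Φ x).B.dim
  modulus : PolyTime M I fun x => encModulus (Φ x).B

/-- A field element computable in polynomial time. -/
def PolyElem (M : X → ℕ) (I : X → Val) (Φ : X → FieldData.{u}) (f : ∀ x, (Φ x).F) : Prop :=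
  PolyTime M I fun x => encElem (Φ x).B (f x)

theorem FieldCtx.lift {φ : Y → X} {J : Y → Val} (h : FieldCtx M I Φ) :
    FieldCtx (fun y => M (φ y)) (fun y => .pair (J y) (I (φ y))) fun y => Φ (φ y) :=
  ⟨h.p.lift, h.dim.lift, h.modulus.lift⟩

theorem FieldCtx.under (h : FieldCtx M I Φ) :
    FieldCtx (idxM K M) (idxI K I) fun y => Φ y.1 := h.lift (φ := Sigma.fst)

namespace PolyElem

variable {f g : ∀ x, (Φ x).F}

theorem congr (hf : PolyElem M I Φ f) (h : ∀ x, f x = g x) : PolyElem M I Φ g := by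
  rwa [← funext h]

theorem comap (φ : Y → X) (hf : PolyElem M I Φ f) :
    PolyElem (fun y => M (φ y)) (fun y => I (φ y)) (fun y => Φ (φ y)) fun y => f (φ y) :=
  PolyTime.comap φ hf

theorem lift {φ : Y → X} {J : Y → Val} (hf : PolyElem M I Φ f) :
    PolyElem (fun y => M (φ y)) (fun y => .pair (J y) (I (φ y))) (fun y => Φ (φ y))
      fun y => f (φ y) := PolyTime.lift hf

theorem under (hf : PolyElem M I Φ f) :
    PolyElem (idxM K M) (idxI K I) (fun y => Φ y.1) fun y => f y.1 := hf.lift (φ := Sigma.fst)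

theorem ite {P : X → Prop} [∀ x, Decidable (P x)] (hP : PolyBool M I P) (hf : PolyElem M I Φ f)
    (hg : PolyElem M I Φ g) : PolyElem M I Φ fun x => if P x then f x else g x :=
  (PolyTime.ite hP hf hg).congr fun x => by by_cases h : P x <;> simp [h]

theorem nth {f : ∀ x, ℕ → (Φ x).F} {i : X → ℕ}
    (hf : PolyTime M I fun x => .tab (K x) fun j => encElem (Φ x).B (f x j))
    (hi : PolyCount M I i) (h : ∀ x, i x < K x) : PolyElem M I Φ fun x => f x (i x) :=
  PolyTime.nth (f := fun x j => encElem (Φ x).B (f x j)) hf hi h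

theorem coord (hΦ : FieldCtx M I Φ) (hf : PolyElem M I Φ f) {i : X → ℕ} (hi : PolyCount M I i)
    (h : ∀ x, i x < (Φ x).B.dim) : PolyNat M I fun x => coord (Φ x).B (f x) (i x) := by
  refine ⟨PolyTime.nth (K := fun x => (Φ x).B.dim)
    (f := fun x i => .num (ListRec.coord (Φ x).B (f x) i)) ?_ hi h,
    hΦ.p.bdd.mono fun x => Nat.size_le_size (coord_lt _ _ _).le⟩
  exact PolyTime.congr hf fun x => encElem_eq _ _

theorem of_coord (hΦ : FieldCtx M I Φ) {c : X → ℕ → ℕ}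
    (hc : PolyNat (idxM (fun x => (Φ x).B.dim) M) (idxI (fun x => (Φ x).B.dim) I)
      fun y => c y.1 y.2) (h : ∀ x, ∀ i < (Φ x).B.dim, ListRec.coord (Φ x).B (f x) i = c x i) :
    PolyElem M I Φ f :=
  (PolyTime.tab (f := fun x i => .num (c x i)) hΦ.dim hc.time).congr fun x => by
    rw [encElem_eq]
    exact Val.tab_congr fun i hi => by rw [h x i hi]

theorem coord_idx (hΦ : FieldCtx M I Φ) (hf : PolyElem M I Φ f) :
    PolyNat (idxM (fun x => (Φ x).B.dim) M) (idxI (fun x => (Φ x).B.dim) I)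
      fun y => ListRec.coord (Φ y.1).B (f y.1) y.2 :=
  PolyElem.coord hΦ.under hf.under (.idx hΦ.dim.bdd) fun y => y.2.2

theorem zero (hΦ : FieldCtx M I Φ) : PolyElem M I Φ fun _ => 0 :=
  of_coord (c := fun _ _ => 0) hΦ (.const 0) fun _ _ _ => coord_zero _ _

theorem one (hΦ : FieldCtx M I Φ) : PolyElem M I Φ fun _ => 1 :=
  of_coord (c := fun _ i => if i = 0 then 1 else 0) hΦ
    (PolyNat.ite (PolyBool.eq (PolyCount.idx hΦ.dim.bdd).toNat (.const 0)) (.const 1) (.const 0))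
    fun _ _ h => coord_one _ h

theorem add (hΦ : FieldCtx M I Φ) (hf : PolyElem M I Φ f) (hg : PolyElem M I Φ g) :
    PolyElem M I Φ fun x => f x + g x :=
  of_coord (c := fun x i => (ListRec.coord (Φ x).B (f x) i + ListRec.coord (Φ x).B (g x) i) %
    (Φ x).p) hΦ (((hf.coord_idx hΦ).add (hg.coord_idx hΦ)).mod hΦ.p.under)
    fun _ _ h => coord_add _ _ _ h

theorem neg (hΦ : FieldCtx M I Φ) (hf : PolyElem M I Φ f) : PolyElem M I Φ fun x => - f x :=
  of_coord (c := fun x i => ((Φ x).p - ListRec.coord (Φ x).B (f x) i) % (Φ x).p) hΦ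
    ((hΦ.p.under.sub (hf.coord_idx hΦ)).mod hΦ.p.under) fun _ _ h => coord_neg _ _ h

theorem sub (hΦ : FieldCtx M I Φ) (hf : PolyElem M I Φ f) (hg : PolyElem M I Φ g) :
    PolyElem M I Φ fun x => f x - g x :=
  (hf.add hΦ (hg.neg hΦ)).congr fun _ => (sub_eq_add_neg _ _).symm

theorem natCast_mul (hΦ : FieldCtx M I Φ) {c : X → ℕ} (hc : PolyNat M I c)
    (hf : PolyElem M I Φ f) : PolyElem M I Φ fun x => (c x : (Φ x).F) * f x :=
  of_coord (c := fun x i => (c x * ListRec.coord (Φ x).B (f x) i) % (Φ x).p) hΦ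
    ((hc.under.mul (hf.coord_idx hΦ)).mod hΦ.p.under) fun _ _ h => coord_natCast_mul _ _ _ h

theorem gen_mul (hΦ : FieldCtx M I Φ) (hf : PolyElem M I Φ f) :
    PolyElem M I Φ fun x => (Φ x).B.gen * f x := by
  refine of_coord (c := fun x i => ((if i = 0 then 0 else ListRec.coord (Φ x).B (f x) (i - 1)) +
      ListRec.coord (Φ x).B (f x) ((Φ x).B.dim - 1) *
        ((Φ x).p - ((minpoly (ZMod (Φ x).p) (Φ x).B.gen).coeff i).val)) % (Φ x).p) hΦ ?_
    fun _ _ h => coord_gen_mul _ _ h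
  have hi : PolyCount (idxM (fun x => (Φ x).B.dim) M) (idxI (fun x => (Φ x).B.dim) I)
    fun y => y.2 := .idx hΦ.dim.bdd
  refine ((PolyNat.ite (PolyBool.eq hi.toNat (.const 0)) (.const 0)
    (PolyElem.coord hΦ.under hf.under (hi.sub (.const 1)) fun y => ?_)).add
    (((hf.coord hΦ (hΦ.dim.sub (.const 1)) fun x => ?_).under).mul
      (hΦ.p.under.sub ?_))).mod hΦ.p.under
  · have := y.2.2; omega
  · have := dim_pos (Φ x).B; omega
  · refine ⟨PolyTime.nth (K := fun y => (Φ y.1).B.dim + 1) (f := fun y i =>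
      .num ((minpoly (ZMod (Φ y.1).p) (Φ y.1).B.gen).coeff i).val) ?_ hi fun y => ?_, ?_⟩
    · exact hΦ.modulus.under.congr fun y => encModulus_eq _
    · have := y.2.2; omega
    · exact hΦ.p.under.bdd.mono fun x => Nat.size_le_size (ZMod.val_lt _).le

/-- Extended input carrying a loop state that is a field element. -/
theorem state_elem (st : ∀ x, ℕ → (Φ x).F) :
    PolyElem (fun y : (x : X) × Fin (K x) => M y.1)
      (fun y => .pair (.pair (.num y.2) (encElem (Φ y.1).B (st y.1 y.2))) (I y.1))
      (fun y => Φ y.1) fun y => st y.1 y.2 :=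
  PolyTime.head.right

theorem state_idx {v : (x : X) × Fin (K x) → Val} (bK : PolyBdd M K) :
    PolyCount (fun y : (x : X) × Fin (K x) => M y.1)
      (fun y => .pair (.pair (.num y.2) (v y)) (I y.1)) fun y => y.2 :=
  ⟨PolyTime.head.left, (bK.comap Sigma.fst).mono fun y => y.2.2.le⟩

theorem loop {st : ∀ x, ℕ → (Φ x).F} (hK : PolyCount M I K) (h0 : PolyElem M I Φ fun x => st x 0)
    (hs : PolyElem (X := (x : X) × Fin (K x)) (fun y => M y.1)
      (fun y => .pair (.pair (.num y.2) (encElem (Φ y.1).B (st y.1 y.2))) (I y.1))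
      (fun y => Φ y.1) fun y => st y.1 (y.2 + 1)) :
    PolyElem M I Φ fun x => st x (K x) :=
  PolyTime.loop (st := fun x j => encElem (Φ x).B (st x j)) hK.time hK.bdd h0 hs

theorem sum {f : ∀ x, ℕ → (Φ x).F} (hΦ : FieldCtx M I Φ) (hK : PolyCount M I K)
    (hf : PolyElem (idxM K M) (idxI K I) (fun y => Φ y.1) fun y => f y.1 y.2) :
    PolyElem M I Φ fun x => ∑ i ∈ Finset.range (K x), f x i := by
  let st : ∀ x, ℕ → (Φ x).F := fun x j => ∑ i ∈ Finset.range j, f x i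
  refine loop (st := st) hK
    ((zero hΦ).congr fun x => by simp [st]) ?_
  have h1 : PolyTime (fun y : (x : X) × Fin (K x) => M y.1)
      (fun y => .pair (.pair (.num y.2) (encElem (Φ y.1).B (st y.1 y.2)))
        (I y.1)) fun y => Val.pair (.num y.2) (I y.1) := PolyTime.head.left.pair PolyTime.id.right
  have h2 : PolyElem (fun y : (x : X) × Fin (K x) => M y.1)
      (fun y => .pair (.pair (.num y.2) (encElem (Φ y.1).B (st y.1 y.2)))
        (I y.1)) (fun y => Φ y.1) fun y => f y.1 y.2 := h1.comp hf
  exact (add hΦ.lift (state_elem st) h2).congr fun y => (Finset.sum_range_succ _ _).symm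

/-- Horner's scheme in θ: the state after j rounds accounts for the top j coordinates of the first
factor, so that only multiplication by θ and by integers is needed. -/
theorem mul (hΦ : FieldCtx M I Φ) (hf : PolyElem M I Φ f) (hg : PolyElem M I Φ g) :
    PolyElem M I Φ fun x => f x * g x := by
  let st : ∀ x, ℕ → (Φ x).F := fun x j => ∑ i ∈ Finset.range j,
    (ListRec.coord (Φ x).B (f x) ((Φ x).B.dim - j + i) : (Φ x).F) * ((Φ x).B.gen ^ i * g x)
  have key := loop (M := M) (I := I) (K := fun x => (Φ x).B.dim) (st := st) hΦ.dim
    ((zero hΦ).congr fun x => by simp [st]) ?_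
  · refine key.congr fun x => ?_
    conv_rhs => rw [← sum_coord (Φ x).B (f x), Finset.sum_mul]
    refine Finset.sum_congr rfl fun i _ => ?_
    rw [Nat.sub_self, zero_add, mul_assoc]
  · refine (add hΦ.lift (gen_mul hΦ.lift (state_elem st)) (natCast_mul hΦ.lift
      (PolyElem.coord hΦ.lift hf.lift (hΦ.dim.lift.sub ((state_idx hΦ.dim.bdd).add (.const 1)))
        fun y => ?_) hg.lift)).congr fun y => ?_
    · have := y.2.2
      show (Φ y.1).B.dim - (y.2 + 1) < (Φ y.1).B.dim
      omega
    · simp only [st]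
      rw [Finset.sum_range_succ', pow_zero, one_mul, Nat.add_zero, Finset.mul_sum]
      congr 1
      refine Finset.sum_congr rfl fun i _ => ?_
      have h1 : (Φ y.1).B.dim - ((y.2 : ℕ) + 1) + (i + 1) = (Φ y.1).B.dim - y.2 + i := by
        have := y.2.2; omega
      rw [h1, pow_succ]
      ring

/-- Repeated squaring, reading the bits of the exponent from the top. The number of rounds is a bit
length, so the exponent itself may be exponentially large, as inversion requires. -/
theorem pow (hΦ : FieldCtx M I Φ) (hf : PolyElem M I Φ f) {e : X → ℕ} (he : PolyNat M I e) :
    PolyElem M I Φ fun x => f x ^ e x := by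
  let st : ∀ x, ℕ → (Φ x).F := fun x j => f x ^ (e x / 2 ^ ((e x).size - j))
  have key := loop (M := M) (I := I) (K := fun x => (e x).size) (st := st) he.size
    ((one hΦ).congr fun x => ?_) ?_
  · exact key.congr fun x => by simp [st]
  · simp only [st]
    rw [Nat.sub_zero, Nat.div_eq_of_lt (Nat.lt_size_self _), pow_zero]
  · refine (mul hΦ.lift (mul hΦ.lift (state_elem st) (state_elem st)) (ite (PolyBool.eq
      ((he.lift.div (PolyNat.pow (.const 2) (he.size.lift.sub ((state_idx he.bdd).add
        (.const 1))))).mod (.const 2)) (.const 1)) hf.lift (one hΦ.lift))).congr fun y => ?_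
    have h1 : (e y.1).size - (y.2 : ℕ) = (e y.1).size - ((y.2 : ℕ) + 1) + 1 := by
      have := y.2.2; omega
    have h2 : ∀ z : (Φ y.1).F, ∀ a b : ℕ, z ^ (a / 2 ^ (b + 1)) * z ^ (a / 2 ^ (b + 1)) *
        (if a / 2 ^ b % 2 = 1 then z else 1) = z ^ (a / 2 ^ b) := by
      intro z a b
      have h3 : a / 2 ^ b = a / 2 ^ (b + 1) + a / 2 ^ (b + 1) + a / 2 ^ b % 2 := by
        rw [pow_succ, ← Nat.div_div_eq_div_mul]
        omega
      conv_rhs => rw [h3, pow_add, pow_add]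
      congr 1
      rcases Nat.mod_two_eq_zero_or_one (a / 2 ^ b) with h | h <;> simp [h]
    simp only [st]
    rw [h1]
    exact h2 _ _ _

theorem eq (hΦ : FieldCtx M I Φ) (hf : PolyElem M I Φ f) (hg : PolyElem M I Φ g) :
    PolyBool M I fun x => f x = g x :=
  (PolyBool.forall_lt (P := fun x i => ListRec.coord (Φ x).B (f x) i =
    ListRec.coord (Φ x).B (g x) i) hΦ.dim
    (PolyBool.eq (hf.coord_idx hΦ) (hg.coord_idx hΦ))).congr fun x =>
      ⟨fun h => coord_injective _ h, fun h i _ => by rw [h]⟩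

end PolyElem

end

end ListRec

end

noncomputable section

namespace ListRec

universe u

/-! ### Computing the kernel of a matrix -/

section Kernel

variable {F : Type*} [Field F]

/-- Inner product of the first `K` entries. -/
def dot (K : ℕ) (ρ u : ℕ → F) : F := ∑ j ∈ Finset.range K, ρ j * u j

/-- The vector on which an equation is tested against the other ones. -/
def pivot (K : ℕ) (ρ : ℕ → F) (v : ℕ → ℕ → F) : ℕ := lastIdx (fun k => dot K ρ (v k) ≠ 0) K

open Classical in
/-- From vectors spanning a space to vectors spanning its subspace cut out by the equation
`ρ`. -/
def kerStep (K : ℕ) (ρ : ℕ → F) (v : ℕ → ℕ → F) (k j : ℕ) : F :=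
  if dot K ρ (v (pivot K ρ v)) = 0 then v k j
  else dot K ρ (v (pivot K ρ v)) * v k j - dot K ρ (v k) * v (pivot K ρ v) j

/-- `K` vectors that span the space of solutions of the first `E` equations. -/
def kerTab (K : ℕ) (rows : ℕ → ℕ → F) : ℕ → ℕ → ℕ → F
  | 0 => fun k j => if k = j then 1 else 0
  | q + 1 => kerStep K (rows q) (kerTab K rows q)

theorem dot_eq_of_comb {K : ℕ} (ρ : ℕ → F) {u c : ℕ → F} {v : ℕ → ℕ → F}
    (h : ∀ j < K, u j = ∑ k ∈ Finset.range K, c k * v k j) :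
    dot K ρ u = ∑ k ∈ Finset.range K, c k * dot K ρ (v k) := by
  simp only [dot, Finset.mul_sum]
  rw [Finset.sum_comm]
  refine Finset.sum_congr rfl fun j hj => ?_
  rw [h j (Finset.mem_range.1 hj), Finset.mul_sum]
  exact Finset.sum_congr rfl fun k _ => by ring

theorem dot_sub_mul (K : ℕ) (ρ u v : ℕ → F) (b c : F) :
    dot K ρ (fun j => b * u j - c * v j) = b * dot K ρ u - c * dot K ρ v := by
  simp only [dot, Finset.mul_sum, ← Finset.sum_sub_distrib]
  exact Finset.sum_congr rfl fun k _ => by ring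

theorem kerStep_eq (K : ℕ) (ρ : ℕ → F) (v : ℕ → ℕ → F) (k : ℕ) :
    (dot K ρ (v (pivot K ρ v)) = 0 ∧ kerStep K ρ v k = v k) ∨
    (dot K ρ (v (pivot K ρ v)) ≠ 0 ∧ kerStep K ρ v k = fun j =>
      dot K ρ (v (pivot K ρ v)) * v k j - dot K ρ (v k) * v (pivot K ρ v) j) := by
  by_cases h : dot K ρ (v (pivot K ρ v)) = 0
  · exact .inl ⟨h, funext fun j => if_pos h⟩
  · exact .inr ⟨h, funext fun j => if_neg h⟩

/-- Earlier equations persist by linearity. For the newest one: if the pivot satisfies it, so do all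
vectors, because the pivot is chosen among the violators whenever there are any; otherwise the
cross-multiplied difference cancels. -/
theorem dot_kerTab {K : ℕ} (rows : ℕ → ℕ → F) {E q k : ℕ} (hq : q < E) (hk : k < K) :
    dot K (rows q) (kerTab K rows E k) = 0 := by
  induction E generalizing k with
  | zero => omega
  | succ E ih =>
    set v := kerTab K rows E with hv
    rw [kerTab]
    have hp : pivot K (rows E) v < K := lastIdx_lt _ (by omega)
    rcases kerStep_eq K (rows E) v k with ⟨h, h'⟩ | ⟨h, h'⟩ <;> rw [← hv, h']
    · rcases Nat.lt_succ_iff_lt_or_eq.1 hq with h1 | rfl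
      · exact ih h1 hk
      · by_contra h2
        exact lastIdx_spec (P := fun k => dot K (rows q) (v k) ≠ 0) hk h2 h
    · rw [dot_sub_mul]
      rcases Nat.lt_succ_iff_lt_or_eq.1 hq with h1 | rfl
      · rw [ih h1 hk, ih h1 hp]; ring
      · ring

/-- The vectors need only span, not form a basis, so the elimination never discards any. Dividing
the old coefficients by the pivot value works because the correction terms add up to a multiple of
ρ·u = 0. -/
theorem exists_comb_kerTab {K : ℕ} (rows : ℕ → ℕ → F) {E : ℕ} {u : ℕ → F}
    (hu : ∀ q < E, dot K (rows q) u = 0) :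
    ∃ c : ℕ → F, ∀ j < K, u j = ∑ k ∈ Finset.range K, c k * kerTab K rows E k j := by
  induction E with
  | zero =>
    refine ⟨u, fun j hj => ?_⟩
    simp [kerTab, hj]
  | succ E ih =>
    obtain ⟨c, hc⟩ := ih fun q hq => hu q (by omega)
    set v := kerTab K rows E with hv
    have h0 := hu E (by omega)
    rw [dot_eq_of_comb (rows E) hc] at h0
    by_cases h : dot K (rows E) (v (pivot K (rows E) v)) = 0
    · exact ⟨c, fun j hj => by simp only [kerTab, kerStep, ← hv, if_pos h, hc j hj]⟩
    · refine ⟨fun k => c k / dot K (rows E) (v (pivot K (rows E) v)), fun j hj => ?_⟩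
      simp only [kerTab, kerStep, ← hv, if_neg h]
      rw [hc j hj]
      have h1 : ∀ k, c k / dot K (rows E) (v (pivot K (rows E) v)) *
          (dot K (rows E) (v (pivot K (rows E) v)) * v k j -
            dot K (rows E) (v k) * v (pivot K (rows E) v) j) =
          c k * v k j - c k * dot K (rows E) (v k) *
            (v (pivot K (rows E) v) j / dot K (rows E) (v (pivot K (rows E) v))) := by
        intro k
        field_simp
      rw [Finset.sum_congr rfl fun k _ => h1 k, Finset.sum_sub_distrib, ← Finset.sum_mul, h0]
      ring

theorem exists_kerTab_ne_zero {K : ℕ} (rows : ℕ → ℕ → F) {E : ℕ} (h : E < K) :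
    ∃ k < K, ∃ j < K, kerTab K rows E k j ≠ 0 := by
  by_contra! hz
  let f : (Fin K → F) →ₗ[F] (Fin E → F) :=
    Matrix.mulVecLin (Matrix.of fun (q : Fin E) (j : Fin K) => rows q j)
  obtain ⟨u, hu, hu0⟩ := (Submodule.ne_bot_iff _).1
    (LinearMap.ker_ne_bot_of_finrank_lt (f := f) (by simpa using h))
  apply hu0
  obtain ⟨c, hc⟩ := exists_comb_kerTab (K := K) rows (E := E)
    (u := fun j => if h : j < K then u ⟨j, h⟩ else 0) (by
      intro q hq
      have h1 := congrFun (LinearMap.mem_ker.1 hu) ⟨q, hq⟩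
      rw [dot, Finset.sum_range]
      simpa [f, Matrix.mulVec, dotProduct] using h1)
  ext j
  have h1 := hc j j.2
  rw [dif_pos j.2] at h1
  rw [Pi.zero_apply]
  refine h1.trans (Finset.sum_eq_zero fun k hk => ?_)
  rw [hz k (Finset.mem_range.1 hk) j j.2, mul_zero]

end Kernel

/-! ### Inversion and linear algebra in polynomial time -/

section

variable {X Y : Type*} {M : X → ℕ} {I J : X → Val} {Φ : X → FieldData.{u}} {K L : X → ℕ}

theorem PolyTime.idx (h : PolyTime M I J) : PolyTime (idxM K M) (idxI K I) (idxI K J) :=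
  PolyTime.head.pair h.under

theorem PolyElem.inv (hΦ : FieldCtx M I Φ) {f : ∀ x, (Φ x).F} (hf : PolyElem M I Φ f) :
    PolyElem M I Φ fun x => (f x)⁻¹ := by
  classical
  -- The inverse is the power with exponent q - 2. Zero is treated apart, since for q = 2 that power
  -- of 0 would be 1.
  refine (PolyElem.ite (hf.eq hΦ (.zero hΦ)) (.zero hΦ)
    (hf.pow hΦ ((hΦ.p.pow hΦ.dim).sub (.const 2)))).congr fun x => ?_
  split_ifs with h
  · rw [h, inv_zero]
  · have : Module.Finite (ZMod (Φ x).p) (Φ x).F := (Φ x).B.finite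
    have : Finite (Φ x).F := Module.finite_of_finite (ZMod (Φ x).p)
    have := Fintype.ofFinite (Φ x).F
    have hc : Fintype.card (Φ x).F = (Φ x).p ^ (Φ x).B.dim := by
      rw [Module.card_fintype (Φ x).B.basis, ZMod.card, Fintype.card_fin]
    have h1 := FiniteField.pow_card_sub_one_eq_one (f x) h
    have h2 : 2 ≤ Fintype.card (Φ x).F := Fintype.one_lt_card
    rw [← hc]
    refine eq_inv_of_mul_eq_one_left ?_
    rw [← pow_succ, ← h1]
    congr 1
    omega

/-- A matrix of field elements computable in polynomial time. -/
def PolyTable (M : X → ℕ) (I : X → Val) (Φ : X → FieldData.{u}) (K L : X → ℕ)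
    (v : ∀ x, ℕ → ℕ → (Φ x).F) : Prop :=
  PolyTime M I fun x => .tab (K x) fun k => .tab (L x) fun j => encElem (Φ x).B (v x k j)

theorem PolyTable.entry {v : ∀ x, ℕ → ℕ → (Φ x).F} (hv : PolyTable M I Φ K L v) {k j : X → ℕ}
    (hk : PolyCount M I k) (hkK : ∀ x, k x < K x) (hj : PolyCount M I j) (hjL : ∀ x, j x < L x) :
    PolyElem M I Φ fun x => v x (k x) (j x) :=
  PolyElem.nth (f := fun x j => v x (k x) j) (PolyTime.nth (f := fun x k => Val.tab (L x)
    fun j => encElem (Φ x).B (v x k j)) hv hk hkK) hj hjL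

theorem PolyTable.under {N : X → ℕ} {v : ∀ x, ℕ → ℕ → (Φ x).F} (hv : PolyTable M I Φ K L v) :
    PolyTable (idxM N M) (idxI N I) (fun y => Φ y.1) (fun y => K y.1) (fun y => L y.1)
      fun y => v y.1 := PolyTime.under hv

theorem PolyTable.of_entry {v : ∀ x, ℕ → ℕ → (Φ x).F} (hK : PolyCount M I K)
    (hL : PolyCount M I L)
    (hv : PolyElem (idxM (fun y : (x : X) × Fin (K x) => L y.1) (idxM K M))
      (idxI (fun y : (x : X) × Fin (K x) => L y.1) (idxI K I)) (fun z => Φ z.1.1)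
      fun z => v z.1.1 z.1.2 z.2) : PolyTable M I Φ K L v :=
  PolyTime.tab (f := fun x k => .tab (L x) fun j => encElem (Φ x).B (v x k j)) hK
    (PolyTime.tab (f := fun (y : (x : X) × Fin (K x)) j => encElem (Φ y.1).B (v y.1 y.2 j))
      hL.under hv)

theorem PolyElem.dot (hΦ : FieldCtx M I Φ) (hK : PolyCount M I K) {ρ v : ∀ x, ℕ → (Φ x).F}
    (hρ : PolyElem (idxM K M) (idxI K I) (fun y => Φ y.1) fun y => ρ y.1 y.2)
    (hv : PolyElem (idxM K M) (idxI K I) (fun y => Φ y.1) fun y => v y.1 y.2) :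
    PolyElem M I Φ fun x => dot (K x) (ρ x) (v x) :=
  PolyElem.sum (f := fun x j => ρ x j * v x j) hΦ hK (hρ.mul hΦ.under hv)

theorem PolyTable.kerStep (hΦ : FieldCtx M I Φ) (hK : PolyCount M I K) (hK0 : ∀ x, 0 < K x)
    {ρ : ∀ x, ℕ → (Φ x).F} {v : ∀ x, ℕ → ℕ → (Φ x).F}
    (hρ : PolyElem (idxM K M) (idxI K I) (fun y => Φ y.1) fun y => ρ y.1 y.2)
    (hv : PolyTable M I Φ K K v) :
    PolyTable M I Φ K K fun x => kerStep (K x) (ρ x) (v x) := by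
  classical
  have hρ' : PolyElem (idxM (fun y : (x : X) × Fin (K x) => K y.1) (idxM K M))
      (idxI (fun y : (x : X) × Fin (K x) => K y.1) (idxI K I)) (fun z => Φ z.1.1)
      fun z => ρ z.1.1 z.2 :=
    PolyTime.comp (PolyTime.head.pair PolyTime.id.right.right)
      (hρ.comap (fun z : (y : (x : X) × Fin (K x)) × Fin (K y.1) =>
        (⟨z.1.1, z.2⟩ : (x : X) × Fin (K x))))
  have hd : PolyElem (idxM K M) (idxI K I) (fun y => Φ y.1)
      fun y => ListRec.dot (K y.1) (ρ y.1) (v y.1 y.2) :=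
    PolyElem.dot (ρ := fun y => ρ y.1) (v := fun y => v y.1 y.2) hΦ.under hK.under hρ'
      (hv.under.under.entry (PolyCount.idx hK.bdd).under (fun z => z.1.2.2)
        (.idx hK.under.bdd) fun z => z.2.2)
  have hp : PolyCount M I fun x => pivot (K x) (ρ x) (v x) :=
    PolyCount.lastIdx (P := fun x k => ListRec.dot (K x) (ρ x) (v x k) ≠ 0) hK
      (hd.eq hΦ.under (.zero hΦ.under)).not
  have hlt : ∀ x, pivot (K x) (ρ x) (v x) < K x := fun x => lastIdx_lt _ (hK0 x)
  have hdp : PolyElem M I Φ fun x => ListRec.dot (K x) (ρ x) (v x (pivot (K x) (ρ x) (v x))) :=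
    PolyElem.dot (v := fun x => v x (pivot (K x) (ρ x) (v x))) hΦ hK hρ
      (hv.under.entry hp.under (fun y => hlt y.1) (.idx hK.bdd) fun y => y.2.2)
  refine PolyTable.of_entry hK hK ?_
  refine PolyElem.ite (hdp.eq hΦ (.zero hΦ)).under.under ?_ (PolyElem.sub hΦ.under.under
    (PolyElem.mul hΦ.under.under hdp.under.under ?_)
    (PolyElem.mul hΦ.under.under hd.under ?_))
  · exact hv.under.under.entry (PolyCount.idx hK.bdd).under (fun z => z.1.2.2)
        (.idx hK.under.bdd) fun z => z.2.2
  · exact hv.under.under.entry (PolyCount.idx hK.bdd).under (fun z => z.1.2.2)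
        (.idx hK.under.bdd) fun z => z.2.2
  · exact hv.under.under.entry hp.under.under (fun z => hlt _)
        (.idx hK.under.bdd) fun z => z.2.2

theorem PolyTable.kerTab (hΦ : FieldCtx M I Φ) {E : X → ℕ} (hK : PolyCount M I K)
    (hE : PolyCount M I E) (hK0 : ∀ x, 0 < K x) {rows : ∀ x, ℕ → ℕ → (Φ x).F}
    (hr : PolyElem (idxM (fun y : (x : X) × Fin (E x) => K y.1) (idxM E M))
      (idxI (fun y : (x : X) × Fin (E x) => K y.1) (idxI E I)) (fun z => Φ z.1.1)
      fun z => rows z.1.1 z.1.2 z.2) :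
    PolyTable M I Φ K K fun x => kerTab (K x) (rows x) (E x) := by
  have h0 : PolyTable M I Φ K K fun x => ListRec.kerTab (K x) (rows x) 0 :=
    PolyTable.of_entry hK hK (PolyElem.ite (PolyBool.eq (PolyCount.idx hK.bdd).toNat.under
      (PolyCount.idx hK.under.bdd).toNat) (.one hΦ.under.under) (.zero hΦ.under.under))
  refine PolyTime.loop (st := fun x q => .tab (K x) fun k => .tab (K x) fun j =>
    encElem (Φ x).B (ListRec.kerTab (K x) (rows x) q k j)) hE.time hE.bdd h0 ?_
  refine PolyTable.kerStep (Φ := fun y : (x : X) × Fin (E x) => Φ y.1) (K := fun y => K y.1)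
    (ρ := fun y => rows y.1 y.2) (v := fun y => ListRec.kerTab (K y.1) (rows y.1) y.2)
    hΦ.lift hK.lift (fun y => hK0 y.1) ?_ PolyTime.head.right
  exact PolyTime.comp (PolyTime.idx (PolyTime.head.left.pair PolyTime.id.right)) hr

end

end ListRec

end

noncomputable section

namespace ListRec

universe u

/-! ### The list-recovery algorithm -/

/-- The input of the list-recovery algorithm: the evaluation points, the input lists, the
parameters of the code, the error bound, and a random seed. -/
structure RecInput (F : Type u) where
  /-- evaluation points -/
  a : ℕ → F
  /-- input lists -/
  y : ℕ → ℕ → ℕ → F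
  /-- multiplicity -/
  s : ℕ
  /-- degree bound -/
  d : ℕ
  /-- length -/
  n : ℕ
  /-- size of the input lists -/
  ℓ : ℕ
  /-- strict bound on the number of errors -/
  e : ℕ
  /-- random seed -/
  g : ℕ

namespace RecInput

section Def

variable {F : Type u} (δ : RecInput F)

/-- The least number of agreements of a codeword that has to be found. -/
def agr : ℕ := δ.n + 1 - δ.e

/-- An upper bound for the inverse of the gap to capacity. -/
def gapInv : ℕ := δ.s * δ.n / (δ.s * δ.agr - δ.d) + 1

/-- The number of derivatives in the interpolated differential operator. -/
def ord : ℕ := 2 * (δ.ℓ * δ.gapInv)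

/-- The multiplicity of interpolation. -/
def mult : ℕ := δ.s + 1 - δ.ord

/-- The degree bound of the coefficients of the differential operator. -/
def deg : ℕ := δ.n * δ.ℓ * δ.mult / δ.ord + 1

/-- The number of sampled coordinates. -/
def samples : ℕ := 2 * δ.gapInv * (δ.ord.size + 1)

/-- The bound on the list size. -/
def bound : ℕ := δ.ord ^ δ.samples

/-- The number of trials. -/
def trials : ℕ := 100 * δ.bound ^ 2

/-- The `τ`-th sample of the `κ`-th trial, encoding a coordinate and an entry of its list. -/
def digit (κ τ : ℕ) : ℕ := δ.g / (δ.n * δ.ℓ) ^ (κ * δ.samples + τ) % (δ.n * δ.ℓ)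

variable [Field F]

/-- The interpolation equations on the coefficients of the differential operator. -/
def interpRow (q k : ℕ) : F :=
  -- The row q = (iℓ + l)·`mult` + κ stands for point i, list entry l and order κ; the column k =
  -- j·`deg` + c for the coefficient of X^c in B_j. The sum is the Leibniz rule for the κ-th Hasse
  -- derivative of X^c ∂^(j)P, with the derivatives of P replaced by the list entry.
  ∑ i ∈ Finset.range (q % δ.mult + 1),
    (((k % δ.deg).choose (q % δ.mult - i) * (k / δ.deg + i).choose (k / δ.deg) : ℕ) : F) *
      (δ.a (q / δ.mult / δ.ℓ) ^ (k % δ.deg - (q % δ.mult - i)) *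
        δ.y (q / δ.mult / δ.ℓ) (q / δ.mult % δ.ℓ) (k / δ.deg + i))

/-- Solutions of the interpolation equations. -/
def interpTab : ℕ → ℕ → F := kerTab (δ.ord * δ.deg) δ.interpRow (δ.n * δ.ℓ * δ.mult)

/-- The index of a nonzero solution of the interpolation equations. -/
def interpIdx : ℕ :=
  lastIdx (fun k => ∃ j < δ.ord * δ.deg, δ.interpTab k j ≠ 0) (δ.ord * δ.deg)

/-- The coefficients of the differential operator. -/
def opCoeff (j : ℕ) : F := δ.interpTab δ.interpIdx j

/-- The equations that express that the differential operator annihilates a polynomial. -/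
def odeRow (q k : ℕ) : F :=
  -- The coefficient of X^q in the image of X^k: since ∂^(j) X^k = C(k, j) X^(k-j), it involves the
  -- coefficient q + j - k of B_j. The test k < q + j + 1 guards the truncated subtraction. The
  -- extra unknown in column d + 1, the scalar, does not enter.
  if k < δ.d + 1 then ∑ j ∈ Finset.range δ.ord,
    if k < q + j + 1 ∧ q + j - k < δ.deg then
      (k.choose j : F) * δ.opCoeff (j * δ.deg + (q + j - k)) else 0
  else 0

/-- The equations that express that a polynomial agrees with the sampled entries of the input
lists, up to a scalar. -/
def sampleRow (κ q k : ℕ) : F :=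
  -- The row q = τs + j stands for the j-th derivative at the τ-th sample, whose digit encodes
  -- coordinate·ℓ + entry. The prescribed value is multiplied by the unknown of column d + 1, which
  -- makes the system homogeneous.
  if k < δ.d + 1 then ((k.choose (q % δ.s) : ℕ) : F) *
    δ.a (δ.digit κ (q / δ.s) / δ.ℓ) ^ (k - q % δ.s)
  else - δ.y (δ.digit κ (q / δ.s) / δ.ℓ) (δ.digit κ (q / δ.s) % δ.ℓ) (q % δ.s)

/-- All equations of a trial. -/
def trialRow (κ q k : ℕ) : F :=
  if q < δ.deg + δ.d then δ.odeRow q k else δ.sampleRow κ (q - (δ.deg + δ.d)) k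

/-- Solutions of the equations of a trial. -/
def trialTab (κ : ℕ) : ℕ → ℕ → F :=
  kerTab (δ.d + 2) (δ.trialRow κ) (δ.deg + δ.d + δ.samples * δ.s)

/-- The index of a solution of the equations of a trial with nonzero scalar. -/
def trialIdx (κ : ℕ) : ℕ := lastIdx (fun k => δ.trialTab κ k (δ.d + 1) ≠ 0) (δ.d + 2)

/-- The coefficients of the polynomial found in a trial. -/
def trialCoeff (κ c : ℕ) : F :=
  δ.trialTab κ (δ.trialIdx κ) c * (δ.trialTab κ (δ.trialIdx κ) (δ.d + 1))⁻¹

/-- The codeword found in a trial. -/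
def trialWord (κ i j : ℕ) : F :=
  ∑ c ∈ Finset.range (δ.d + 1), (c.choose j : F) * (δ.trialCoeff κ c * δ.a i ^ (c - j))

open Classical in
/-- The codeword found in a trial is close to the input lists and new. -/
def accepts (κ : ℕ) : Prop :=
  (∑ i ∈ Finset.range δ.n, if ∃ l < δ.ℓ, ∀ j < δ.s, δ.trialWord κ i j = δ.y i l j then 0 else 1)
      < δ.e ∧
    -- Comparison with all earlier trials, accepted or not: closeness depends on the word only, so
    -- the first trial producing a close word is accepted.
    ∀ κ' < κ, ∃ i < δ.n, ∃ j < δ.s, δ.trialWord κ i j ≠ δ.trialWord κ' i j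

open Classical in
/-- The accepted trials. -/
def accepted : List ℕ := (List.range δ.trials).filter δ.accepts

end Def

end RecInput

/-! ### The output of the algorithm is computable in polynomial time -/

section

variable {X Y : Type*} {M : X → ℕ} {I J : X → Val} {Φ : X → FieldData.{u}}
  {δ : ∀ x, RecInput (Φ x).F} {K : X → ℕ}

/-- The input of the list-recovery algorithm can be computed from `I`, and its running time
parameters are polynomially bounded. -/
structure RecCtx (M : X → ℕ) (I : X → Val) (Φ : X → FieldData.{u})
    (δ : ∀ x, RecInput (Φ x).F) : Prop where
  field : FieldCtx M I Φ
  s : PolyCount M I fun x => (δ x).s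
  d : PolyCount M I fun x => (δ x).d
  n : PolyCount M I fun x => (δ x).n
  ℓ : PolyCount M I fun x => (δ x).ℓ
  e : PolyCount M I fun x => (δ x).e
  g : PolyNat M I fun x => (δ x).g
  bound_bdd : PolyBdd M fun x => (δ x).bound
  points : PolyTime M I fun x => .tab (δ x).n fun i => encElem (Φ x).B ((δ x).a i)
  lists : PolyTime M I fun x => .tab (δ x).n fun i => .tab (δ x).ℓ fun l => .tab (δ x).s fun j =>
    encElem (Φ x).B ((δ x).y i l j)
  n_pos : ∀ x, 0 < (δ x).n
  ℓ_pos : ∀ x, 0 < (δ x).ℓ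
  ord_le : ∀ x, (δ x).ord ≤ (δ x).s

namespace RecCtx

theorem lift {φ : Y → X} {J : Y → Val} (h : RecCtx M I Φ δ) :
    RecCtx (fun y => M (φ y)) (fun y => .pair (J y) (I (φ y))) (fun y => Φ (φ y))
      fun y => δ (φ y) :=
  ⟨h.field.lift, h.s.lift, h.d.lift, h.n.lift, h.ℓ.lift, h.e.lift, h.g.lift,
    h.bound_bdd.comap φ, h.points.lift, h.lists.lift, fun _ => h.n_pos _, fun _ => h.ℓ_pos _,
    fun _ => h.ord_le _⟩

theorem under (h : RecCtx M I Φ δ) :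
    RecCtx (idxM K M) (idxI K I) (fun y => Φ y.1) fun y => δ y.1 := h.lift (φ := Sigma.fst)

variable (h : RecCtx M I Φ δ)
include h

theorem ord_pos (x : X) : 0 < (δ x).ord := by
  have := h.ℓ_pos x
  rw [RecInput.ord, RecInput.gapInv]
  positivity

theorem mult_pos (x : X) : 0 < (δ x).mult := by
  have := h.ord_le x
  rw [RecInput.mult]
  omega

theorem s_pos (x : X) : 0 < (δ x).s := (h.ord_pos x).trans_le (h.ord_le x)

theorem gapInv : PolyCount M I fun x => (δ x).gapInv :=
  ((h.s.mul h.n).div ((h.s.mul ((h.n.add (.const 1)).sub h.e)).sub h.d)).add (.const 1)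

theorem ord : PolyCount M I fun x => (δ x).ord := (PolyCount.const 2).mul (h.ℓ.mul h.gapInv)

theorem mult : PolyCount M I fun x => (δ x).mult := (h.s.add (.const 1)).sub h.ord

theorem deg : PolyCount M I fun x => (δ x).deg :=
  (((h.n.mul h.ℓ).mul h.mult).div h.ord).add (.const 1)

theorem samples : PolyCount M I fun x => (δ x).samples :=
  ((PolyCount.const 2).mul h.gapInv).mul (h.ord.toNat.size.add (.const 1))

theorem bound : PolyCount M I fun x => (δ x).bound :=
  ⟨(h.ord.toNat.pow h.samples).time, h.bound_bdd⟩

theorem trials : PolyCount M I fun x => (δ x).trials :=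
  (PolyCount.const 100).mul ((h.bound.mul h.bound).congr fun _ => (sq _).symm)

/-- The seed and the power of nℓ are only of polynomial length, but their reduction modulo nℓ is
polynomially bounded and can serve as an index. -/
theorem digit {κ τ : X → ℕ} (hκ : PolyCount M I κ) (hτ : PolyCount M I τ) :
    PolyCount M I fun x => (δ x).digit (κ x) (τ x) := by
  have hb := (h.n.mul h.ℓ)
  refine .of_le ((h.g.div (hb.toNat.pow ((hκ.mul h.samples).add hτ))).mod hb.toNat).time
    hb.bdd fun x => (Nat.mod_lt _ ?_).le
  exact Nat.mul_pos (h.n_pos x) (h.ℓ_pos x)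

theorem digit_div_lt (x : X) (κ τ : ℕ) : (δ x).digit κ τ / (δ x).ℓ < (δ x).n := by
  rw [Nat.div_lt_iff_lt_mul (h.ℓ_pos x)]
  exact Nat.mod_lt _ (Nat.mul_pos (h.n_pos x) (h.ℓ_pos x))

theorem a {i : X → ℕ} (hi : PolyCount M I i) (hin : ∀ x, i x < (δ x).n) :
    PolyElem M I Φ fun x => (δ x).a (i x) :=
  PolyElem.nth (f := fun x i => (δ x).a i) h.points hi hin

theorem y {i l j : X → ℕ} (hi : PolyCount M I i) (hin : ∀ x, i x < (δ x).n)
    (hl : PolyCount M I l) (hlℓ : ∀ x, l x < (δ x).ℓ) (hj : PolyCount M I j)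
    (hjs : ∀ x, j x < (δ x).s) : PolyElem M I Φ fun x => (δ x).y (i x) (l x) (j x) :=
  PolyTable.entry (v := fun x l j => (δ x).y (i x) l j) (PolyTime.nth (f := fun x i =>
    .tab (δ x).ℓ fun l => .tab (δ x).s fun j => encElem (Φ x).B ((δ x).y i l j)) h.lists hi hin)
    hl hlℓ hj hjs

theorem interpRow {q k : X → ℕ} (hq : PolyCount M I q)
    (hq' : ∀ x, q x < (δ x).n * (δ x).ℓ * (δ x).mult) (hk : PolyCount M I k)
    (hk' : ∀ x, k x < (δ x).ord * (δ x).deg) :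
    PolyElem M I Φ fun x => (δ x).interpRow (q x) (k x) := by
  have hi : ∀ x, q x / (δ x).mult / (δ x).ℓ < (δ x).n := fun x => by
    rw [Nat.div_lt_iff_lt_mul (h.ℓ_pos x), Nat.div_lt_iff_lt_mul (h.mult_pos x)]
    exact hq' x
  have hκ := hq.mod h.mult
  have hi' := (hq.div h.mult).div h.ℓ
  have hj := hk.div h.deg
  have hc := hk.mod h.deg
  have hκ1 : PolyCount M I fun x => q x % (δ x).mult + 1 := hκ.add (.const 1)
  have hidx : PolyCount (idxM (fun x => q x % (δ x).mult + 1) M)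
    (idxI (fun x => q x % (δ x).mult + 1) I) fun y => y.2 := .idx hκ1.bdd
  refine PolyElem.sum (f := fun x i => (((k x % (δ x).deg).choose (q x % (δ x).mult - i) *
    (k x / (δ x).deg + i).choose (k x / (δ x).deg) : ℕ) : (Φ x).F) *
      ((δ x).a (q x / (δ x).mult / (δ x).ℓ) ^ (k x % (δ x).deg - (q x % (δ x).mult - i)) *
        (δ x).y (q x / (δ x).mult / (δ x).ℓ) (q x / (δ x).mult % (δ x).ℓ) (k x / (δ x).deg + i)))
    h.field hκ1 ?_
  refine PolyElem.natCast_mul h.field.under ((PolyNat.choose hc.under (hκ.under.sub hidx)).mul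
    (PolyNat.choose (hj.under.add hidx) hj.under)) (PolyElem.mul h.field.under
    (PolyElem.pow h.field.under (h.a hi' hi).under (hc.under.sub (hκ.under.sub hidx)).toNat) ?_)
  refine h.under.y hi'.under (fun y => hi y.1) ((hq.div h.mult).mod h.ℓ).under
    (fun y => Nat.mod_lt _ (h.ℓ_pos _)) (hj.under.add hidx) fun y => ?_
  have h1 : k y.1 / (δ y.1).deg < (δ y.1).ord := by
    refine Nat.div_lt_of_lt_mul ?_
    rw [mul_comm]
    exact hk' _
  have h2 : (y.2 : ℕ) < q y.1 % (δ y.1).mult + 1 := y.2.2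
  have h3 := Nat.mod_lt (q y.1) (h.mult_pos y.1)
  have h4 := h.ord_le y.1
  have h5 : (δ y.1).mult = (δ y.1).s + 1 - (δ y.1).ord := rfl
  omega

theorem ord_mul_deg_pos (x : X) : 0 < (δ x).ord * (δ x).deg :=
  Nat.mul_pos (h.ord_pos x) (Nat.succ_pos _)

theorem interpTab : PolyTable M I Φ (fun x => (δ x).ord * (δ x).deg)
    (fun x => (δ x).ord * (δ x).deg) fun x => (δ x).interpTab := by
  have hE := (h.n.mul h.ℓ).mul h.mult
  have hK := h.ord.mul h.deg
  exact PolyTable.kerTab h.field hK hE h.ord_mul_deg_pos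
    (h.under.under.interpRow (PolyCount.idx hE.bdd).under (fun z => z.1.2.2)
      (.idx hK.under.bdd) fun z => z.2.2)

theorem interpIdx : PolyCount M I fun x => (δ x).interpIdx := by
  have hK := h.ord.mul h.deg
  refine PolyCount.lastIdx (P := fun x k => ∃ j < (δ x).ord * (δ x).deg,
    (δ x).interpTab k j ≠ 0) hK (PolyBool.exists_lt (P := fun y j =>
      (δ y.1).interpTab y.2 j ≠ 0) hK.under ?_)
  exact (PolyElem.eq h.field.under.under (h.interpTab.under.under.entry
    (PolyCount.idx hK.bdd).under (fun z => z.1.2.2) (.idx hK.under.bdd) fun z => z.2.2)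
    (.zero h.field.under.under)).not

theorem opCoeff {j : X → ℕ} (hj : PolyCount M I j) (hj' : ∀ x, j x < (δ x).ord * (δ x).deg) :
    PolyElem M I Φ fun x => (δ x).opCoeff (j x) :=
  h.interpTab.entry h.interpIdx (fun x => lastIdx_lt _ (h.ord_mul_deg_pos x)) hj hj'

theorem odeRow {q k : X → ℕ} (hq : PolyCount M I q) (hk : PolyCount M I k) :
    PolyElem M I Φ fun x => (δ x).odeRow (q x) (k x) := by
  have hF := h.field
  have hj : PolyCount (idxM (fun x => (δ x).ord) M) (idxI (fun x => (δ x).ord) I) fun y => y.2 :=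
    .idx h.ord.bdd
  refine PolyElem.ite (PolyBool.lt hk.toNat (h.d.add (.const 1)).toNat)
    (PolyElem.sum (f := fun x j => if k x < q x + j + 1 ∧ q x + j - k x < (δ x).deg then
      ((k x).choose j : (Φ x).F) * (δ x).opCoeff (j * (δ x).deg + (q x + j - k x)) else 0)
      hF h.ord ?_) (.zero hF)
  have hs := (hq.under.add hj).sub hk.under
  -- Both branches have to be computable on every input, so the index is reduced modulo the table
  -- length. This changes nothing where the condition holds.
  refine (PolyElem.ite ((PolyBool.lt hk.under.toNat ((hq.under.add hj).add (.const 1)).toNat).and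
    (PolyBool.lt hs.toNat h.deg.under.toNat))
    (PolyElem.natCast_mul hF.under (PolyNat.choose hk.under hj)
      (h.under.opCoeff (((hj.mul h.deg.under).add hs).mod (h.ord.mul h.deg).under)
        fun y => Nat.mod_lt _ (h.ord_mul_deg_pos y.1))) (.zero hF.under)).congr fun y => ?_
  split_ifs with hc
  · rw [Nat.mod_eq_of_lt]
    calc (y.2 : ℕ) * (δ y.1).deg + (q y.1 + y.2 - k y.1)
        < y.2 * (δ y.1).deg + (δ y.1).deg := by have := hc.2; omega
      _ = (y.2 + 1) * (δ y.1).deg := by ring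
      _ ≤ _ := Nat.mul_le_mul_right _ y.2.2
  · rfl

theorem sampleRow {κ q k : X → ℕ} (hκ : PolyCount M I κ) (hq : PolyCount M I q)
    (hk : PolyCount M I k) : PolyElem M I Φ fun x => (δ x).sampleRow (κ x) (q x) (k x) := by
  have hF := h.field
  have hi := (h.digit hκ (hq.div h.s)).div h.ℓ
  have hj := hq.mod h.s
  refine PolyElem.ite (PolyBool.lt hk.toNat (h.d.add (.const 1)).toNat)
    (PolyElem.natCast_mul hF (PolyNat.choose hk hj) ((h.a hi fun x => h.digit_div_lt x _ _).pow hF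
      (hk.sub hj).toNat)) (PolyElem.neg hF ?_)
  exact h.y hi (fun x => h.digit_div_lt x _ _) ((h.digit hκ (hq.div h.s)).mod h.ℓ)
    (fun x => Nat.mod_lt _ (h.ℓ_pos x)) hj fun x => Nat.mod_lt _ (h.s_pos x)

theorem trialRow {κ q k : X → ℕ} (hκ : PolyCount M I κ) (hq : PolyCount M I q)
    (hk : PolyCount M I k) : PolyElem M I Φ fun x => (δ x).trialRow (κ x) (q x) (k x) :=
  PolyElem.ite (PolyBool.lt hq.toNat (h.deg.add h.d).toNat) (h.odeRow hq hk)
    (h.sampleRow hκ (hq.sub (h.deg.add h.d)) hk)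

theorem trialTab {κ : X → ℕ} (hκ : PolyCount M I κ) : PolyTable M I Φ (fun x => (δ x).d + 2)
    (fun x => (δ x).d + 2) fun x => (δ x).trialTab (κ x) := by
  have hE := (h.deg.add h.d).add (h.samples.mul h.s)
  have hK := h.d.add (.const 2)
  exact PolyTable.kerTab h.field hK hE (fun x => by omega)
    (h.under.under.trialRow hκ.under.under (PolyCount.idx hE.bdd).under (.idx hK.under.bdd))

theorem trialIdx {κ : X → ℕ} (hκ : PolyCount M I κ) :
    PolyCount M I fun x => (δ x).trialIdx (κ x) := by
  have hK := h.d.add (.const 2)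
  refine PolyCount.lastIdx (P := fun x k => (δ x).trialTab (κ x) k ((δ x).d + 1) ≠ 0) hK
    (PolyElem.eq h.field.under ((h.trialTab hκ).under.entry
      (PolyCount.idx hK.bdd) (fun z => z.2.2) (h.d.add (.const 1)).under fun z => by omega)
      (.zero h.field.under)).not

theorem trialCoeff {κ c : X → ℕ} (hκ : PolyCount M I κ) (hc : PolyCount M I c)
    (hcd : ∀ x, c x < (δ x).d + 1) :
    PolyElem M I Φ fun x => (δ x).trialCoeff (κ x) (c x) := by
  have hlt : ∀ x, (δ x).trialIdx (κ x) < (δ x).d + 2 := fun x => lastIdx_lt _ (by omega)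
  exact PolyElem.mul h.field
    ((h.trialTab hκ).entry (h.trialIdx hκ) hlt hc fun x => (hcd x).trans (by omega))
    (PolyElem.inv h.field ((h.trialTab hκ).entry (h.trialIdx hκ) hlt (h.d.add (.const 1))
      fun x => by omega))

theorem trialWord {κ i j : X → ℕ} (hκ : PolyCount M I κ) (hi : PolyCount M I i)
    (hin : ∀ x, i x < (δ x).n) (hj : PolyCount M I j) :
    PolyElem M I Φ fun x => (δ x).trialWord (κ x) (i x) (j x) := by
  have hd := h.d.add (.const 1)
  have hc : PolyCount (idxM (fun x => (δ x).d + 1) M) (idxI (fun x => (δ x).d + 1) I)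
    fun y => y.2 := .idx hd.bdd
  exact PolyElem.sum (f := fun x c => (c.choose (j x) : (Φ x).F) *
    ((δ x).trialCoeff (κ x) c * (δ x).a (i x) ^ (c - j x))) h.field hd
    (PolyElem.natCast_mul h.field.under (PolyNat.choose hc hj.under) (PolyElem.mul h.field.under
      (h.under.trialCoeff hκ.under hc fun y => y.2.2)
      ((h.a hi hin).under.pow h.field.under (hc.sub hj.under).toNat)))

theorem accepts {κ : X → ℕ} (hκ : PolyCount M I κ) :
    PolyBool M I fun x => (δ x).accepts (κ x) := by
  classical
  have hn : PolyCount (idxM (fun x => (δ x).n) M) (idxI (fun x => (δ x).n) I) fun y => y.2 :=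
    .idx h.n.bdd
  refine (PolyBool.lt (PolyCount.sum (f := fun x i => if ∃ l < (δ x).ℓ, ∀ j < (δ x).s,
    (δ x).trialWord (κ x) i j = (δ x).y i l j then 0 else 1) h.n
    (PolyCount.ite ?_ (.const 0) (.const 1))).toNat h.e.toNat).and ?_
  · refine PolyBool.exists_lt (P := fun y l => ∀ j < (δ y.1).s,
      (δ y.1).trialWord (κ y.1) y.2 j = (δ y.1).y y.2 l j) h.ℓ.under ?_
    refine PolyBool.forall_lt (P := fun y j =>
      (δ y.1.1).trialWord (κ y.1.1) y.1.2 j = (δ y.1.1).y y.1.2 y.2 j) h.s.under.under ?_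
    have hs := PolyCount.idx h.s.under.under.bdd (I := idxI (fun y => (δ y.1).ℓ)
      (idxI (fun x => (δ x).n) I))
    exact PolyElem.eq h.field.under.under.under
      (h.under.under.under.trialWord hκ.under.under.under hn.under.under (fun z => z.1.1.2.2) hs)
      (h.under.under.under.y hn.under.under (fun z => z.1.1.2.2)
        (PolyCount.idx h.ℓ.under.bdd).under (fun z => z.1.2.2) hs fun z => z.2.2)
  · refine PolyBool.forall_lt (P := fun x κ' => ∃ i < (δ x).n, ∃ j < (δ x).s,
      (δ x).trialWord (κ x) i j ≠ (δ x).trialWord κ' i j) hκ ?_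
    refine PolyBool.exists_lt (P := fun y i => ∃ j < (δ y.1).s,
      (δ y.1).trialWord (κ y.1) i j ≠ (δ y.1).trialWord y.2 i j) h.n.under ?_
    refine PolyBool.exists_lt (P := fun y j =>
      (δ y.1.1).trialWord (κ y.1.1) y.2 j ≠ (δ y.1.1).trialWord y.1.2 y.2 j) h.s.under.under ?_
    have hs := PolyCount.idx h.s.under.under.bdd (I := idxI (fun y => (δ y.1).n) (idxI κ I))
    exact (PolyElem.eq h.field.under.under.under
      (h.under.under.under.trialWord hκ.under.under.under (PolyCount.idx h.n.under.bdd).under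
        (fun z => z.1.2.2) hs)
      (h.under.under.under.trialWord (PolyCount.idx hκ.bdd).under.under
        (PolyCount.idx h.n.under.bdd).under (fun z => z.1.2.2) hs)).not

theorem output : PolyTime M I fun x => .ofList ((δ x).accepted.map fun κ =>
    .tab (δ x).n fun i => .tab (δ x).s fun j => encElem (Φ x).B ((δ x).trialWord κ i j)) := by
  have hκ := PolyCount.idx h.trials.bdd (I := I)
  refine PolyTime.filterTab (P := fun x => (δ x).accepts) (f := fun x κ =>
    .tab (δ x).n fun i => .tab (δ x).s fun j => encElem (Φ x).B ((δ x).trialWord κ i j))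
    h.trials (h.under.accepts hκ) ?_
  have hT : PolyTable (idxM (fun x => (δ x).trials) M) (idxI (fun x => (δ x).trials) I)
      (fun y => Φ y.1) (fun y => (δ y.1).n) (fun y => (δ y.1).s)
      fun y => (δ y.1).trialWord y.2 :=
    PolyTable.of_entry h.n.under h.s.under
      (h.under.under.under.trialWord hκ.under.under (PolyCount.idx h.n.under.bdd).under
        (fun z => z.1.2.2) (.idx h.s.under.under.bdd))
  exact hT

end RecCtx

end

end ListRec

end

noncomputable section

namespace ListRec

/-! ### Differential operators and Wronskians in positive characteristic -/

section Wronskian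

variable {F : Type*} [Field F]

theorem coeff_X_pow_mul_hasseDeriv (P : F[X]) (j k : ℕ) :
    (X ^ j * hasseDeriv j P).coeff k = k.choose j * P.coeff k := by
  rw [coeff_X_pow_mul']
  split_ifs with h
  · rw [hasseDeriv_coeff, Nat.sub_add_cancel h]
  · rw [Nat.choose_eq_zero_of_lt (by omega), Nat.cast_zero, zero_mul]

theorem natDegree_X_pow_mul_hasseDeriv_le (P : F[X]) (j : ℕ) :
    (X ^ j * hasseDeriv j P).natDegree ≤ P.natDegree := by
  rw [natDegree_le_iff_coeff_eq_zero]
  intro k hk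
  rw [coeff_X_pow_mul_hasseDeriv, coeff_eq_zero_of_natDegree_lt hk, mul_zero]

/-- A combination of binomial coefficients of degree less than `r ≤ p` has fewer than `r`
roots among `0, …, p - 1`. -/
theorem card_lt_of_sum_choose_eq_zero {p : ℕ} [Fact p.Prime] [CharP F p] {r : ℕ} (hr : r ≤ p)
    {b : ℕ → F} (hb : ∃ j < r, b j ≠ 0) {E : Finset ℕ} (hE : ∀ e ∈ E, e < p)
    (h : ∀ e ∈ E, ∑ j ∈ Finset.range r, b j * (e.choose j : F) = 0) : E.card < r := by
  classical
  have hfac : ∀ j < r, (j.factorial : F) ≠ 0 := by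
    intro j hj h0
    rw [CharP.cast_eq_zero_iff F p, (Fact.out : p.Prime).dvd_factorial] at h0
    omega
  let f : F[X] := ∑ j ∈ Finset.range r, C (b j / j.factorial) * descPochhammer F j
  have hf : ∀ e : ℕ, f.eval (e : F) = ∑ j ∈ Finset.range r, b j * (e.choose j : F) := by
    intro e
    rw [eval_finsetSum]
    refine Finset.sum_congr rfl fun j hj => ?_
    rw [eval_mul, eval_C, descPochhammer_eval_eq_descFactorial,
      Nat.descFactorial_eq_factorial_mul_choose, Nat.cast_mul]
    have := hfac j (Finset.mem_range.1 hj)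
    field_simp
  have hr0 : 0 < r := by obtain ⟨j, hj, _⟩ := hb; omega
  -- At the least index j with b_j ≠ 0 only the term b_j C(j, j) survives: lower coefficients are
  -- zero, and C(j, i) = 0 for i > j.
  have hf0 : f ≠ 0 := by
    intro h0
    have hex : ∃ j, j < r ∧ b j ≠ 0 := hb
    obtain ⟨hj1, hj2⟩ := Nat.find_spec hex
    have hmin := fun i => Nat.find_min (m := i) hex
    set j := Nat.find hex
    apply hj2
    have h1 := hf j
    rw [h0, eval_zero, Finset.sum_eq_single j] at h1
    · simpa using h1.symm
    · intro i hi hij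
      rw [Finset.mem_range] at hi
      rcases lt_or_gt_of_ne hij with h2 | h2
      · have := hmin i h2
        push Not at this
        rw [this hi, zero_mul]
      · rw [Nat.choose_eq_zero_of_lt h2, Nat.cast_zero, mul_zero]
    · simp [hj1]
  have hdeg : f.natDegree ≤ r - 1 := by
    refine natDegree_sum_le_of_forall_le _ _ fun j hj => ?_
    refine (natDegree_C_mul_le _ _).trans ?_
    rw [descPochhammer_natDegree]
    have := Finset.mem_range.1 hj
    omega
  have hinj : Set.InjOn (fun e : ℕ => (e : F)) E := by
    intro x hx y hy hxy
    have := (CharP.natCast_eq_natCast F p).1 hxy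
    rwa [Nat.ModEq, Nat.mod_eq_of_lt (hE x hx), Nat.mod_eq_of_lt (hE y hy)] at this
  have hcard : (E.image fun e : ℕ => (e : F)).card ≤ f.natDegree := by
    refine card_le_degree_of_subset_roots fun x hx => ?_
    rw [Finset.mem_val, Finset.mem_image] at hx
    obtain ⟨e, he, rfl⟩ := hx
    rw [mem_roots hf0, IsRoot.def, hf e, h e he]
  rw [Finset.card_image_of_injOn hinj] at hcard
  omega

/-- A nonzero linear differential operator of order less than `r` annihilates a space of
polynomials of degree less than the characteristic of dimension less than `r`. -/
theorem finrank_lt_of_sum_hasseDeriv_eq_zero {p : ℕ} [Fact p.Prime] [CharP F p] {r d : ℕ}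
    (hr : r ≤ p) (hd : d < p) {W : Submodule F F[X]} (hW : ∀ P ∈ W, P.natDegree ≤ d)
    {B : ℕ → F[X]} (hB : ∃ j < r, B j ≠ 0)
    (h : ∀ P ∈ W, ∑ j ∈ Finset.range r, B j * hasseDeriv j P = 0) :
    Module.finrank F W < r := by
  classical
  -- It suffices to bound the number of degrees occurring in W: an element whose coefficients at
  -- these degrees all vanish would have zero leading coefficient.
  let E : Finset ℕ := (Finset.range (d + 1)).filter fun e => ∃ P ∈ W, P ≠ 0 ∧ P.natDegree = e
  have hcard : Module.finrank F W ≤ E.card := by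
    let φ : W →ₗ[F] (E → F) := LinearMap.pi fun e => (lcoeff F e).comp W.subtype
    have hφ : Function.Injective φ := by
      rw [injective_iff_map_eq_zero]
      intro P hP
      by_contra hP0
      have hP1 : (P : F[X]) ≠ 0 := fun h0 => hP0 (Subtype.ext h0)
      have hmem : (P : F[X]).natDegree ∈ E := by
        rw [Finset.mem_filter, Finset.mem_range]
        exact ⟨Nat.lt_succ_of_le (hW P P.2), P, P.2, hP1, rfl⟩
      have := congrFun hP ⟨_, hmem⟩
      exact hP1 (leadingCoeff_eq_zero.1 this)
    simpa using LinearMap.finrank_le_finrank_of_injective hφ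
  refine hcard.trans_lt ?_
  obtain ⟨j₁, hj₁, hBj₁⟩ := hB
  -- The index is one where X^(r-j) B_j has the largest degree μ; the summand 1 ranks nonzero
  -- constants above the zero polynomial.
  obtain ⟨j₀, hj₀, hmax⟩ := Finset.exists_max_image (Finset.range r)
    (fun j => if B j = 0 then 0 else (X ^ (r - j) * B j).natDegree + 1)
    ⟨j₁, Finset.mem_range.2 hj₁⟩
  rw [Finset.mem_range] at hj₀
  have hB0 : B j₀ ≠ 0 := by
    intro h0
    have := hmax j₁ (Finset.mem_range.2 hj₁)
    simp [h0, hBj₁] at this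
  set μ := (X ^ (r - j₀) * B j₀).natDegree with hμ
  have hle : ∀ j < r, (X ^ (r - j) * B j).natDegree ≤ μ := by
    intro j hj
    by_cases h0 : B j = 0
    · simp [h0]
    · have := hmax j (Finset.mem_range.2 hj)
      simpa [h0, hB0] using this
  refine card_lt_of_sum_choose_eq_zero hr (b := fun j => (X ^ (r - j) * B j).coeff μ)
    ⟨j₀, hj₀, ?_⟩ ?_ ?_
  · have : X ^ (r - j₀) * B j₀ ≠ 0 := mul_ne_zero (pow_ne_zero _ X_ne_zero) hB0
    exact leadingCoeff_ne_zero.2 this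
  · intro e he
    rw [Finset.mem_filter, Finset.mem_range] at he
    omega
  · intro e he
    rw [Finset.mem_filter] at he
    obtain ⟨-, P, hP, hP0, rfl⟩ := he
    -- Split X^r into X^(r-j)·X^j: the operator X^j ∂^(j) multiplies the coefficient of X^k by C(k,
    -- j) and raises no degree, so the top coefficient of the equation is the indicial equation for
    -- deg P.
    have h1 := congrArg (fun Q => (X ^ r * Q).coeff (μ + P.natDegree)) (h P hP)
    simp only [mul_zero, coeff_zero, Finset.mul_sum, finsetSum_coeff] at h1
    have h2 : ∀ j ∈ Finset.range r, (X ^ r * (B j * hasseDeriv j P)).coeff (μ + P.natDegree) =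
        (X ^ (r - j) * B j).coeff μ * (P.natDegree.choose j : F) * P.leadingCoeff := by
      intro j hj
      rw [Finset.mem_range] at hj
      have h3 : X ^ r * (B j * hasseDeriv j P) = (X ^ (r - j) * B j) * (X ^ j * hasseDeriv j P) := by
        conv_lhs => rw [← Nat.sub_add_cancel hj.le, pow_add]
        ring
      rw [h3, coeff_mul_add_eq_of_natDegree_le (hle j hj) (natDegree_X_pow_mul_hasseDeriv_le P j),
        coeff_X_pow_mul_hasseDeriv, mul_assoc]
      rfl
    rw [Finset.sum_congr rfl h2, ← Finset.sum_mul] at h1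
    exact (mul_eq_zero.1 h1).resolve_right (leadingCoeff_ne_zero.2 hP0)

/-- The polynomials that vanish at `x` to order `s`. -/
def vanish (s : ℕ) (x : F) : Submodule F F[X] where
  carrier := {P | ∀ j < s, (hasseDeriv j P).eval x = 0}
  zero_mem' := fun j _ => by simp
  add_mem' := fun {P Q} hP hQ j hj => by
    simp [hP j hj, hQ j hj]
  smul_mem' := fun c P hP j hj => by simp [hP j hj]

theorem mem_vanish {s : ℕ} {x : F} {P : F[X]} :
    P ∈ vanish s x ↔ ∀ j < s, (hasseDeriv j P).eval x = 0 := Iff.rfl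

theorem mem_vanish_iff_dvd {s : ℕ} {x : F} {P : F[X]} :
    P ∈ vanish s x ↔ (X - C x) ^ s ∣ P := by
  rw [X_sub_C_pow_dvd_iff, X_pow_dvd_iff, mem_vanish]
  have h : P.comp (X + C x) = taylor x P := rfl
  simp only [h, taylor_coeff]

theorem hasseDeriv_mem_vanish {s j : ℕ} {x : F} {P : F[X]} (hP : P ∈ vanish s x) :
    hasseDeriv j P ∈ vanish (s - j) x := by
  intro i hi
  have := congrArg (eval x) (congrArg (fun f => f P) (hasseDeriv_comp (R := F) i j))
  simp only [LinearMap.comp_apply, LinearMap.smul_apply, eval_smul] at this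
  rw [this, hP (i + j) (by omega), smul_zero]

/-- Polynomials whose orders of vanishing at distinct points add up to more than the degree
are zero. -/
theorem sum_le_natDegree {n : ℕ} {a : Fin n → F} (ha : Function.Injective a) {m : Fin n → ℕ}
    {P : F[X]} (hP : P ≠ 0) (T : Finset (Fin n)) (h : ∀ i ∈ T, (X - C (a i)) ^ m i ∣ P) :
    ∑ i ∈ T, m i ≤ P.natDegree := by
  have h1 : ∏ i ∈ T, (X - C (a i)) ^ m i ∣ P :=
    Finset.prod_dvd_of_coprime (fun i _ j _ hij =>
      (pairwise_coprime_X_sub_C ha hij).pow) h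
  have h2 := natDegree_le_of_dvd h1 hP
  rw [natDegree_prod _ _ fun i _ => pow_ne_zero _ (X_sub_C_ne_zero _)] at h2
  simpa using h2

/-- The matrix of Hasse derivatives. -/
def wron {w : ℕ} (b : Fin w → F[X]) : Matrix (Fin w) (Fin w) F[X] :=
  .of fun j k => hasseDeriv j (b k)

theorem natDegree_det_wron_le {w d : ℕ} {b : Fin w → F[X]} (hb : ∀ k, (b k).natDegree ≤ d) :
    (wron b).det.natDegree ≤ w * d := by
  rw [Matrix.det_apply]
  refine natDegree_sum_le_of_forall_le _ _ fun σ _ => ?_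
  refine (natDegree_smul_le _ _).trans ((natDegree_prod_le _ _).trans ?_)
  refine (Finset.sum_le_card_nsmul _ _ d fun k _ => ?_).trans (by simp)
  exact (natDegree_hasseDeriv_le _ _).trans ((Nat.sub_le _ _).trans (hb k))

/-- Each derivative of order at most w - 1 loses at most w - 1 from the order of vanishing, so every
column indexed by T is divisible by (X - x)^(s+1-w). -/
theorem pow_dvd_det_wron {w s : ℕ} {x : F} {b : Fin w → F[X]} {T : Finset (Fin w)}
    (hT : ∀ k ∈ T, b k ∈ vanish s x) : (X - C x) ^ (T.card * (s + 1 - w)) ∣ (wron b).det := by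
  classical
  have hdvd : ∀ j k : Fin w, ∃ q, (wron b) j k =
      q * (if k ∈ T then (X - C x) ^ (s + 1 - w) else 1) := by
    intro j k
    split_ifs with hk
    · obtain ⟨q, hq⟩ := mem_vanish_iff_dvd.1 (hasseDeriv_mem_vanish (j := j) (hT k hk))
      refine ⟨(X - C x) ^ (s - j - (s + 1 - w)) * q, ?_⟩
      have h1 : s - (j : ℕ) = (s - j - (s + 1 - w)) + (s + 1 - w) := by
        have := j.2; omega
      show hasseDeriv j (b k) = _
      rw [hq]
      conv_lhs => rw [h1, pow_add]
      ring
    · exact ⟨wron b j k, by ring⟩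
  choose q hq using hdvd
  have h1 : wron b = Matrix.of q *
      Matrix.diagonal fun k => if k ∈ T then (X - C x) ^ (s + 1 - w) else 1 := by
    ext1 j k
    rw [Matrix.mul_diagonal, hq]
    rfl
  rw [h1, Matrix.det_mul, Matrix.det_diagonal, Finset.prod_ite_mem, Finset.univ_inter,
    Finset.prod_const, ← pow_mul, mul_comm (s + 1 - w)]
  exact dvd_mul_left _ _

theorem exists_basis_adapted {V : Type*} [AddCommGroup V] [Module F V] [FiniteDimensional F V]
    (U : Submodule F V) : ∃ (b : Module.Basis (Fin (Module.finrank F V)) F V)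
      (T : Finset (Fin (Module.finrank F V))), T.card = Module.finrank F U ∧ ∀ k ∈ T, b k ∈ U := by
  classical
  obtain ⟨U', hU'⟩ := U.exists_isCompl
  let b₀ := ((Module.finBasis F U).prod (Module.finBasis F U')).map
    (U.prodEquivOfIsCompl U' hU')
  have hc : Module.finrank F U + Module.finrank F U' = Module.finrank F V :=
    Submodule.finrank_add_eq_of_isCompl hU'
  let e : Fin (Module.finrank F U) ⊕ Fin (Module.finrank F U') ≃ Fin (Module.finrank F V) :=
    finSumFinEquiv.trans (finCongr hc)
  refine ⟨b₀.reindex e, Finset.univ.map (Function.Embedding.inl.trans e.toEmbedding),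
    by simp, fun k hk => ?_⟩
  rw [Finset.mem_map] at hk
  obtain ⟨i, -, rfl⟩ := hk
  simp [b₀]

/-- Hasse derivatives are F-linear, so a change of basis only multiplies the Wronskian by a
constant. Thus its order at each point can be estimated in a basis adapted to that point. -/
theorem det_wron_eq {w : ℕ} {W : Submodule F F[X]} (b b' : Module.Basis (Fin w) F W) :
    (wron fun k => (b k : F[X])).det =
      (wron fun k => (b' k : F[X])).det * C (b'.toMatrix b).det := by
  have h1 : (wron fun k => (b k : F[X])) =
      (wron fun k => (b' k : F[X])) * (b'.toMatrix b).map C := by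
    ext1 j k
    rw [Matrix.mul_apply]
    show hasseDeriv j (b k : F[X]) = ∑ l, hasseDeriv j (b' l : F[X]) * C (b'.toMatrix b l k)
    conv_lhs => rw [← b'.sum_toMatrix_smul_self b k]
    simp only [Submodule.coe_sum, Submodule.coe_smul, map_sum, map_smul]
    exact Finset.sum_congr rfl fun l _ => by rw [smul_eq_C_mul, mul_comm]
  rw [h1, Matrix.det_mul]
  congr 1
  exact ((C : F →+* F[X]).map_det _).symm

theorem finiteDimensional_of_natDegree_le {d : ℕ} {W : Submodule F F[X]}
    (hW : ∀ P ∈ W, P.natDegree ≤ d) :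
    FiniteDimensional F W ∧ Module.finrank F W ≤ d + 1 := by
  let φ : W →ₗ[F] (Fin (d + 1) → F) := LinearMap.pi fun e => (lcoeff F e).comp W.subtype
  have hφ : Function.Injective φ := by
    rw [injective_iff_map_eq_zero]
    intro P hP
    apply Subtype.ext
    ext k
    rcases Nat.lt_or_ge k (d + 1) with hk | hk
    · exact congrFun hP ⟨k, hk⟩
    · have := hW P P.2
      exact coeff_eq_zero_of_natDegree_lt (by omega)
  exact ⟨FiniteDimensional.of_injective φ hφ,
    by simpa using LinearMap.finrank_le_finrank_of_injective hφ⟩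

/-- Spaces of polynomials of degree less than the characteristic form a subspace design. -/
theorem sum_finrank_inf_vanish_le {p : ℕ} [Fact p.Prime] [CharP F p] {n s d : ℕ} {a : Fin n → F}
    (ha : Function.Injective a) (hd : d < p) {W : Submodule F F[X]}
    (hW : ∀ P ∈ W, P.natDegree ≤ d) :
    ∑ i, Module.finrank F ↥(W ⊓ vanish s (a i)) * (s + 1 - Module.finrank F W) ≤
      Module.finrank F W * d := by
  obtain ⟨hfd, hdim⟩ := finiteDimensional_of_natDegree_le hW
  let b := Module.finBasis F W
  have hdet : (wron fun k => (b k : F[X])).det ≠ 0 := by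
    intro h0
    -- A dependence of the rows over F[X] is a nonzero differential operator with dim W terms that
    -- annihilates W, which would force dim W < dim W.
    obtain ⟨v, hv0, hv⟩ := Matrix.exists_vecMul_eq_zero_iff.2 h0
    obtain ⟨k₀, hk₀⟩ := Function.ne_iff.1 hv0
    have := finrank_lt_of_sum_hasseDeriv_eq_zero (F := F) (r := Module.finrank F W)
      (B := fun j => if h : j < Module.finrank F W then v ⟨j, h⟩ else 0) (by omega) hd hW
      ⟨k₀, k₀.2, by simpa using hk₀⟩ (by
        intro P hP
        rw [Finset.sum_range]
        have h1 : ∀ Q : W, ∑ j : Fin (Module.finrank F W), v j * hasseDeriv j (Q : F[X]) = 0 := by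
          intro Q
          have hz : ∑ j : Fin (Module.finrank F W),
              (LinearMap.mulLeft F (v j)) ∘ₗ (hasseDeriv j) ∘ₗ W.subtype = 0 := by
            refine b.ext fun k => ?_
            simpa [Matrix.vecMul, dotProduct, wron] using congrFun hv k
          simpa using congrArg (fun f => f Q) hz
        simpa using h1 ⟨P, hP⟩)
    omega
  refine (sum_le_natDegree ha hdet Finset.univ fun i _ => ?_).trans
    (natDegree_det_wron_le fun k => hW _ (b k).2)
  obtain ⟨b', T, hT, hT'⟩ := exists_basis_adapted ((vanish s (a i)).comap W.subtype)
  have hcard : T.card = Module.finrank F ↥(W ⊓ vanish s (a i)) := by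
    rw [hT, ← Submodule.map_comap_subtype]
    exact (LinearEquiv.finrank_eq (Submodule.equivMapOfInjective _ W.injective_subtype _))
  rw [det_wron_eq b b', ← hcard]
  exact dvd_mul_of_dvd_left (pow_dvd_det_wron hT') _

end Wronskian

end ListRec

end

noncomputable section

namespace ListRec

universe u

/-! ### Correctness of the algorithm -/

theorem sum_range_mul_eq {R : Type*} [AddCommMonoid R] (f : ℕ → R) (r D : ℕ) :
    ∑ k ∈ Finset.range (r * D), f k =
      ∑ j ∈ Finset.range r, ∑ c ∈ Finset.range D, f (j * D + c) := by
  induction r with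
  | zero => simp
  | succ r ih => rw [Nat.succ_mul, Finset.sum_range_add, ih, Finset.sum_range_succ]

namespace RecInput

variable {F : Type u}

/-- The hypotheses on the parameters under which the algorithm works. -/
structure Valid (p : ℕ) (δ : RecInput F) : Prop where
  n_pos : 0 < δ.n
  ℓ_pos : 0 < δ.ℓ
  e_pos : 0 < δ.e
  d_lt : δ.d < p
  sn_lt : δ.s * δ.n < p
  inj : Function.Injective fun i : Fin δ.n => δ.a i
  gap : δ.d < δ.s * δ.agr
  big : 16 * δ.ℓ * (δ.s * δ.n) ^ 2 ≤ δ.s * (δ.s * δ.agr - δ.d) ^ 2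

/-! ### Inequalities between the parameters -/

namespace Valid

variable {p : ℕ} {δ : RecInput F} (h : Valid p δ)
include h

theorem s_pos : 0 < δ.s := by
  rcases Nat.eq_zero_or_pos δ.s with h0 | h0
  · have := h.gap
    rw [h0] at this
    omega
  · exact h0

theorem agr_le : δ.agr ≤ δ.n := by
  have := h.e_pos
  rw [agr]; omega

theorem agr_pos : 0 < δ.agr := by
  rcases Nat.eq_zero_or_pos δ.agr with h0 | h0
  · have := h.gap
    rw [h0] at this
    omega
  · exact h0

theorem ord_pos : 0 < δ.ord := by
  have := h.ℓ_pos
  rw [ord, gapInv]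
  positivity

theorem lt_gapInv_mul : δ.s * δ.n < δ.gapInv * (δ.s * δ.agr - δ.d) := by
  have h1 : 0 < δ.s * δ.agr - δ.d := by have := h.gap; omega
  have := Nat.lt_mul_div_succ (δ.s * δ.n) h1
  rw [gapInv, mul_comm (_ + 1)]
  exact this

/-- This is where the constant 16 is spent. With G = sA - d ≤ sn one has gG ≤ sn + G ≤ 2sn, so rG =
2ℓgG ≤ 4ℓsn. Multiplying by 4sn and using 16ℓ(sn)² ≤ sG² gives the claim after cancelling G. -/
theorem ord_mul_le : 4 * δ.ord * (δ.s * δ.n) ≤ δ.s * (δ.s * δ.agr - δ.d) := by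
  have h1 : 0 < δ.s * δ.agr - δ.d := by have := h.gap; omega
  have h2 : δ.s * δ.agr - δ.d ≤ δ.s * δ.n :=
    (Nat.sub_le _ _).trans (Nat.mul_le_mul_left _ h.agr_le)
  have h3 := Nat.div_mul_le_self (δ.s * δ.n) (δ.s * δ.agr - δ.d)
  have h4 := h.big
  have h5 : δ.ord = 2 * (δ.ℓ * (δ.s * δ.n / (δ.s * δ.agr - δ.d) + 1)) := rfl
  rw [h5]
  generalize δ.s * δ.agr - δ.d = W at *
  generalize δ.s * δ.n / W = E at *
  generalize δ.s * δ.n = N at *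
  have h6 : (E + 1) * W ≤ 2 * N := by nlinarith
  have h7 : δ.ℓ * N * ((E + 1) * W) ≤ δ.ℓ * N * (2 * N) := Nat.mul_le_mul_left _ h6
  refine Nat.le_of_mul_le_mul_right (c := W) ?_ h1
  nlinarith

theorem four_mul_ord_le : 4 * δ.ord ≤ δ.s := by
  have h2 : δ.s * δ.agr - δ.d ≤ δ.s * δ.n :=
    (Nat.sub_le _ _).trans (Nat.mul_le_mul_left _ h.agr_le)
  exact Nat.le_of_mul_le_mul_right (h.ord_mul_le.trans (Nat.mul_le_mul_left _ h2))
    (Nat.mul_pos h.s_pos h.n_pos)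

theorem ord_le : δ.ord ≤ δ.s := by have := h.four_mul_ord_le; omega

theorem mult_add : δ.mult + δ.ord = δ.s + 1 := by
  have := h.ord_le
  rw [mult]; omega

theorem mult_pos : 0 < δ.mult := by
  have := h.ord_le
  rw [mult]; omega

theorem lt_ord_mul_deg : δ.n * δ.ℓ * δ.mult < δ.ord * δ.deg :=
  Nat.lt_mul_div_succ _ h.ord_pos

theorem n_le : δ.n ≤ δ.gapInv * δ.agr := by
  have h1 := h.lt_gapInv_mul
  have h2 : δ.gapInv * (δ.s * δ.agr - δ.d) ≤ δ.gapInv * (δ.s * δ.agr) :=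
    Nat.mul_le_mul_left _ (Nat.sub_le _ _)
  refine le_of_mul_le_mul_left (a := δ.s) ?_ h.s_pos
  nlinarith

/-- Provides the slack that absorbs the rounding in the degree bound. The hypothesis `big` first
forces s ≥ 16, as the gap is at most sn, and then the square of the gap is at least 16s. -/
theorem sixteen_le_gap : 16 ≤ δ.s * δ.agr - δ.d := by
  have h1 := h.big
  have h2 : δ.s * δ.agr - δ.d ≤ δ.s * δ.n :=
    (Nat.sub_le _ _).trans (Nat.mul_le_mul_left _ h.agr_le)
  have hs := h.s_pos
  have hn := h.n_pos
  have hℓ := h.ℓ_pos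
  have h0 : 0 < δ.s * δ.n := Nat.mul_pos hs hn
  have h16 : 16 ≤ δ.s := by
    have h3 : 16 * (δ.s * δ.n) ^ 2 ≤ δ.s * (δ.s * δ.n) ^ 2 :=
      calc 16 * (δ.s * δ.n) ^ 2 ≤ 16 * δ.ℓ * (δ.s * δ.n) ^ 2 :=
            Nat.mul_le_mul_right _ (by omega)
        _ ≤ _ := h1
        _ ≤ _ := Nat.mul_le_mul_left _ (Nat.pow_le_pow_left h2 2)
    exact Nat.le_of_mul_le_mul_right h3 (by positivity)
  have h4 : 16 * δ.s ≤ (δ.s * δ.agr - δ.d) ^ 2 := by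
    refine le_of_mul_le_mul_left (a := δ.s) (le_trans ?_ h1) hs
    have : 1 ≤ δ.ℓ * δ.n ^ 2 := Nat.mul_pos hℓ (by positivity)
    nlinarith [Nat.mul_le_mul_left (16 * δ.s ^ 2) this]
  by_contra! h5
  nlinarith

/-- Put G = sA - d and multiply by s, so that the right side is m(d + G). Up to rounding, s·`deg`
costs at most mG/2. Replacing m by s in md costs at most rd ≤ sG/4, while m ≥ 3s/4 leaves mG/2 ≥
3sG/8. The remaining sG/8 ≥ 2s pays for the rounding. -/
theorem deg_add_le : δ.deg + δ.d ≤ δ.mult * δ.agr := by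
  have h1 := h.lt_gapInv_mul
  have h2 := h.ord_mul_le
  have h3 := h.four_mul_ord_le
  have h4 := h.sixteen_le_gap
  have h5 := h.mult_add
  have h6 : δ.s * δ.agr ≤ δ.s * δ.n := Nat.mul_le_mul_left _ h.agr_le
  have hs := h.s_pos
  obtain ⟨W, hW⟩ : ∃ W, δ.s * δ.agr = δ.d + W := ⟨δ.s * δ.agr - δ.d, by have := h.gap; omega⟩
  have hW' : δ.s * δ.agr - δ.d = W := by omega
  rw [hW'] at h1 h2 h4
  obtain ⟨D, hD⟩ : ∃ D, D = δ.n * δ.ℓ * δ.mult / δ.ord := ⟨_, rfl⟩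
  have hdeg : δ.deg = D + 1 := by rw [hD, deg]
  have h7 : D * δ.ord ≤ δ.n * δ.ℓ * δ.mult := hD ▸ Nat.div_mul_le_self _ _
  have h8 : D * (2 * δ.gapInv) ≤ δ.n * δ.mult := by
    refine le_of_mul_le_mul_left (a := δ.ℓ) ?_ h.ℓ_pos
    have : δ.ord = 2 * (δ.ℓ * δ.gapInv) := rfl
    rw [this] at h7
    nlinarith
  have h9 : D * 2 * δ.s ≤ δ.mult * W := by
    refine le_of_mul_le_mul_left (a := δ.n) ?_ h.n_pos
    calc δ.n * (D * 2 * δ.s) = D * 2 * (δ.s * δ.n) := by ring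
      _ ≤ D * 2 * (δ.gapInv * W) := Nat.mul_le_mul_left _ h1.le
      _ = D * (2 * δ.gapInv) * W := by ring
      _ ≤ δ.n * δ.mult * W := Nat.mul_le_mul_right _ h8
      _ = _ := by ring
  refine le_of_mul_le_mul_left (a := δ.s) ?_ hs
  have h10 : δ.s * (δ.mult * δ.agr) = δ.mult * (δ.d + W) := by rw [← hW]; ring
  rw [h10, hdeg]
  have h11 : 4 * (δ.ord * δ.d) ≤ δ.s * W := by
    refine le_trans ?_ h2
    rw [mul_assoc]
    exact Nat.mul_le_mul_left _ (Nat.mul_le_mul_left _ (by omega))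
  have h12 : δ.s * 16 ≤ δ.s * W := Nat.mul_le_mul_left _ h4
  have h13 : 3 * δ.s ≤ 4 * δ.mult := by omega
  have h14 : 3 * δ.s * W ≤ 4 * δ.mult * W := Nat.mul_le_mul_right _ h13
  have h15 : δ.mult * δ.d + δ.ord * δ.d = δ.s * δ.d + δ.d := by
    rw [← add_mul, h5]; ring
  nlinarith

/-- The contraction factor of one sampling step: d/(mA) ≤ 1 - 1/(2g). With G = sA - d, one has mA ≥
d + G/2, whereas mA/(2g) ≤ (d + G)/(2g) ≤ G/2 because d + G ≤ sn < gG. -/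
theorem d_mul_le : 2 * δ.gapInv * δ.d ≤ (2 * δ.gapInv - 1) * (δ.mult * δ.agr) := by
  have h1 := h.lt_gapInv_mul
  have h2 := h.ord_mul_le
  have h5 := h.mult_add
  have h6 : δ.s * δ.agr ≤ δ.s * δ.n := Nat.mul_le_mul_left _ h.agr_le
  have hs := h.s_pos
  have hop := h.ord_pos
  obtain ⟨W, hW⟩ : ∃ W, δ.s * δ.agr = δ.d + W := ⟨δ.s * δ.agr - δ.d, by have := h.gap; omega⟩
  have hW' : δ.s * δ.agr - δ.d = W := by omega
  rw [hW'] at h1 h2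
  obtain ⟨E, hE⟩ : ∃ E, δ.gapInv = E + 1 := ⟨_, rfl⟩
  have h3 : 2 * δ.gapInv - 1 = 2 * E + 1 := by omega
  rw [h3]
  rw [hE] at h1 ⊢
  refine le_of_mul_le_mul_left (a := δ.s) ?_ hs
  have h10 : δ.s * ((2 * E + 1) * (δ.mult * δ.agr)) = (2 * E + 1) * (δ.mult * (δ.d + W)) := by
    rw [← hW]; ring
  rw [h10]
  have hm : δ.mult ≤ δ.s := by omega
  have h11 : δ.mult * (δ.d + W) ≤ δ.s * ((E + 1) * W) :=
    Nat.mul_le_mul hm (by omega)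
  have h12 : δ.mult * (δ.d + W) + δ.ord * (δ.d + W) = (δ.s + 1) * (δ.d + W) := by
    rw [← add_mul, h5]
  have h13 : 4 * (δ.ord * (δ.d + W)) ≤ δ.s * W := by
    refine le_trans ?_ h2
    rw [mul_assoc]
    exact Nat.mul_le_mul_left _ (Nat.mul_le_mul_left _ (by omega))
  have h14 : 2 * (δ.s * δ.d) + δ.s * W ≤ 2 * (δ.mult * (δ.d + W)) := by nlinarith
  have h15 := Nat.mul_le_mul_left (E + 1) h14
  nlinarith

end Valid

/-! ### The interpolated operator, its solution space, and a single trial -/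

variable [Field F] (δ : RecInput F)

/-- The word of a polynomial agrees with an entry of the `i`-th input list. -/
def Agrees (P : F[X]) (i : ℕ) : Prop :=
  ∃ l < δ.ℓ, ∀ j < δ.s, (hasseDeriv j P).eval (δ.a i) = δ.y i l j

open Classical in
/-- The coordinates in which the word of a polynomial agrees with the input lists. -/
def agreeSet (P : F[X]) : Finset (Fin δ.n) := Finset.univ.filter fun i => δ.Agrees P i

theorem mem_agreeSet {P : F[X]} {i : Fin δ.n} : i ∈ δ.agreeSet P ↔ δ.Agrees P i := by
  simp [agreeSet]

/-- The polynomials whose words have to be found. -/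
def IsClose (P : F[X]) : Prop := P.natDegree ≤ δ.d ∧ δ.agr ≤ (δ.agreeSet P).card

/-- The coefficients of the differential operator. -/
def opPoly (j : ℕ) : F[X] :=
  ∑ c ∈ Finset.range δ.deg, monomial c (δ.opCoeff (j * δ.deg + c))

/-- The differential operator. -/
def diffOp : F[X] →ₗ[F] F[X] :=
  ∑ j ∈ Finset.range δ.ord, LinearMap.mulLeft F (δ.opPoly j) ∘ₗ hasseDeriv j

theorem diffOp_apply (P : F[X]) :
    δ.diffOp P = ∑ j ∈ Finset.range δ.ord, δ.opPoly j * hasseDeriv j P := by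
  simp [diffOp, LinearMap.sum_apply]

theorem coeff_opPoly (j m : ℕ) :
    (δ.opPoly j).coeff m = if m < δ.deg then δ.opCoeff (j * δ.deg + m) else 0 := by
  simp only [opPoly, finsetSum_coeff, coeff_monomial]
  simp

theorem natDegree_opPoly_lt (j : ℕ) : (δ.opPoly j).natDegree < δ.deg := by
  have h : (δ.opPoly j).natDegree ≤ δ.deg - 1 :=
    natDegree_sum_le_of_forall_le _ _ fun c hc => (natDegree_monomial_le _).trans (by
      have := Finset.mem_range.1 hc; omega)
  have : 0 < δ.deg := Nat.succ_pos _
  omega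

theorem natDegree_diffOp_lt {P : F[X]} (hP : P.natDegree ≤ δ.d) :
    (δ.diffOp P).natDegree < δ.deg + δ.d := by
  have h0 : 0 < δ.deg := Nat.succ_pos _
  have h : (δ.diffOp P).natDegree ≤ δ.deg + δ.d - 1 := by
    rw [diffOp_apply]
    refine natDegree_sum_le_of_forall_le _ _ fun j _ => natDegree_mul_le.trans ?_
    have h1 := δ.natDegree_opPoly_lt j
    have h2 := natDegree_hasseDeriv_le P j
    omega
  omega

theorem eval_hasseDeriv_sum_monomial (D m : ℕ) (f : ℕ → F) (x : F) :
    (hasseDeriv m (∑ c ∈ Finset.range D, monomial c (f c))).eval x =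
      ∑ c ∈ Finset.range D, (c.choose m : F) * (f c * x ^ (c - m)) := by
  rw [map_sum, eval_finsetSum]
  refine Finset.sum_congr rfl fun c _ => ?_
  rw [hasseDeriv_monomial, eval_monomial]
  ring

theorem opCoeff_ne_zero {p : ℕ} (h : δ.Valid p) : ∃ j < δ.ord, δ.opPoly j ≠ 0 := by
  obtain ⟨k, hk, j, hj, hkj⟩ := exists_kerTab_ne_zero δ.interpRow h.lt_ord_mul_deg
  obtain ⟨j', hj', hne⟩ : ∃ j < δ.ord * δ.deg, δ.opCoeff j ≠ 0 :=
    lastIdx_spec (P := fun k => ∃ j < δ.ord * δ.deg, δ.interpTab k j ≠ 0) hk ⟨j, hj, hkj⟩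
  have hdeg : 0 < δ.deg := Nat.succ_pos _
  refine ⟨j' / δ.deg, Nat.div_lt_of_lt_mul (by rwa [mul_comm]), fun h0 => hne ?_⟩
  have h1 := δ.coeff_opPoly (j' / δ.deg) (j' % δ.deg)
  rw [h0, coeff_zero, if_pos (Nat.mod_lt _ hdeg), Nat.div_add_mod'] at h1
  exact h1.symm

/-- The value of the interpolation equations on the coefficients of the operator. -/
theorem eval_hasseDeriv_diffOp {P : F[X]} {i l κ : ℕ} (hl : l < δ.ℓ) (hκ : κ < δ.mult)
    (hP : ∀ j < δ.s, (hasseDeriv j P).eval (δ.a i) = δ.y i l j) (hm : δ.mult + δ.ord = δ.s + 1) :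
    (hasseDeriv κ (δ.diffOp P)).eval (δ.a i) =
      dot (δ.ord * δ.deg) (δ.interpRow ((i * δ.ℓ + l) * δ.mult + κ)) δ.opCoeff := by
  have hdeg : 0 < δ.deg := Nat.succ_pos _
  have hq1 : ((i * δ.ℓ + l) * δ.mult + κ) % δ.mult = κ := by
    rw [Nat.mul_add_mod', Nat.mod_eq_of_lt hκ]
  have hq2 : ((i * δ.ℓ + l) * δ.mult + κ) / δ.mult = i * δ.ℓ + l := by
    rw [mul_comm, Nat.mul_add_div (by omega), Nat.div_eq_of_lt hκ, add_zero]
  have hq3 : (i * δ.ℓ + l) / δ.ℓ = i := by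
    rw [mul_comm, Nat.mul_add_div (by omega), Nat.div_eq_of_lt hl, add_zero]
  have hq4 : (i * δ.ℓ + l) % δ.ℓ = l := by
    rw [Nat.mul_add_mod', Nat.mod_eq_of_lt hl]
  rw [dot, sum_range_mul_eq, diffOp_apply, map_sum, eval_finsetSum]
  refine Finset.sum_congr rfl fun j hj => ?_
  rw [Finset.mem_range] at hj
  rw [hasseDeriv_mul, ← Finset.Nat.sum_antidiagonal_swap]
  simp only [Prod.fst_swap, Prod.snd_swap]
  rw [Finset.Nat.sum_antidiagonal_eq_sum_range_succ
    (fun x y => hasseDeriv y (δ.opPoly j) * hasseDeriv x (hasseDeriv j P)), eval_finsetSum]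
  have hterm : ∀ x ∈ Finset.range κ.succ,
      (hasseDeriv (κ - x) (δ.opPoly j) * hasseDeriv x (hasseDeriv j P)).eval (δ.a i) =
      ∑ c ∈ Finset.range δ.deg, ((c.choose (κ - x) * (j + x).choose j : ℕ) : F) *
        (δ.a i ^ (c - (κ - x)) * δ.y i l (j + x)) * δ.opCoeff (j * δ.deg + c) := by
    intro x hx
    rw [Finset.mem_range] at hx
    -- Composing ∂^(x) with ∂^(j) gives C(j+x, j) ∂^(j+x). As j < `ord` and x ≤ κ < `mult`, the
    -- order j + x is below s, so its value at the point can be read off the list entry.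
    have h1 := congrArg (eval (δ.a i)) (congrArg (fun f => f P) (hasseDeriv_comp (R := F) x j))
    simp only [LinearMap.comp_apply, LinearMap.smul_apply, eval_smul] at h1
    rw [eval_mul, h1, add_comm x j, hP (j + x) (by omega), ← Nat.choose_symm_add, opPoly,
      eval_hasseDeriv_sum_monomial, Finset.sum_mul]
    refine Finset.sum_congr rfl fun c _ => ?_
    push_cast
    rw [nsmul_eq_mul]
    ring
  rw [Finset.sum_congr rfl hterm, Finset.sum_comm]
  refine Finset.sum_congr rfl fun c hc => ?_
  rw [Finset.mem_range] at hc
  have hk1 : (j * δ.deg + c) % δ.deg = c := by rw [Nat.mul_add_mod', Nat.mod_eq_of_lt hc]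
  have hk2 : (j * δ.deg + c) / δ.deg = j := by
    rw [mul_comm, Nat.mul_add_div hdeg, Nat.div_eq_of_lt hc, add_zero]
  rw [interpRow, hq1, hq2, hq3, hq4, hk1, hk2, Finset.sum_mul]

theorem diffOp_eq_zero {p : ℕ} (h : δ.Valid p) {P : F[X]} (hP : δ.IsClose P) :
    δ.diffOp P = 0 := by
  by_contra h0
  have h1 := sum_le_natDegree h.inj h0 (m := fun _ => δ.mult) (δ.agreeSet P) (by
    intro i hi
    obtain ⟨l, hl, hy⟩ := δ.mem_agreeSet.1 hi
    refine mem_vanish_iff_dvd.1 fun κ hκ => ?_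
    rw [δ.eval_hasseDeriv_diffOp hl hκ hy h.mult_add]
    refine dot_kerTab δ.interpRow ?_ ?_
    · calc ((i : ℕ) * δ.ℓ + l) * δ.mult + κ < (i * δ.ℓ + l) * δ.mult + δ.mult := by omega
        _ = (i * δ.ℓ + l + 1) * δ.mult := by ring
        _ ≤ (i * δ.ℓ + δ.ℓ) * δ.mult := Nat.mul_le_mul_right _ (by omega)
        _ = (i + 1) * δ.ℓ * δ.mult := by ring
        _ ≤ _ := Nat.mul_le_mul_right _ (Nat.mul_le_mul_right _ i.2)
    · exact lastIdx_lt _ (Nat.mul_pos h.ord_pos (Nat.succ_pos _)))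
  rw [Finset.sum_const, smul_eq_mul] at h1
  have h2 := δ.natDegree_diffOp_lt hP.1
  have h3 := h.deg_add_le
  have h4 := Nat.mul_le_mul_right δ.mult hP.2
  rw [mul_comm δ.mult] at h3
  omega

/-- The polynomials of degree at most `d` annihilated by the differential operator. -/
def solSpace : Submodule F F[X] := degreeLE F δ.d ⊓ LinearMap.ker δ.diffOp

theorem mem_solSpace {P : F[X]} : P ∈ δ.solSpace ↔ P.natDegree ≤ δ.d ∧ δ.diffOp P = 0 := by
  rw [solSpace, Submodule.mem_inf, mem_degreeLE, LinearMap.mem_ker, natDegree_le_iff_degree_le]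

theorem finrank_solSpace_lt {p : ℕ} [Fact p.Prime] [CharP F p] (h : δ.Valid p) :
    Module.finrank F δ.solSpace < δ.ord := by
  have hsp : δ.s ≤ p := by
    have := h.sn_lt
    have := Nat.le_mul_of_pos_right δ.s h.n_pos
    omega
  refine finrank_lt_of_sum_hasseDeriv_eq_zero (h.ord_le.trans hsp) h.d_lt
    (fun P hP => (δ.mem_solSpace.1 hP).1) (δ.opCoeff_ne_zero h) fun P hP => ?_
  rw [← diffOp_apply]
  exact (δ.mem_solSpace.1 hP).2

/-- The polynomial with the given coefficients of degree at most `d`. -/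
def polyOf (f : ℕ → F) : F[X] := ∑ c ∈ Finset.range (δ.d + 1), monomial c (f c)

theorem natDegree_polyOf_le (f : ℕ → F) : (δ.polyOf f).natDegree ≤ δ.d :=
  natDegree_sum_le_of_forall_le _ _ fun c hc => (natDegree_monomial_le _).trans (by
    have := Finset.mem_range.1 hc; omega)

theorem polyOf_coeff {P : F[X]} (hP : P.natDegree ≤ δ.d) : δ.polyOf P.coeff = P :=
  (P.as_sum_range' _ (Nat.lt_succ_of_le hP)).symm

theorem coeff_diffOp_polyOf (f : ℕ → F) (q : ℕ) :
    (δ.diffOp (δ.polyOf f)).coeff q = ∑ k ∈ Finset.range (δ.d + 1), δ.odeRow q k * f k := by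
  rw [polyOf, map_sum, finsetSum_coeff]
  refine Finset.sum_congr rfl fun k hk => ?_
  rw [odeRow, if_pos (Finset.mem_range.1 hk), diffOp_apply, finsetSum_coeff, Finset.sum_mul]
  refine Finset.sum_congr rfl fun j _ => ?_
  rw [hasseDeriv_monomial, ← C_mul_X_pow_eq_monomial, ← mul_assoc, coeff_mul_X_pow', coeff_mul_C,
    coeff_opPoly]
  rcases Nat.lt_or_ge k j with hkj | hkj
  · simp [Nat.choose_eq_zero_of_lt hkj]
  · have h1 : q - (k - j) = q + j - k := by omega
    have h2 : k - j ≤ q ↔ k < q + j + 1 := by omega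
    rw [h1]
    simp only [h2]
    by_cases h3 : k < q + j + 1 <;> by_cases h4 : q + j - k < δ.deg <;> simp [h3, h4]
    ring

/-- The polynomial found in a trial. -/
def trialPoly (κ : ℕ) : F[X] := δ.polyOf (δ.trialCoeff κ)

theorem trialWord_eq (κ i j : ℕ) :
    δ.trialWord κ i j = (hasseDeriv j (δ.trialPoly κ)).eval (δ.a i) := by
  rw [trialPoly, polyOf, eval_hasseDeriv_sum_monomial]
  rfl

theorem dot_odeRow (q : ℕ) (u : ℕ → F) :
    dot (δ.d + 2) (δ.odeRow q) u = (δ.diffOp (δ.polyOf u)).coeff q := by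
  rw [coeff_diffOp_polyOf, dot, Finset.sum_range_succ]
  simp [odeRow]

theorem dot_sampleRow (κ q : ℕ) (u : ℕ → F) :
    dot (δ.d + 2) (δ.sampleRow κ q) u =
      (hasseDeriv (q % δ.s) (δ.polyOf u)).eval (δ.a (δ.digit κ (q / δ.s) / δ.ℓ)) -
        δ.y (δ.digit κ (q / δ.s) / δ.ℓ) (δ.digit κ (q / δ.s) % δ.ℓ) (q % δ.s) * u (δ.d + 1) := by
  rw [dot, Finset.sum_range_succ, polyOf, eval_hasseDeriv_sum_monomial]
  have h1 : δ.sampleRow κ q (δ.d + 1) =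
      - δ.y (δ.digit κ (q / δ.s) / δ.ℓ) (δ.digit κ (q / δ.s) % δ.ℓ) (q % δ.s) := by
    simp [sampleRow]
  rw [h1, neg_mul, ← sub_eq_add_neg]
  congr 1
  refine Finset.sum_congr rfl fun k hk => ?_
  rw [sampleRow, if_pos (Finset.mem_range.1 hk)]
  ring

/-- A sample is good for a polynomial if the polynomial agrees with all sampled entries and is
determined by the sampled coordinates. -/
def GoodSample (ω : Fin δ.samples → ℕ) (P : F[X]) : Prop :=
  (∀ τ, ∀ j < δ.s, (hasseDeriv j P).eval (δ.a (ω τ / δ.ℓ)) = δ.y (ω τ / δ.ℓ) (ω τ % δ.ℓ) j) ∧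
  ∀ Q ∈ δ.solSpace, (∀ τ, Q ∈ vanish δ.s (δ.a (ω τ / δ.ℓ))) → Q = 0

/-- The coefficients of P followed by the scalar 1 solve the system, so some spanning vector has
nonzero scalar. After normalization, its difference from P lies in the solution space and vanishes
to order s at all sampled points, hence is zero for a good sample. -/
theorem trialPoly_eq {p : ℕ} (h : δ.Valid p) {κ : ℕ} {P : F[X]} (hP : δ.IsClose P)
    (hg : δ.GoodSample (fun τ => δ.digit κ τ) P) : δ.trialPoly κ = P := by
  have hPop := δ.diffOp_eq_zero h hP
  have hs := h.s_pos
  let u : ℕ → F := fun k => if k = δ.d + 1 then 1 else P.coeff k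
  have hu1 : u (δ.d + 1) = 1 := if_pos rfl
  have hupoly : δ.polyOf u = P := by
    conv_rhs => rw [← δ.polyOf_coeff hP.1]
    rw [polyOf, polyOf]
    refine Finset.sum_congr rfl fun c hc => ?_
    have h1 : ¬ (c = δ.d + 1) := by have := Finset.mem_range.1 hc; omega
    simp [u, h1]
  have hu : ∀ q < δ.deg + δ.d + δ.samples * δ.s, dot (δ.d + 2) (δ.trialRow κ q) u = 0 := by
    intro q hq
    by_cases hq1 : q < δ.deg + δ.d
    · have h1 : δ.trialRow κ q = δ.odeRow q := funext fun k => if_pos hq1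
      rw [h1, dot_odeRow, hupoly, hPop, coeff_zero]
    · have h1 : δ.trialRow κ q = δ.sampleRow κ (q - (δ.deg + δ.d)) := funext fun k => if_neg hq1
      rw [h1, dot_sampleRow, hupoly, hu1, mul_one, hg.1 ⟨(q - (δ.deg + δ.d)) / δ.s,
        Nat.div_lt_of_lt_mul (by rw [mul_comm]; omega)⟩ _ (Nat.mod_lt _ hs), sub_self]
  obtain ⟨c, hc⟩ := exists_comb_kerTab (δ.trialRow κ) hu
  set v := δ.trialTab κ (δ.trialIdx κ) with hv
  have hz : v (δ.d + 1) ≠ 0 := by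
    obtain ⟨k, hk, hk0⟩ : ∃ k < δ.d + 2, δ.trialTab κ k (δ.d + 1) ≠ 0 := by
      by_contra! h0
      have h1 := hc (δ.d + 1) (by omega)
      rw [hu1, Finset.sum_eq_zero] at h1
      · exact one_ne_zero h1
      · intro k hk
        have := h0 k (Finset.mem_range.1 hk)
        rw [trialTab] at this
        rw [this, mul_zero]
    exact lastIdx_spec (P := fun k => δ.trialTab κ k (δ.d + 1) ≠ 0) hk hk0
  have hrow : ∀ q < δ.deg + δ.d + δ.samples * δ.s, dot (δ.d + 2) (δ.trialRow κ q) v = 0 :=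
    fun q hq => dot_kerTab (δ.trialRow κ) hq (lastIdx_lt _ (by omega))
  have hpoly : δ.trialPoly κ = (v (δ.d + 1))⁻¹ • δ.polyOf v := by
    rw [trialPoly, polyOf, polyOf, Finset.smul_sum]
    refine Finset.sum_congr rfl fun c _ => ?_
    rw [smul_monomial, trialCoeff, smul_eq_mul, mul_comm]
  have hsol : δ.diffOp (δ.trialPoly κ) = 0 := by
    have h1 : δ.diffOp (δ.polyOf v) = 0 := by
      ext q
      rw [coeff_zero]
      rcases Nat.lt_or_ge q (δ.deg + δ.d) with hq | hq
      · have h2 := hrow q (by omega)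
        have h3 : δ.trialRow κ q = δ.odeRow q := funext fun k => if_pos hq
        rwa [h3, dot_odeRow] at h2
      · exact coeff_eq_zero_of_natDegree_lt
          ((δ.natDegree_diffOp_lt (δ.natDegree_polyOf_le v)).trans_le hq)
    rw [hpoly, map_smul, h1, smul_zero]
  refine sub_eq_zero.1 (hg.2 _ ?_ fun τ j hj => ?_)
  · exact δ.solSpace.sub_mem (δ.mem_solSpace.2 ⟨δ.natDegree_polyOf_le _, hsol⟩)
      (δ.mem_solSpace.2 ⟨hP.1, hPop⟩)
  · have hq : (τ : ℕ) * δ.s + j < δ.samples * δ.s := by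
      calc (τ : ℕ) * δ.s + j < (τ + 1) * δ.s := by rw [Nat.succ_mul]; omega
        _ ≤ _ := Nat.mul_le_mul_right _ τ.2
    have h2 := hrow (δ.deg + δ.d + ((τ : ℕ) * δ.s + j)) (by omega)
    have h3 : δ.trialRow κ (δ.deg + δ.d + ((τ : ℕ) * δ.s + j)) = δ.sampleRow κ (τ * δ.s + j) :=
      funext fun k => by rw [trialRow, if_neg (by omega), Nat.add_sub_cancel_left]
    have h4 : ((τ : ℕ) * δ.s + j) % δ.s = j := by rw [Nat.mul_add_mod', Nat.mod_eq_of_lt hj]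
    have h5 : ((τ : ℕ) * δ.s + j) / δ.s = τ := by
      rw [mul_comm, Nat.mul_add_div hs, Nat.div_eq_of_lt hj, add_zero]
    rw [h3, dot_sampleRow, h4, h5, sub_eq_zero] at h2
    rw [map_sub, eval_sub, hg.1 τ j hj, hpoly, map_smul, eval_smul, h2, smul_eq_mul]
    field_simp
    ring

end RecInput

end ListRec

end

noncomputable section

namespace ListRec

universe u

/-! ### Counting good samples -/

/-- Bernoulli's inequality (1 + 1/x)^k ≥ 1 + k/x without denominators; it serves both for the number
of samples and for the number of trials. -/
theorem add_mul_pow_le (x k : ℕ) : (x + k) * x ^ k ≤ x * (x + 1) ^ k := by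
  induction k with
  | zero => simp
  | succ k ih =>
    calc (x + (k + 1)) * x ^ (k + 1) = (x * x + k * x + x) * x ^ k := by ring
      _ ≤ (x * x + k * x + x + k) * x ^ k := Nat.mul_le_mul_right _ (Nat.le_add_right _ _)
      _ = ((x + k) * x ^ k) * (x + 1) := by ring
      _ ≤ (x * (x + 1) ^ k) * (x + 1) := Nat.mul_le_mul_right _ ih
      _ = x * (x + 1) ^ (k + 1) := by ring

theorem two_mul_pow_le (x : ℕ) : 2 * x ^ (x + 1) ≤ (x + 1) ^ (x + 1) := by
  rcases Nat.eq_zero_or_pos x with rfl | hx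
  · simp
  · refine le_of_mul_le_mul_left (a := x) (le_trans ?_ (add_mul_pow_le x (x + 1))) hx
    rw [← mul_assoc]
    exact Nat.mul_le_mul_right _ (by omega)

section Design

variable {F V ι : Type*} [Field F] [AddCommGroup V] [Module F V] [Fintype ι]

/-- Induction on the number of samples, splitting off the first one. The design inequality is
assumed for all subspaces with the same m, so it can be reused inside W ⊓ H i. -/
theorem sum_finrank_iInf_le {m d : ℕ} {H : ι → Submodule F V} (t : ℕ) {W : Submodule F V}
    (h : ∀ U ≤ W, ∑ i, Module.finrank F ↥(U ⊓ H i) * m ≤ Module.finrank F U * d) :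
    ∑ f : Fin t → ι, Module.finrank F ↥(W ⊓ ⨅ τ, H (f τ)) * m ^ t ≤
      Module.finrank F W * d ^ t := by
  induction t generalizing W with
  | zero =>
    have h0 : ∀ f : Fin 0 → ι, W ⊓ ⨅ τ, H (f τ) = W := fun f => by
      rw [iInf_of_empty, inf_top_eq]
    rw [Fintype.sum_unique, h0, pow_zero, pow_zero]
  | succ t ih =>
    have h1 : ∑ f : Fin (t + 1) → ι, Module.finrank F ↥(W ⊓ ⨅ τ, H (f τ)) * m ^ (t + 1) =
        ∑ i : ι, (∑ f : Fin t → ι, Module.finrank F ↥((W ⊓ H i) ⊓ ⨅ τ, H (f τ)) * m ^ t) * m := by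
      rw [← (Fin.consEquiv fun _ => ι).sum_comp, Fintype.sum_prod_type]
      refine Finset.sum_congr rfl fun i _ => ?_
      rw [Finset.sum_mul]
      refine Finset.sum_congr rfl fun f _ => ?_
      have h2 : ⨅ τ, H ((Fin.consEquiv fun _ => ι) (i, f) τ) = H i ⊓ ⨅ τ, H (f τ) := by
        refine le_antisymm (le_inf (iInf_le _ 0) (le_iInf fun τ => iInf_le _ τ.succ))
          (le_iInf fun τ => ?_)
        refine Fin.cases ?_ (fun τ => ?_) τ
        · exact inf_le_left
        · exact inf_le_right.trans (iInf_le _ τ)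
      rw [h2, inf_assoc, pow_succ, mul_assoc]
    rw [h1]
    calc ∑ i : ι, (∑ f : Fin t → ι, Module.finrank F ↥((W ⊓ H i) ⊓ ⨅ τ, H (f τ)) * m ^ t) * m
        ≤ ∑ i : ι, (Module.finrank F ↥(W ⊓ H i) * d ^ t) * m :=
          Finset.sum_le_sum fun i _ => Nat.mul_le_mul_right _
            (ih fun U hU => h U (hU.trans inf_le_left))
      _ = (∑ i : ι, Module.finrank F ↥(W ⊓ H i) * m) * d ^ t := by
          rw [Finset.sum_mul]
          exact Finset.sum_congr rfl fun i _ => by ring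
      _ ≤ (Module.finrank F W * d) * d ^ t := Nat.mul_le_mul_right _ (h W le_rfl)
      _ = _ := by ring

-- Markov's inequality: a nonzero intersection has dimension at least 1.
open Classical in
theorem card_iInf_ne_bot_le {m d : ℕ} {H : ι → Submodule F V} (t : ℕ) {W : Submodule F V}
    [FiniteDimensional F W]
    (h : ∀ U ≤ W, ∑ i, Module.finrank F ↥(U ⊓ H i) * m ≤ Module.finrank F U * d) :
    (Finset.univ.filter fun f : Fin t → ι => W ⊓ ⨅ τ, H (f τ) ≠ ⊥).card * m ^ t ≤
      Module.finrank F W * d ^ t := by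
  refine le_trans ?_ (sum_finrank_iInf_le t h)
  rw [← smul_eq_mul, ← Finset.sum_const]
  refine (Finset.sum_le_sum fun f hf => ?_).trans
    (Finset.sum_le_sum_of_subset (Finset.filter_subset _ _))
  rw [Finset.mem_filter] at hf
  have : FiniteDimensional F ↥(W ⊓ ⨅ τ, H (f τ)) :=
    Submodule.finiteDimensional_of_le (inf_le_left : _ ≤ W)
  exact Nat.le_mul_of_pos_left _ (Nat.pos_of_ne_zero fun h0 =>
    hf.2 (Submodule.finrank_eq_zero.1 h0))

end Design

/-! ### Probability of a good sample, list size, and failure probability -/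

namespace RecInput

variable {F : Type u} [Field F] (δ : RecInput F) {p : ℕ}

open Classical in
/-- The good samples for a polynomial. -/
def goodSet (P : F[X]) : Finset (Fin δ.samples → Fin (δ.n * δ.ℓ)) :=
  Finset.univ.filter fun ω => δ.GoodSample (fun τ => ω τ) P

theorem mem_goodSet {P : F[X]} {ω : Fin δ.samples → Fin (δ.n * δ.ℓ)} :
    ω ∈ δ.goodSet P ↔ δ.GoodSample (fun τ => ω τ) P := by
  simp [goodSet]

omit [Field F] in
theorem two_mul_ord_le : 2 * δ.ord ≤ 2 ^ (δ.ord.size + 1) := by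
  rw [pow_succ, mul_comm]
  exact Nat.mul_le_mul_right _ (Nat.lt_size_self _).le

-- The choice of `samples`: with x + 1 = 2g, each block of 2g samples contracts by (x/(x+1))^(x+1) ≤
-- 1/2, and size(r) + 1 blocks bring r down to at most 1/2.
omit [Field F] in
theorem pow_samples_le (h : δ.Valid p) {c : ℕ} (hc : δ.agr ≤ c) :
    2 * δ.ord * δ.d ^ δ.samples ≤ δ.mult ^ δ.samples * c ^ δ.samples := by
  obtain ⟨x, hx⟩ : ∃ x, 2 * δ.gapInv = x + 1 := ⟨2 * δ.gapInv - 1, by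
    have : 0 < δ.gapInv := Nat.succ_pos _
    omega⟩
  have h1 := h.d_mul_le
  have h2 := δ.two_mul_ord_le
  have hs : δ.samples = (x + 1) * (δ.ord.size + 1) := by rw [samples, hx]
  rw [hx, Nat.add_sub_cancel] at h1
  have h3 : 2 ^ (δ.ord.size + 1) * x ^ δ.samples ≤ (x + 1) ^ δ.samples := by
    rw [hs, pow_mul, pow_mul, ← mul_pow]
    exact Nat.pow_le_pow_left (two_mul_pow_le x) _
  refine le_of_mul_le_mul_left (a := (x + 1) ^ δ.samples) ?_ (by positivity)
  calc (x + 1) ^ δ.samples * (2 * δ.ord * δ.d ^ δ.samples)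
      = 2 * δ.ord * ((x + 1) * δ.d) ^ δ.samples := by rw [mul_pow]; ring
    _ ≤ 2 ^ (δ.ord.size + 1) * (x * (δ.mult * δ.agr)) ^ δ.samples :=
        Nat.mul_le_mul h2 (Nat.pow_le_pow_left h1 _)
    _ = (2 ^ (δ.ord.size + 1) * x ^ δ.samples) * (δ.mult ^ δ.samples * δ.agr ^ δ.samples) := by
        rw [mul_pow, mul_pow]; ring
    _ ≤ _ := Nat.mul_le_mul h3 (Nat.mul_le_mul_left _ (Nat.pow_le_pow_left hc _))

variable [Fact p.Prime] [CharP F p]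

/-- At least half of the tuples of agreeing coordinates cut the solution space down to zero. Pairing
each coordinate with an agreeing list entry turns such tuples into good samples. -/
theorem pow_agr_le (h : δ.Valid p) {P : F[X]} (hP : δ.IsClose P) :
    δ.agr ^ δ.samples ≤ 2 * (δ.goodSet P).card := by
  classical
  have hfd : FiniteDimensional F δ.solSpace :=
    (finiteDimensional_of_natDegree_le fun P hP => (δ.mem_solSpace.1 hP).1).1
  let ι := {i // i ∈ δ.agreeSet P}
  have hι : Fintype.card ι = (δ.agreeSet P).card := Fintype.card_coe _
  let H : ι → Submodule F F[X] := fun i => vanish δ.s (δ.a i.1)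
  have hdes : ∀ U ≤ δ.solSpace, ∑ i, Module.finrank F ↥(U ⊓ H i) * δ.mult ≤
      Module.finrank F U * δ.d := by
    intro U hU
    -- This gives s + 1 - dim U ≥ `mult`, so one constant serves all subspaces of the solution
    -- space.
    have h1 : Module.finrank F U < δ.ord :=
      (Submodule.finrank_mono hU).trans_lt (δ.finrank_solSpace_lt h)
    refine le_trans ?_ (sum_finrank_inf_vanish_le (s := δ.s) h.inj h.d_lt
      fun P hP => (δ.mem_solSpace.1 (hU hP)).1)
    rw [Finset.sum_coe_sort (δ.agreeSet P)
      fun i => Module.finrank F ↥(U ⊓ vanish δ.s (δ.a i)) * δ.mult]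
    refine (Finset.sum_le_sum_of_subset (Finset.subset_univ _)).trans
      (Finset.sum_le_sum fun i _ => Nat.mul_le_mul_left _ ?_)
    rw [mult]; omega
  have hbad := card_iInf_ne_bot_le δ.samples hdes
  set bad := Finset.univ.filter fun f : Fin δ.samples → ι => δ.solSpace ⊓ ⨅ τ, H (f τ) ≠ ⊥
    with hbaddef
  have h2 : 2 * bad.card ≤ Fintype.card ι ^ δ.samples := by
    have h3 := δ.pow_samples_le h hP.2
    rw [← hι] at h3
    refine le_of_mul_le_mul_left (a := δ.mult ^ δ.samples) ?_ (pow_pos h.mult_pos _)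
    have h4 := Nat.mul_le_mul_right (δ.d ^ δ.samples) (δ.finrank_solSpace_lt h).le
    nlinarith
  have h5 : (Finset.univ.filter fun f : Fin δ.samples → ι => δ.solSpace ⊓ ⨅ τ, H (f τ) = ⊥).card
      + bad.card = Fintype.card ι ^ δ.samples := by
    have := Finset.card_filter_add_card_filter_not (s := (Finset.univ : Finset (Fin δ.samples → ι)))
      (fun f => δ.solSpace ⊓ ⨅ τ, H (f τ) = ⊥)
    rw [Finset.card_univ, Fintype.card_fun, Fintype.card_fin] at this
    exact this
  have h6 : δ.agr ^ δ.samples ≤ Fintype.card ι ^ δ.samples :=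
    Nat.pow_le_pow_left (hι ▸ hP.2) _
  have hagree : ∀ i : ι, δ.Agrees P i.1 := fun i => δ.mem_agreeSet.1 i.2
  choose l hl hly using hagree
  -- The coordinate is recovered by dividing by ℓ, so the induced map on tuples is injective.
  let ψ : ι → Fin (δ.n * δ.ℓ) := fun i => ⟨i.1 * δ.ℓ + l i, by
    calc (i.1 : ℕ) * δ.ℓ + l i < (i.1 + 1) * δ.ℓ := by rw [Nat.succ_mul]; have := hl i; omega
      _ ≤ _ := Nat.mul_le_mul_right _ i.1.2⟩
  have hψ1 : ∀ i, (ψ i : ℕ) / δ.ℓ = i.1 := fun i => by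
    show ((i.1 : ℕ) * δ.ℓ + l i) / δ.ℓ = _
    rw [mul_comm, Nat.mul_add_div h.ℓ_pos, Nat.div_eq_of_lt (hl i), add_zero]
  have hψ2 : ∀ i, (ψ i : ℕ) % δ.ℓ = l i := fun i => by
    show ((i.1 : ℕ) * δ.ℓ + l i) % δ.ℓ = _
    rw [Nat.mul_add_mod', Nat.mod_eq_of_lt (hl i)]
  have h7 : (Finset.univ.filter fun f : Fin δ.samples → ι =>
      δ.solSpace ⊓ ⨅ τ, H (f τ) = ⊥).card ≤ (δ.goodSet P).card := by
    refine Finset.card_le_card_of_injOn (fun f τ => ψ (f τ)) (fun f hf => ?_) ?_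
    · rw [Finset.mem_coe, Finset.mem_filter] at hf
      rw [Finset.mem_coe, mem_goodSet]
      refine ⟨fun τ j hj => ?_, fun Q hQ hQv => ?_⟩
      · rw [hψ1, hψ2]
        exact hly _ j hj
      · have : Q ∈ δ.solSpace ⊓ ⨅ τ, H (f τ) := by
          refine ⟨hQ, (Submodule.mem_iInf _).2 fun τ => ?_⟩
          have := hQv τ
          rwa [hψ1] at this
        rwa [hf.2, Submodule.mem_bot] at this
    · intro f _ f' _ hff
      funext τ
      apply Subtype.ext
      apply Fin.ext
      rw [← hψ1, ← hψ1]
      exact congrArg (fun v : Fin (δ.n * δ.ℓ) => (v : ℕ) / δ.ℓ) (congrFun hff τ)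
  omega

-- Both polynomials take the sampled values, so their difference lies in the solution space,
-- vanishes at all sampled points, and is zero. Thus good sets are disjoint, which bounds the list
-- size.
omit [Fact p.Prime] [CharP F p] in
theorem eq_of_mem_goodSet (h : δ.Valid p) {P P' : F[X]} (hP : δ.IsClose P) (hP' : δ.IsClose P')
    {ω : Fin δ.samples → Fin (δ.n * δ.ℓ)} (h1 : ω ∈ δ.goodSet P) (h2 : ω ∈ δ.goodSet P') :
    P = P' := by
  rw [mem_goodSet] at h1 h2
  refine sub_eq_zero.1 (h1.2 _ (δ.solSpace.sub_mem
    (δ.mem_solSpace.2 ⟨hP.1, δ.diffOp_eq_zero h hP⟩)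
    (δ.mem_solSpace.2 ⟨hP'.1, δ.diffOp_eq_zero h hP'⟩)) fun τ j hj => ?_)
  rw [map_sub, eval_sub, h1.1 τ j hj, h2.1 τ j hj, sub_self]

-- Since n ≤ gA, a random pair has chance at least 1/(ℓg) of having an agreeing coordinate and one
-- prescribed entry there. The factor 2 in r = 2ℓg leaves 2^t to spare, more than the 2 lost in
-- `pow_agr_le`.
omit [Field F] [Fact p.Prime] [CharP F p] in
theorem two_mul_pow_samples_le (h : δ.Valid p) :
    2 * (δ.n * δ.ℓ) ^ δ.samples ≤ δ.bound * δ.agr ^ δ.samples := by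
  have ht : δ.samples ≠ 0 := by rw [samples, gapInv]; positivity
  have h1 : δ.n * δ.ℓ ≤ δ.ℓ * δ.gapInv * δ.agr := by
    have := Nat.mul_le_mul_left δ.ℓ h.n_le
    nlinarith
  calc 2 * (δ.n * δ.ℓ) ^ δ.samples ≤ 2 ^ δ.samples * (δ.ℓ * δ.gapInv * δ.agr) ^ δ.samples :=
        Nat.mul_le_mul (Nat.le_self_pow ht 2) (Nat.pow_le_pow_left h1 _)
    _ = _ := by rw [bound, ord, ← mul_pow, ← mul_pow]; ring

/-- The number of polynomials that have to be found. -/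
theorem card_le_bound (h : δ.Valid p) {S : Finset F[X]} (hS : ∀ P ∈ S, δ.IsClose P) :
    S.card ≤ δ.bound := by
  classical
  have h1 : ∑ P ∈ S, (δ.goodSet P).card ≤ (δ.n * δ.ℓ) ^ δ.samples := by
    rw [← Finset.card_biUnion]
    · refine (Finset.card_le_univ _).trans ?_
      rw [Fintype.card_fun, Fintype.card_fin, Fintype.card_fin]
    · intro P hP P' hP' hne
      exact Finset.disjoint_left.2 fun ω h1 h2 =>
        hne (δ.eq_of_mem_goodSet h (hS P hP) (hS P' hP') h1 h2)
  have h2 : S.card * δ.agr ^ δ.samples ≤ 2 * ∑ P ∈ S, (δ.goodSet P).card := by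
    rw [← smul_eq_mul, ← Finset.sum_const, Finset.mul_sum]
    exact Finset.sum_le_sum fun P hP => δ.pow_agr_le h (hS P hP)
  have h3 := δ.two_mul_pow_samples_le h
  exact Nat.le_of_mul_le_mul_right (by omega : S.card * δ.agr ^ δ.samples ≤ _)
    (pow_pos h.agr_pos _)

/-- A sample is good with probability at least the inverse of the bound on the list size. -/
theorem pow_le_bound_mul (h : δ.Valid p) {P : F[X]} (hP : δ.IsClose P) :
    (δ.n * δ.ℓ) ^ δ.samples ≤ δ.bound * (δ.goodSet P).card := by
  have h1 := δ.two_mul_pow_samples_le h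
  have h2 := Nat.mul_le_mul_left δ.bound (δ.pow_agr_le h hP)
  nlinarith

omit [Field F] [Fact p.Prime] [CharP F p] in
theorem bound_pos (h : δ.Valid p) : 0 < δ.bound := pow_pos h.ord_pos _

-- Bernoulli in the form (1 - 1/N)^(100N²) ≤ 1/(100N), with N = `bound`: failure 1/(100N) for each
-- of at most N polynomials adds up to 1/100.
omit [Field F] [Fact p.Prime] [CharP F p] in
theorem pow_trials_le (h : δ.Valid p) :
    100 * δ.bound * (δ.bound - 1) ^ δ.trials ≤ δ.bound ^ δ.trials := by
  obtain ⟨x, hx⟩ : ∃ x, δ.bound = x + 1 := ⟨δ.bound - 1, by have := δ.bound_pos h; omega⟩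
  have ht : δ.trials = 100 * (x + 1) ^ 2 := by rw [trials, hx]
  rw [hx, Nat.add_sub_cancel]
  rcases Nat.eq_zero_or_pos x with rfl | h0
  · rw [ht]; simp
  · refine le_of_mul_le_mul_left (a := x) (le_trans ?_ (add_mul_pow_le x δ.trials)) h0
    rw [← mul_assoc]
    refine Nat.mul_le_mul_right _ ?_
    rw [ht]
    nlinarith

open Classical in
/-- All polynomials are found except with small probability. -/
theorem card_fail_le (h : δ.Valid p) {S : Finset F[X]} (hS : ∀ P ∈ S, δ.IsClose P) :
    100 * (Finset.univ.filter fun G : Fin δ.trials → Fin δ.samples → Fin (δ.n * δ.ℓ) =>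
      ∃ P ∈ S, ∀ κ, G κ ∉ δ.goodSet P).card ≤ ((δ.n * δ.ℓ) ^ δ.samples) ^ δ.trials := by
  have hT : Fintype.card (Fin δ.samples → Fin (δ.n * δ.ℓ)) = (δ.n * δ.ℓ) ^ δ.samples := by
    rw [Fintype.card_fun, Fintype.card_fin, Fintype.card_fin]
  set T := (δ.n * δ.ℓ) ^ δ.samples with hTdef
  have h1 : ∀ P ∈ S, (Finset.univ.filter fun G : Fin δ.trials → Fin δ.samples →
      Fin (δ.n * δ.ℓ) => ∀ κ, G κ ∉ δ.goodSet P).card = (T - (δ.goodSet P).card) ^ δ.trials := by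
    intro P _
    have h2 : (Finset.univ.filter fun G : Fin δ.trials → Fin δ.samples →
        Fin (δ.n * δ.ℓ) => ∀ κ, G κ ∉ δ.goodSet P) =
        Fintype.piFinset fun _ => (δ.goodSet P)ᶜ := by
      ext G; simp
    rw [h2, Fintype.card_piFinset_const, Finset.card_compl, hT]
  have h3 : ∀ P ∈ S, 100 * δ.bound * (T - (δ.goodSet P).card) ^ δ.trials ≤ T ^ δ.trials := by
    intro P hP
    have h4 := δ.pow_le_bound_mul h (hS P hP)
    refine le_of_mul_le_mul_left (a := δ.bound ^ δ.trials) ?_ (pow_pos (δ.bound_pos h) _)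
    have h5 : δ.bound * (T - (δ.goodSet P).card) ≤ (δ.bound - 1) * T := by
      rw [Nat.mul_sub, Nat.sub_mul, one_mul]
      omega
    calc δ.bound ^ δ.trials * (100 * δ.bound * (T - (δ.goodSet P).card) ^ δ.trials)
        = 100 * δ.bound * (δ.bound * (T - (δ.goodSet P).card)) ^ δ.trials := by
          rw [mul_pow]; ring
      _ ≤ 100 * δ.bound * ((δ.bound - 1) * T) ^ δ.trials :=
          Nat.mul_le_mul_left _ (Nat.pow_le_pow_left h5 _)
      _ = (100 * δ.bound * (δ.bound - 1) ^ δ.trials) * T ^ δ.trials := by rw [mul_pow]; ring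
      _ ≤ _ := Nat.mul_le_mul_right _ (δ.pow_trials_le h)
  have h6 : (Finset.univ.filter fun G : Fin δ.trials → Fin δ.samples → Fin (δ.n * δ.ℓ) =>
      ∃ P ∈ S, ∀ κ, G κ ∉ δ.goodSet P).card ≤
      ∑ P ∈ S, (T - (δ.goodSet P).card) ^ δ.trials := by
    rw [← Finset.sum_congr rfl h1]
    refine (Finset.card_le_card fun G hG => ?_).trans Finset.card_biUnion_le
    rw [Finset.mem_filter] at hG
    obtain ⟨-, P, hP, hG⟩ := hG
    exact Finset.mem_biUnion.2 ⟨P, hP, Finset.mem_filter.2 ⟨Finset.mem_univ _, hG⟩⟩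
  refine le_of_mul_le_mul_left (a := δ.bound) ?_ (δ.bound_pos h)
  calc δ.bound * (100 * _) ≤ δ.bound * (100 * ∑ P ∈ S, (T - (δ.goodSet P).card) ^ δ.trials) :=
        Nat.mul_le_mul_left _ (Nat.mul_le_mul_left _ h6)
    _ = ∑ P ∈ S, 100 * δ.bound * (T - (δ.goodSet P).card) ^ δ.trials := by
        rw [← Finset.mul_sum]; ring
    _ ≤ S.card * T ^ δ.trials := (Finset.sum_le_card_nsmul _ _ _ h3)
    _ ≤ _ := Nat.mul_le_mul_right _ (δ.card_le_bound h hS)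

omit [Fact p.Prime] [CharP F p] in
/-- Unique decoding from lists of size one. -/
theorem eq_of_isClose (h : δ.Valid p) (hℓ : δ.ℓ = 1)
    (hgap : δ.s * δ.n + δ.d < 2 * (δ.s * δ.agr)) {P P' : F[X]} (hP : δ.IsClose P)
    (hP' : δ.IsClose P') : P = P' := by
  classical
  by_contra hne
  have h1 := sum_le_natDegree h.inj (sub_ne_zero.2 hne) (m := fun _ => δ.s)
    (δ.agreeSet P ∩ δ.agreeSet P') (by
      intro i hi
      rw [Finset.mem_inter, mem_agreeSet, mem_agreeSet] at hi
      obtain ⟨⟨l, hl, hy⟩, l', hl', hy'⟩ := hi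
      have hll : l = l' := by omega
      refine mem_vanish_iff_dvd.1 fun j hj => ?_
      rw [map_sub, eval_sub, hy j hj, hy' j hj, hll, sub_self])
  rw [Finset.sum_const, smul_eq_mul] at h1
  have h2 : (P - P').natDegree ≤ δ.d := (natDegree_sub_le _ _).trans (max_le hP.1 hP'.1)
  have h3 := Finset.card_union_add_card_inter (δ.agreeSet P) (δ.agreeSet P')
  have h4 : (δ.agreeSet P ∪ δ.agreeSet P').card ≤ δ.n := by
    simpa using Finset.card_le_univ (δ.agreeSet P ∪ δ.agreeSet P')
  have h5 := hP.2
  have h6 := hP'.2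
  have h7 : 2 * δ.agr ≤ δ.n + (δ.agreeSet P ∩ δ.agreeSet P').card := by omega
  have h8 := Nat.mul_le_mul_left δ.s h7
  nlinarith

end RecInput

/-! ### Seeds -/

/-- The samples determined by a seed. -/
def seedEquiv (b N t : ℕ) : Fin (b ^ (N * t)) ≃ (Fin N → Fin t → Fin b) :=
  finFunctionFinEquiv.symm.trans
    ((finProdFinEquiv.symm.arrowCongr (Equiv.refl _)).trans (Equiv.curry _ _ _))

theorem seedEquiv_apply {b N t : ℕ} (g : Fin (b ^ (N * t))) (κ : Fin N) (τ : Fin t) :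
    (seedEquiv b N t g κ τ : ℕ) = g / b ^ ((κ : ℕ) * t + τ) % b := by
  have : (seedEquiv b N t g κ τ) = finFunctionFinEquiv.symm g (finProdFinEquiv (κ, τ)) := rfl
  rw [this, finFunctionFinEquiv_symm_apply_val, finProdFinEquiv_apply_val]
  congr 3
  ring

end ListRec

end

noncomputable section

namespace ListRec

universe u

/-! ### The output of the algorithm -/

namespace RecInput

variable {F : Type u} [Field F] (δ : RecInput F)

/-- The codeword of a polynomial. -/
def encode (P : F[X]) : Fin δ.n → (Fin δ.s → F) := multEnc δ.s (fun i : Fin δ.n => δ.a i) P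

/-- The output of the algorithm. -/
def words : List (Fin δ.n → (Fin δ.s → F)) := δ.accepted.map fun κ => δ.encode (δ.trialPoly κ)

/-- All polynomials that have to be found are found in good trials. -/
def GoodSeed : Prop :=
  ∀ P, δ.IsClose P → ∃ κ < δ.trials, δ.GoodSample (fun τ => δ.digit κ τ) P

open Classical in
theorem isClose_iff {P : F[X]} : δ.IsClose P ↔ P.natDegree ≤ δ.d ∧
    (∑ i ∈ Finset.range δ.n, if δ.Agrees P i then 0 else 1) < δ.e := by
  have h1 : (∑ i ∈ Finset.range δ.n, if δ.Agrees P i then 0 else 1) + (δ.agreeSet P).card =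
      δ.n := by
    rw [Finset.sum_range, agreeSet, Finset.card_filter, ← Finset.sum_add_distrib]
    rw [Finset.sum_congr rfl (g := fun _ => 1) fun i _ => by split_ifs <;> rfl]
    simp
  rw [IsClose, agr]
  constructor <;> rintro ⟨h2, h3⟩ <;> exact ⟨h2, by omega⟩

theorem encode_eq_iff {P Q : F[X]} : δ.encode P = δ.encode Q ↔ ∀ i < δ.n, ∀ j < δ.s,
    (hasseDeriv j P).eval (δ.a i) = (hasseDeriv j Q).eval (δ.a i) := by
  constructor
  · intro h i hi j hj
    exact congrFun (congrFun h ⟨i, hi⟩) ⟨j, hj⟩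
  · intro h
    funext i j
    exact h i i.2 j j.2

theorem accepts_iff (κ : ℕ) : δ.accepts κ ↔ δ.IsClose (δ.trialPoly κ) ∧
    ∀ κ' < κ, δ.encode (δ.trialPoly κ) ≠ δ.encode (δ.trialPoly κ') := by
  have hd : (δ.trialPoly κ).natDegree ≤ δ.d := δ.natDegree_polyOf_le _
  rw [accepts, isClose_iff, and_iff_right hd]
  have hw : δ.trialWord = fun κ i j => (hasseDeriv j (δ.trialPoly κ)).eval (δ.a i) := by
    funext κ i j
    exact δ.trialWord_eq κ i j
  rw [hw]
  simp only [Agrees, ne_eq, encode_eq_iff]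
  push Not
  convert Iff.rfl using 4
  congr

theorem mem_accepted {κ : ℕ} : κ ∈ δ.accepted ↔ κ < δ.trials ∧ δ.accepts κ := by
  simp [accepted]

theorem isClose_congr {P Q : F[X]} (hP : δ.IsClose P) (hQ : Q.natDegree ≤ δ.d)
    (h : δ.encode Q = δ.encode P) : δ.IsClose Q := by
  refine ⟨hQ, hP.2.trans (Finset.card_le_card fun i hi => ?_)⟩
  obtain ⟨l, hl, hy⟩ := δ.mem_agreeSet.1 hi
  exact δ.mem_agreeSet.2 ⟨l, hl, fun j hj => (δ.encode_eq_iff.1 h i i.2 j hj).trans (hy j hj)⟩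

theorem nodup_words : δ.words.Nodup := by
  refine List.Nodup.map_on (fun κ hκ κ' hκ' heq => ?_) ((List.nodup_range).filter _)
  have h1 := ((δ.accepts_iff κ).1 (δ.mem_accepted.1 hκ).2).2
  have h2 := ((δ.accepts_iff κ').1 (δ.mem_accepted.1 hκ').2).2
  rcases lt_trichotomy κ κ' with h | h | h
  · exact absurd heq.symm (h2 κ h)
  · exact h
  · exact absurd heq (h1 κ' h)

theorem exists_of_mem_words {c : Fin δ.n → (Fin δ.s → F)} (hc : c ∈ δ.words) :
    ∃ P, δ.IsClose P ∧ c = δ.encode P := by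
  obtain ⟨κ, hκ, rfl⟩ := List.mem_map.1 hc
  exact ⟨_, ((δ.accepts_iff κ).1 (δ.mem_accepted.1 hκ).2).1, rfl⟩

/-- A good seed guarantees that some trial yields the word; the first trial yielding it passes the
novelty test. That trial need not find the polynomial P itself, so closeness is transferred through
the word. -/
theorem mem_words_iff {p : ℕ} (h : δ.Valid p) (hg : δ.GoodSeed)
    {c : Fin δ.n → (Fin δ.s → F)} : c ∈ δ.words ↔ ∃ P, δ.IsClose P ∧ c = δ.encode P := by
  refine ⟨δ.exists_of_mem_words, ?_⟩
  rintro ⟨P, hP, rfl⟩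
  have hex : ∃ κ, δ.encode (δ.trialPoly κ) = δ.encode P := by
    obtain ⟨κ, -, h2⟩ := hg P hP
    exact ⟨κ, by rw [δ.trialPoly_eq h hP h2]⟩
  classical
  have hspec := Nat.find_spec hex
  have hmin := fun m => Nat.find_min (m := m) hex
  have hlt : Nat.find hex < δ.trials := by
    obtain ⟨κ, hκ, h2⟩ := hg P hP
    exact (Nat.find_min' hex (by rw [δ.trialPoly_eq h hP h2])).trans_lt hκ
  set κ := Nat.find hex
  refine List.mem_map.2 ⟨κ, δ.mem_accepted.2 ⟨hlt, (δ.accepts_iff κ).2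
    ⟨δ.isClose_congr hP (δ.natDegree_polyOf_le _) hspec, fun κ' hκ' heq => ?_⟩⟩, hspec⟩
  exact hmin κ' hκ' (heq.symm.trans hspec)

/-- Distinct output words come from distinct close polynomials, whatever the seed; hence the bound
holds in every run. -/
theorem length_words_le {L : ℕ} (hL : ∀ S : Finset F[X], (∀ P ∈ S, δ.IsClose P) → S.card ≤ L) :
    δ.words.length ≤ L := by
  classical
  have h1 : (δ.accepted.map δ.trialPoly).Nodup := by
    refine List.Nodup.of_map δ.encode ?_
    rw [List.map_map]
    exact δ.nodup_words
  have h2 := hL (δ.accepted.map δ.trialPoly).toFinset fun P hP => by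
    obtain ⟨κ, hκ, rfl⟩ := List.mem_map.1 (List.mem_toFinset.1 hP)
    exact ((δ.accepts_iff κ).1 (δ.mem_accepted.1 hκ).2).1
  rw [List.toFinset_card_of_nodup h1, List.length_map] at h2
  rwa [words, List.length_map]

/-- The number of seeds. -/
def seeds : ℕ := (δ.n * δ.ℓ) ^ (δ.trials * δ.samples)

/-- The input with another random seed. -/
def withSeed (g : ℕ) : RecInput F := { δ with g := g }

theorem Valid.withSeed {p : ℕ} {G : Type u} {δ : RecInput G} (h : δ.Valid p) (g : ℕ) :
    (δ.withSeed g).Valid p :=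
  ⟨h.n_pos, h.ℓ_pos, h.e_pos, h.d_lt, h.sn_lt, h.inj, h.gap, h.big⟩

/-- The set of polynomials to be found is finite. -/
theorem finite_isClose {p : ℕ} [Fact p.Prime] [CharP F p] (h : δ.Valid p) :
    {P | δ.IsClose P}.Finite := by
  by_contra hinf
  obtain ⟨S, hS, hc⟩ := Set.Infinite.exists_subset_card_eq hinf (δ.bound + 1)
  have := δ.card_le_bound h (S := S) fun P hP => hS hP
  omega

-- Seeds correspond bijectively to families of samples through their digits in base nℓ, so bad seeds
-- inject into failing families.
open Classical in
theorem card_goodSeed {p : ℕ} [Fact p.Prime] [CharP F p] (h : δ.Valid p) :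
    99 * δ.seeds ≤
      100 * (Finset.univ.filter fun g : Fin δ.seeds => (δ.withSeed g).GoodSeed).card := by
  have hfin := δ.finite_isClose h
  have h1 := δ.card_fail_le h (S := hfin.toFinset) fun P hP => hfin.mem_toFinset.1 hP
  have h2 : (Finset.univ.filter fun g : Fin δ.seeds => ¬ (δ.withSeed g).GoodSeed).card ≤
      (Finset.univ.filter fun G : Fin δ.trials → Fin δ.samples → Fin (δ.n * δ.ℓ) =>
        ∃ P ∈ hfin.toFinset, ∀ κ, G κ ∉ δ.goodSet P).card := by
    refine Finset.card_le_card_of_injOn (seedEquiv (δ.n * δ.ℓ) δ.trials δ.samples)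
      (fun g hg => ?_) (seedEquiv _ _ _).injective.injOn
    rw [Finset.mem_coe, Finset.mem_filter] at hg ⊢
    refine ⟨Finset.mem_univ _, ?_⟩
    have h3 := hg.2
    rw [GoodSeed] at h3
    push Not at h3
    obtain ⟨P, hP, h4⟩ := h3
    refine ⟨P, hfin.mem_toFinset.2 hP, fun κ h5 => h4 κ κ.2 ?_⟩
    have h6 := δ.mem_goodSet.1 h5
    have h7 : (fun τ => ((seedEquiv (δ.n * δ.ℓ) δ.trials δ.samples g κ τ : Fin _) : ℕ)) =
        fun τ : Fin δ.samples => (δ.withSeed g).digit κ τ :=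
      funext fun τ => seedEquiv_apply g κ τ
    rw [GoodSample] at h6 ⊢
    refine ⟨fun τ j hj => ?_, fun Q hQ hQv => h6.2 Q hQ fun τ j hj => ?_⟩
    · rw [← congrFun h7 τ]
      exact h6.1 τ j hj
    · rw [congrFun h7 τ]
      exact hQv τ j hj
  have h3 := Finset.card_filter_add_card_filter_not (s := (Finset.univ : Finset (Fin δ.seeds)))
    (fun g => (δ.withSeed g).GoodSeed)
  rw [Finset.card_univ, Fintype.card_fin] at h3
  have h4 : ((δ.n * δ.ℓ) ^ δ.samples) ^ δ.trials = δ.seeds := by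
    rw [seeds, ← pow_mul, mul_comm δ.samples]
  rw [h4] at h1
  omega

end RecInput

/-! ### Programs with one random choice -/

open ListRec.Comp

theorem Comp.bind_ret_seq {ι : Type*} (U : PMF ι) {v w : ι → Val} {c u : ι → ℕ} {f : Val → Comp}
    (h : ∀ i, f (v i) = ret (w i) (u i)) :
    seq (U.bind fun i => ret (v i) (c i)) f = U.bind fun i => ret (w i) (c i + u i) := by
  simp only [seq, ret, PMF.bind_bind, PMF.pure_bind] at h ⊢
  congr 1
  funext i
  rw [h]
  simp

theorem Comp.draw_of_pos (k : ℕ) [NeZero k] :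
    draw k = (PMF.uniformOfFintype (Fin k)).bind fun i => ret (.num i) (Nat.size k + 1) := by
  cases k with
  | zero => exact absurd rfl (NeZero.ne 0)
  | succ k => rfl

/-- A computable function of the input and a random number is the output of a program. -/
theorem exists_prog_of_polyTime {X : Type*} {M : X → ℕ} {I : X → Val} {Q : X → ℕ}
    {out : ∀ x, Fin (Q x) → Val} (hQ : PolyNat M I Q) (hQ0 : ∀ x, 0 < Q x)
    (hout : PolyTime (idxM Q M) (idxI Q I) fun y => out y.1 y.2) :
    ∃ (A : Prog) (k : ℕ), ∀ x env,
      (∀ z ∈ (A.eval (I x :: env)).support, z.2 ≤ (M x + 2) ^ k ∧ ∃ g, z.1 = out x g) ∧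
      ∀ (S : Set (Fin (Q x))) (E : Set (Val × ℕ)), (∀ g ∈ S, ∀ t, (out x g, t) ∈ E) →
        99 * Q x ≤ 100 * S.ncard → 99 / 100 ≤ (A.eval (I x :: env)).toOuterMeasure E := by
  obtain ⟨e, T, hT, he⟩ := hQ.time.exists_bdd
  obtain ⟨e', k', he'⟩ := hout
  have hB : PolyBdd M fun x => (M x + 2) ^ k' := ⟨k', fun _ => le_rfl⟩
  obtain ⟨k, hk⟩ := (((hT.add hQ.bdd).add hB).add (.const 10) : PolyBdd M _)
  -- One draw, then the number is paired with the input to form the indexed input on which the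
  -- deterministic program runs.
  refine ⟨.letIn (.rand e) (.letIn (.pair (.var 0) (.var 1)) e'), k, fun x env => ?_⟩
  obtain ⟨t, ht, h⟩ := he x env
  have hne : NeZero (Q x) := ⟨(hQ0 x).ne'⟩
  have h1 : ∀ g : Fin (Q x), ∃ u ≤ (M x + 2) ^ k',
      e'.eval (.pair (.num g) (I x) :: .num g :: I x :: env) = ret (out x g) u :=
    fun g => he' ⟨x, g⟩ _
  choose u hu h1 using h1
  have hev : (Prog.letIn (.rand e) (.letIn (.pair (.var 0) (.var 1)) e')).eval (I x :: env) =
      (PMF.uniformOfFintype (Fin (Q x))).map fun g =>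
        (out x g, t + ((Q x).size + 1) + 1 + (1 + (1 + 1) + 1 + u g)) := by
    have h2 : (Prog.rand e).eval (I x :: env) = (PMF.uniformOfFintype (Fin (Q x))).bind fun g =>
        ret (.num g) (t + ((Q x).size + 1)) := by
      rw [Prog.eval, h, ret_seq]
      show (draw (Q x)).bind _ = _
      rw [draw_of_pos, PMF.bind_bind]
      simp [ret]
    have h3 : seq ((Prog.rand e).eval (I x :: env)) (fun v => ret v 1) =
        (PMF.uniformOfFintype (Fin (Q x))).bind fun g =>
          ret (.num g) (t + ((Q x).size + 1) + 1) := by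
      rw [h2]
      exact bind_ret_seq _ fun _ => rfl
    rw [Prog.eval, h3]
    refine (bind_ret_seq _ (w := fun g => out x g) (u := fun g => 1 + (1 + 1) + 1 + u g)
      fun g => ?_).trans ?_
    rotate_left
    · rw [← PMF.bind_pure_comp]
      rfl
    · rw [Prog.eval, Prog.eval, Prog.eval, Prog.eval]
      rw [ret_seq_ret (t := 1) (u := 1 + 1) (w := .pair (.num g) (I x)) (ret_seq_ret rfl),
        ret_seq_ret (u := 1) rfl]
      exact ret_seq_ret (h1 g)
  rw [hev]
  refine ⟨fun z hz => ?_, fun S E hSE hS => ?_⟩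
  · rw [PMF.support_map] at hz
    obtain ⟨g, -, rfl⟩ := hz
    refine ⟨le_trans ?_ (hk x), g, rfl⟩
    have := hu g
    beta_reduce
    show t + ((Q x).size + 1) + 1 + (1 + (1 + 1) + 1 + u g) ≤ _
    omega
  · rw [PMF.toOuterMeasure_map_apply]
    refine le_trans ?_ (MeasureTheory.measure_mono (s := S) fun g hg => hSE g hg _)
    classical
    rw [PMF.toOuterMeasure_uniformOfFintype_apply, Fintype.card_fin, ← Nat.card_eq_fintype_card,
      Nat.card_coe_set_eq]
    rw [ENNReal.div_le_iff_le_mul (by simp) (by simp), mul_comm, ← mul_div_assoc,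
      ENNReal.le_div_iff_mul_le (by simp [hne.out]) (by simp)]
    exact_mod_cast hS

/-! ### The program -/

theorem Val.ofList_map_eq_tab {α : Type*} (l : List α) (f : α → Val) (x : α) :
    Val.ofList (l.map f) = Val.tab l.length fun i => f (l[i]?.getD x) := by
  rw [Val.tab]
  congr 1
  refine List.ext_getElem (by simp) fun i h1 h2 => ?_
  rw [List.length_map] at h1
  simp [h1]

/-- The input of the algorithm for given points and lists, with random seed `0`. -/
def RecInput.ofLists {F : Type u} [Field F] {n s : ℕ} (d ℓ e : ℕ) (a : Fin n → F)
    (S : Fin n → List (Fin s → F)) : RecInput F where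
  a i := if h : i < n then a ⟨i, h⟩ else 0
  y i l j := if h : i < n ∧ j < s then ((S ⟨i, h.1⟩)[l]?.getD 0) ⟨j, h.2⟩ else 0
  s := s
  d := d
  n := n
  ℓ := ℓ
  e := e
  g := 0

/-- An instance of the list-recovery problem, with a parameter that controls the running time. -/
structure Inst : Type (u + 1) where
  /-- the field -/
  Φ : FieldData.{u}
  /-- multiplicity -/
  s : ℕ
  /-- degree bound -/
  d : ℕ
  /-- length -/
  n : ℕ
  /-- size of the input lists -/
  ℓ : ℕ
  /-- error bound -/
  e : ℕ
  /-- evaluation points -/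
  a : Fin n → Φ.F
  /-- input lists -/
  S : Fin n → List (Fin s → Φ.F)
  /-- running time parameter -/
  M : ℕ
  length_eq : ∀ i, (S i).length = ℓ

namespace Inst

/-- The input of the algorithm, with random seed `0`. -/
def input (x : Inst.{u}) : RecInput x.Φ.F := .ofLists x.d x.ℓ x.e x.a x.S

/-- The input of the program. -/
def enc (x : Inst.{u}) : Val := encInput x.Φ.B x.e x.d x.ℓ x.a x.S

/-- The hypotheses under which the algorithm works in polynomial time. -/
structure Good (x : Inst.{u}) : Prop where
  valid : x.input.Valid x.Φ.p
  p_le : x.Φ.p.size ≤ x.M + 2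
  dim_le : x.Φ.B.dim ≤ x.M + 2
  s_le : x.s ≤ x.M + 2
  d_le : x.d ≤ x.M + 2
  n_le : x.n ≤ x.M + 2
  bound_le : x.input.bound ≤ (x.M + 2) ^ 200

theorem points_eq (x : Inst.{u}) : Val.ofList (List.ofFn fun i => encElem x.Φ.B (x.a i)) =
    .tab x.n fun i => encElem x.Φ.B (x.input.a i) :=
  Val.ofList_ofFn _ _ fun i => by simp [input, RecInput.ofLists]

theorem lists_eq (x : Inst.{u}) :
    Val.ofList (List.ofFn fun i => .ofList ((x.S i).map (encSymbol x.Φ.B))) =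
      .tab x.n fun i => .tab x.ℓ fun l => .tab x.s fun j => encElem x.Φ.B (x.input.y i l j) := by
  refine Val.ofList_ofFn _ _ fun i => ?_
  rw [Val.ofList_map_eq_tab _ _ 0, x.length_eq]
  refine Val.tab_congr fun l _ => ?_
  exact Val.ofList_ofFn _ _ fun j => by simp [input, RecInput.ofLists]

theorem words_eq {Φ : FieldData.{u}} (δ : RecInput Φ.F) : encWords Φ.B δ.words =
    .ofList (δ.accepted.map fun κ =>
      .tab δ.n fun i => .tab δ.s fun j => encElem Φ.B (δ.trialWord κ i j)) := by
  rw [encWords, RecInput.words, List.map_map]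
  congr 1
  refine List.map_congr_left fun κ _ => ?_
  refine Val.ofList_ofFn _ _ fun i => Val.ofList_ofFn _ _ fun j => ?_
  rw [RecInput.trialWord_eq]
  rfl

/-- The projections follow the order of the fields in `encInput`. The list size is bounded through ℓ
≤ `ord` ≤ s, and the error bound through `agr` > 0. -/
theorem recCtx : RecCtx (X := {x : Inst.{u} // x.Good}) (fun x => x.1.M) (fun x => x.1.enc)
    (fun x => x.1.Φ) fun x => x.1.input := by
  have hI := PolyTime.id (M := fun x : {x : Inst.{u} // x.Good} => x.1.M)
    (I := fun x => x.1.enc)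
  have hb : ∀ f : {x : Inst.{u} // x.Good} → ℕ, (∀ x, f x ≤ x.1.M + 2) →
      PolyBdd (fun x : {x : Inst.{u} // x.Good} => x.1.M) f := fun f hf => ⟨1, by simpa using hf⟩
  have hn := hb (fun x => x.1.n) fun x => x.2.n_le
  have hℓ : ∀ x : {x : Inst.{u} // x.Good}, x.1.ℓ ≤ x.1.M + 2 := fun x => by
    have h1 := x.2.valid.ord_le
    have h2 : x.1.input.ord = 2 * (x.1.ℓ * x.1.input.gapInv) := rfl
    have h3 : x.1.ℓ ≤ x.1.ℓ * x.1.input.gapInv := Nat.le_mul_of_pos_right _ (Nat.succ_pos _)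
    have h4 : x.1.input.s = x.1.s := rfl
    have := x.2.s_le
    omega
  have he : ∀ x : {x : Inst.{u} // x.Good}, x.1.e ≤ x.1.n := fun x => by
    have h1 := x.2.valid.agr_pos
    have h2 : x.1.input.agr = x.1.n + 1 - x.1.e := rfl
    omega
  have hlast := hI.right.right.right.right.right.right.right.right
  exact {
    field := ⟨⟨hI.right.left, hb _ fun x => x.2.p_le⟩,
      ⟨hI.right.right.left, hb _ fun x => x.2.dim_le⟩, hI.right.right.right.left⟩
    s := ⟨hI.right.right.right.right.left, hb _ fun x => x.2.s_le⟩
    d := ⟨hI.right.right.right.right.right.left, hb _ fun x => x.2.d_le⟩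
    n := ⟨hI.right.right.right.right.right.right.left, hn⟩
    ℓ := ⟨hI.right.right.right.right.right.right.right.left, hb _ hℓ⟩
    e := ⟨hI.left, hn.mono he⟩
    g := .const 0
    bound_bdd := ⟨200, fun x => x.2.bound_le⟩
    points := hlast.left.congr fun x => x.1.points_eq
    lists := hlast.right.left.congr fun x => x.1.lists_eq
    n_pos := fun x => x.2.valid.n_pos
    ℓ_pos := fun x => x.2.valid.ℓ_pos
    ord_le := fun x => x.2.valid.ord_le }

theorem seeds_pos {x : Inst.{u}} (hx : x.Good) : 0 < x.input.seeds :=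
  pow_pos (Nat.mul_pos hx.valid.n_pos hx.valid.ℓ_pos) _

theorem polyNat_seeds : PolyNat (X := {x : Inst.{u} // x.Good}) (fun x => x.1.M)
    (fun x => x.1.enc) fun x => x.1.input.seeds :=
  PolyNat.pow (recCtx.n.mul recCtx.ℓ).toNat (recCtx.trials.mul recCtx.samples)

theorem polyTime_words : PolyTime (X := (x : {x : Inst.{u} // x.Good}) × Fin x.1.input.seeds)
    (idxM (fun x : {x : Inst.{u} // x.Good} => x.1.input.seeds) fun x => x.1.M)
    (idxI (fun x : {x : Inst.{u} // x.Good} => x.1.input.seeds) fun x => x.1.enc)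
    fun y => encWords y.1.1.Φ.B (y.1.1.input.withSeed y.2).words := by
  have h := recCtx.{u}.under (K := fun x => x.1.input.seeds)
  have hg : PolyNat (idxM (fun x : {x : Inst.{u} // x.Good} => x.1.input.seeds) fun x => x.1.M)
      (idxI (fun x : {x : Inst.{u} // x.Good} => x.1.input.seeds) fun x => x.1.enc)
      fun y => (y.2 : ℕ) :=
    ⟨PolyTime.head (X := (x : {x : Inst.{u} // x.Good}) × Fin x.1.input.seeds)
      (J := fun y => .num y.2) (I := fun y => y.1.1.enc), (polyNat_seeds.bdd.comap Sigma.fst).mono fun y =>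
      Nat.size_le_size y.2.2.le⟩
  have h' : RecCtx (idxM (fun x : {x : Inst.{u} // x.Good} => x.1.input.seeds) fun x => x.1.M)
      (idxI (fun x : {x : Inst.{u} // x.Good} => x.1.input.seeds) fun x => x.1.enc)
      (fun y => y.1.1.Φ)
      fun y => y.1.1.input.withSeed y.2 :=
    ⟨h.field, h.s, h.d, h.n, h.ℓ, h.e, hg, h.bound_bdd, h.points, h.lists, h.n_pos, h.ℓ_pos,
      h.ord_le⟩
  exact h'.output.congr fun y => (words_eq _).symm

/-- The program that solves the list-recovery problem. -/
theorem exists_prog : ∃ (A : Prog) (k : ℕ), ∀ x : Inst.{u}, (x.e = 0 →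
      A.eval [x.enc] = ret (.num 0) 4) ∧ (x.Good →
      (∀ z ∈ (A.eval [x.enc]).support, z.2 ≤ (x.M + 2) ^ k ∧
        ∃ g, z.1 = encWords x.Φ.B (x.input.withSeed g).words) ∧
      ∀ E : Set (Val × ℕ), (∀ g, (x.input.withSeed g).GoodSeed →
        ∀ t, (encWords x.Φ.B (x.input.withSeed g).words, t) ∈ E) →
        99 / 100 ≤ (A.eval [x.enc]).toOuterMeasure E) := by
  classical
  obtain ⟨A, k, h⟩ := exists_prog_of_polyTime
    (out := fun x g => encWords x.1.Φ.B (x.1.input.withSeed g).words)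
    polyNat_seeds.{u} (fun x => seeds_pos x.2) polyTime_words
  -- The first input component is the error bound. If it is 0, no word qualifies and the leaf 0, the
  -- empty list, is returned; the main program has no time guarantee there.
  refine ⟨.ite (.fst (.var 0)) A (.lit 0), k + 2, fun x => ?_⟩
  have h1 : seq ((Prog.fst (.var 0)).eval [x.enc]) (fun v => ret v 1) = ret (.num x.e) 3 := by
    rw [Prog.eval, Prog.eval, ret_seq_ret (w := .num x.e) (t := 1) (u := 1) rfl]
    exact ret_seq_ret (u := 1) rfl
  refine ⟨fun he => ?_, fun hx => ?_⟩
  · rw [Prog.eval, h1, he]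
    exact ret_seq_ret (u := 1) rfl
  · have he : (Val.num x.e).isTrue = true := by
      have := hx.valid.e_pos
      change 0 < x.e at this
      obtain ⟨m, hm⟩ := Nat.exists_eq_succ_of_ne_zero this.ne'
      rw [hm]
      rfl
    have h2 : (Prog.ite (.fst (.var 0)) A (.lit 0)).eval [x.enc] =
        (A.eval [x.enc]).map fun z => (z.1, 3 + z.2) := by
      rw [Prog.eval, h1, ret_seq, if_pos he, ← PMF.bind_pure_comp]
      rfl
    have h3 := (h ⟨x, hx⟩ []).1
    have h4 := (h ⟨x, hx⟩ []).2
    rw [h2]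
    refine ⟨fun z hz => ?_, fun E hE => ?_⟩
    · rw [PMF.support_map] at hz
      obtain ⟨w, hw, rfl⟩ := hz
      obtain ⟨h5, g, h6⟩ := h3 w hw
      refine ⟨?_, g, h6⟩
      have h5 : w.2 ≤ (x.M + 2) ^ k := h5
      have h7 : 1 ≤ (x.M + 2) ^ k := Nat.one_le_pow _ _ (by omega)
      have h8 : 4 ≤ (x.M + 2) ^ 2 := Nat.pow_le_pow_left (by omega : 2 ≤ x.M + 2) 2
      rw [pow_add]
      show 3 + w.2 ≤ _
      nlinarith
    · rw [PMF.toOuterMeasure_map_apply]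
      refine h4 {g | (x.input.withSeed g).GoodSeed} _ (fun g hg t => hE g hg _) ?_
      rw [Set.ncard_eq_toFinset_card', Set.toFinset_ofPred]
      have := charP_of_injective_algebraMap (algebraMap (ZMod x.Φ.p) x.Φ.F).injective x.Φ.p
      exact x.input.card_goodSeed hx.valid

end Inst

end ListRec

end

noncomputable section

namespace ListRec

universe u

open Real

/-! ### Estimates -/

namespace RecInput

/-- The hypotheses on the parameters, for a gap `ε` to capacity. -/
structure Params {F : Type u} (p : ℕ) (ε : ℝ) (δ : RecInput F) : Prop where
  n_pos : 0 < δ.n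
  ℓ_pos : 0 < δ.ℓ
  ε_pos : 0 < ε
  d_lt : δ.d < p
  n_lt : (δ.n : ℝ) < (p : ℝ) / δ.s
  big : 16 * (δ.ℓ : ℝ) / ε ^ 2 ≤ δ.s
  inj : Function.Injective fun i : Fin δ.n => δ.a i
  e_eq : δ.e = errorBound δ.n (1 - δ.d / (δ.s * δ.n) - ε)
  e_pos : 0 < δ.e

namespace Params

variable {F : Type u} {p : ℕ} {ε : ℝ} {δ : RecInput F} (h : δ.Params p ε)
include h

theorem s_pos : 0 < (δ.s : ℝ) := by
  have h1 : (0 : ℝ) < δ.ℓ := Nat.cast_pos.2 h.ℓ_pos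
  have h2 := h.ε_pos
  exact lt_of_lt_of_le (by positivity) h.big

theorem n_pos' : 0 < (δ.n : ℝ) := Nat.cast_pos.2 h.n_pos

theorem capacity_nonneg : 0 ≤ 1 - δ.d / (δ.s * δ.n) - ε := by
  have h1 := h.e_pos
  rw [h.e_eq, errorBound, Nat.floor_pos] at h1
  exact nonneg_of_mul_nonneg_left (by linarith) h.n_pos'

theorem ε_le_one : ε ≤ 1 := by
  have h1 := h.capacity_nonneg
  have h2 : 0 ≤ (δ.d : ℝ) / (δ.s * δ.n) := by positivity
  linarith

/-- The error bound is at most αn + 1, so A ≥ n + 1 - e ≥ (1 - α)n = dn/(sn) + εn; multiply by s. -/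
theorem gap_le : (δ.d : ℝ) + ε * (δ.s * δ.n) ≤ δ.s * δ.agr := by
  have hs := h.s_pos
  have hn := h.n_pos'
  have h1 : (δ.e : ℝ) ≤ (1 - δ.d / (δ.s * δ.n) - ε) * δ.n + 1 := by
    rw [h.e_eq]
    exact Nat.floor_le (by have := h.capacity_nonneg; positivity)
  have h2 : (δ.n : ℝ) + 1 - δ.e ≤ δ.agr := by
    rw [agr]
    rw [sub_le_iff_le_add]
    exact_mod_cast (by omega : δ.n + 1 ≤ δ.n + 1 - δ.e + δ.e)
  have h3 : (δ.d : ℝ) = δ.s * (δ.d / (δ.s * δ.n) * δ.n) := by field_simp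
  have h4 := mul_le_mul_of_nonneg_left h2 hs.le
  have h5 := mul_le_mul_of_nonneg_left h1 hs.le
  nlinarith

theorem valid : δ.Valid p := by
  have hs := h.s_pos
  have hn := h.n_pos'
  have hε := h.ε_pos
  have hg := h.gap_le
  have h0 : 0 < ε * (δ.s * δ.n) := by positivity
  have hlt : δ.d < δ.s * δ.agr := by
    have : (δ.d : ℝ) < δ.s * δ.agr := by linarith
    exact_mod_cast this
  refine ⟨h.n_pos, h.ℓ_pos, h.e_pos, h.d_lt, ?_, h.inj, hlt, ?_⟩
  · have h1 := h.n_lt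
    rw [lt_div_iff₀ hs] at h1
    rw [mul_comm]
    exact_mod_cast h1
  · have h1 := h.big
    rw [div_le_iff₀ (by positivity)] at h1
    have h2 : (16 : ℝ) * δ.ℓ * (δ.s * δ.n) ^ 2 ≤ δ.s * (δ.s * δ.agr - δ.d) ^ 2 :=
      calc (16 : ℝ) * δ.ℓ * (δ.s * δ.n) ^ 2 ≤ δ.s * ε ^ 2 * (δ.s * δ.n) ^ 2 := by gcongr
        _ = δ.s * (ε * (δ.s * δ.n)) ^ 2 := by ring
        _ ≤ _ := by gcongr; linarith
    rw [← Nat.cast_mul, ← Nat.cast_mul, ← Nat.cast_sub hlt.le] at h2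
    exact_mod_cast h2

theorem gapInv_le : (δ.gapInv : ℝ) ≤ 1 / ε + 1 := by
  have hs := h.s_pos
  have hn := h.n_pos'
  have hε := h.ε_pos
  have hg := h.gap_le
  have h0 : 0 < ε * (δ.s * δ.n) := by positivity
  rw [gapInv]
  push_cast
  refine add_le_add_left (Nat.cast_div_le.trans ?_) _
  rw [Nat.cast_sub h.valid.gap.le]
  push_cast
  rw [div_le_div_iff₀ (by linarith) hε]
  linarith

theorem le_gapInv : (δ.gapInv : ℝ) ≤ 2 / ε := by
  have h1 := h.gapInv_le
  have h2 : 1 ≤ 1 / ε := (one_le_div h.ε_pos).2 h.ε_le_one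
  have h3 : 2 / ε = 1 / ε + 1 / ε := by ring
  linarith

theorem one_le_ratio : 1 ≤ (δ.ℓ : ℝ) / ε := by
  rw [one_le_div h.ε_pos]
  exact h.ε_le_one.trans (by exact_mod_cast h.ℓ_pos)

theorem ord_le_ratio : (δ.ord : ℝ) ≤ 4 * (δ.ℓ / ε) := by
  have h1 := mul_le_mul_of_nonneg_left h.le_gapInv (Nat.cast_nonneg (α := ℝ) δ.ℓ)
  rw [ord]
  push_cast
  have h2 : (δ.ℓ : ℝ) * (2 / ε) = 2 * (δ.ℓ / ε) := by ring
  linarith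

theorem ord_pos : 0 < δ.ord := by
  have := h.ℓ_pos
  have : 0 < δ.gapInv := Nat.succ_pos _
  rw [ord]
  positivity

/-- The constant is 20 = 2·2·5: g ≤ 2/ε, and size(r) + 1 ≤ log₂(4ℓ/ε) + 2 ≤ 5 log₂(ℓ/ε), because the
logarithm is at least 1. -/
theorem samples_le (hr : 2 ≤ (δ.ℓ : ℝ) / ε) :
    (δ.samples : ℝ) ≤ 20 * (logb 2 (δ.ℓ / ε) / ε) := by
  have hlog : 1 ≤ logb 2 ((δ.ℓ : ℝ) / ε) := by
    rw [le_logb_iff_rpow_le one_lt_two (by linarith)]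
    simpa using hr
  have hsize : (δ.ord.size : ℝ) ≤ logb 2 δ.ord + 1 := by
    have h1 : 2 ^ (δ.ord.size - 1) ≤ δ.ord :=
      Nat.lt_size.1 (Nat.sub_lt (Nat.size_pos.2 h.ord_pos) one_pos)
    have h2 : ((δ.ord.size - 1 : ℕ) : ℝ) ≤ logb 2 δ.ord := by
      rw [le_logb_iff_rpow_le one_lt_two (Nat.cast_pos.2 h.ord_pos), rpow_natCast]
      exact_mod_cast h1
    have h3 : δ.ord.size ≤ δ.ord.size - 1 + 1 := by omega
    have h4 : (δ.ord.size : ℝ) ≤ (δ.ord.size - 1 : ℕ) + 1 := by exact_mod_cast h3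
    linarith
  have hlog4 : logb 2 (4 * ((δ.ℓ : ℝ) / ε)) = 2 + logb 2 (δ.ℓ / ε) := by
    rw [logb_mul (by norm_num) (by linarith)]
    congr 1
    rw [show (4 : ℝ) = 2 ^ (2 : ℝ) by norm_num, logb_rpow two_pos (by norm_num)]
  have hmono := logb_le_logb_of_le one_lt_two (Nat.cast_pos.2 h.ord_pos) h.ord_le_ratio
  have h1 : (δ.ord.size : ℝ) + 1 ≤ 5 * logb 2 (δ.ℓ / ε) := by linarith
  have h2 := h.le_gapInv
  have h3 := h.ε_pos
  rw [samples]
  push_cast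
  calc 2 * (δ.gapInv : ℝ) * (δ.ord.size + 1) ≤ 2 * (2 / ε) * (5 * logb 2 (δ.ℓ / ε)) := by gcongr
    _ = _ := by ring

/-- Here 60 = 3·20: since ℓ/ε ≥ 2, r ≤ 4ℓ/ε ≤ (ℓ/ε)³, and the exponent is `samples`. -/
theorem bound_le (hr : 2 ≤ (δ.ℓ : ℝ) / ε) :
    (δ.bound : ℝ) ≤ ((δ.ℓ : ℝ) / ε) ^ (60 * (1 / ε * logb 2 (δ.ℓ / ε))) := by
  have h0 : 0 ≤ (δ.ℓ : ℝ) / ε := by linarith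
  have h1 : (δ.ord : ℝ) ≤ ((δ.ℓ : ℝ) / ε) ^ 3 := by
    refine h.ord_le_ratio.trans ?_
    have h2 : (2 : ℝ) ^ 2 ≤ ((δ.ℓ : ℝ) / ε) ^ 2 := by gcongr
    rw [pow_succ]
    gcongr
    linarith
  have h2 : 60 * (1 / ε * logb 2 ((δ.ℓ : ℝ) / ε)) = 3 * (20 * (logb 2 (δ.ℓ / ε) / ε)) := by ring
  rw [h2, rpow_mul h0, bound]
  push_cast
  rw [← rpow_natCast (δ.ord : ℝ)]
  have h3 : ((δ.ℓ : ℝ) / ε) ^ (3 : ℝ) = ((δ.ℓ : ℝ) / ε) ^ 3 := by norm_cast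
  rw [h3]
  refine (rpow_le_rpow (Nat.cast_nonneg _) h1 (Nat.cast_nonneg _)).trans ?_
  exact rpow_le_rpow_of_exponent_le (one_le_pow₀ (by linarith)) (h.samples_le hr)

theorem half_lt (hr : (δ.ℓ : ℝ) / ε < 2) : δ.ℓ = 1 ∧ 1 / 2 < ε := by
  have h1 := h.ε_le_one
  rw [div_lt_iff₀ h.ε_pos] at hr
  have h2 : (δ.ℓ : ℝ) < 2 := by linarith
  have h3 : δ.ℓ < 2 := by exact_mod_cast h2
  have h4 := h.ℓ_pos
  have h5 : δ.ℓ = 1 := by omega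
  refine ⟨h5, ?_⟩
  rw [h5] at hr
  push_cast at hr
  linarith

theorem bound_le_of_lt (hr : (δ.ℓ : ℝ) / ε < 2) : δ.bound ≤ 4 ^ 16 := by
  obtain ⟨h1, h2⟩ := h.half_lt hr
  have h3 := h.gapInv_le
  have h4 : 1 / ε < 2 := by
    rw [div_lt_iff₀ h.ε_pos]
    linarith
  have h5 : (δ.gapInv : ℝ) < 3 := by linarith
  have h6 : δ.gapInv < 3 := by exact_mod_cast h5
  have h7 : δ.ord ≤ 4 := by
    rw [ord, h1]
    omega
  have h8 : δ.ord.size ≤ 3 := Nat.size_le.2 (by omega)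
  have h9 : δ.samples ≤ 16 := by
    rw [samples]
    calc 2 * δ.gapInv * (δ.ord.size + 1) ≤ 2 * 2 * (3 + 1) := by gcongr; omega
      _ = 16 := rfl
  exact (Nat.pow_le_pow_left h7 _).trans (Nat.pow_le_pow_right (by norm_num) h9)

end Params

variable {F : Type u} [Field F] {p : ℕ} {ε : ℝ} {δ : RecInput F}

/-- The bound on the number of polynomials to be found. -/
theorem Params.card_le [Fact p.Prime] [CharP F p] (h : δ.Params p ε) {S : Finset F[X]}
    (hS : ∀ P ∈ S, δ.IsClose P) :
    S.card ≤ ⌊((δ.ℓ : ℝ) / ε) ^ (60 * (1 / ε * logb 2 (δ.ℓ / ε)))⌋₊ := by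
  rcases le_or_gt 2 ((δ.ℓ : ℝ) / ε) with hr | hr
  · exact (δ.card_le_bound h.valid hS).trans (Nat.le_floor (h.bound_le hr))
  -- The logarithm may now be 0, so the sampling bound is too weak. But ℓ = 1 and ε > 1/2, so two
  -- close polynomials agree with each other in more than d/s coordinates and coincide.
  · obtain ⟨h1, h2⟩ := h.half_lt hr
    have h3 := h.gap_le
    have h4 : δ.s * δ.n + δ.d < 2 * (δ.s * δ.agr) := by
      have hs := h.s_pos
      have hn := h.n_pos'
      have h5 : 0 < (δ.s : ℝ) * δ.n := by positivity
      have h6 : (0 : ℝ) ≤ δ.d := Nat.cast_nonneg _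
      have h7 : (δ.s : ℝ) * δ.n + δ.d < 2 * (δ.s * δ.agr) := by nlinarith
      exact_mod_cast h7
    have h5 : S.card ≤ 1 := Finset.card_le_one.2 fun P hP P' hP' =>
      δ.eq_of_isClose h.valid h1 h4 (hS P hP) (hS P' hP')
    refine h5.trans (Nat.le_floor ?_)
    rw [Nat.cast_one]
    have h6 := h.one_le_ratio
    have h7 := h.ε_pos
    have h8 := logb_nonneg one_lt_two h6
    exact one_le_rpow h6 (by positivity)

end RecInput

/-! ### Codewords and polynomials -/

section Close

variable {F : Type u} [Field F] {n s d ℓ : ℕ} {a : Fin n → F}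

theorem ofLists_agrees_iff {e : ℕ} {S : Fin n → List (Fin s → F)} (hS : ∀ i, (S i).length = ℓ)
    (P : F[X]) (i : Fin n) :
    (RecInput.ofLists d ℓ e a S).Agrees P i ↔ multEnc s a P i ∈ S i := by
  rw [List.mem_iff_getElem, RecInput.Agrees]
  constructor
  · rintro ⟨l, hl, h⟩
    have hl' : l < (S i).length := by rw [hS]; exact hl
    refine ⟨l, hl', funext fun j => ?_⟩
    have := h j j.2
    simp only [RecInput.ofLists, i.2, j.2, and_self, dif_pos, Fin.eta] at this
    rw [List.getElem?_eq_getElem hl', Option.getD_some] at this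
    exact this.symm
  · rintro ⟨l, hl, h⟩
    refine ⟨l, by rw [hS] at hl; exact hl, fun j hj => ?_⟩
    have hj' : j < s := hj
    simp only [RecInput.ofLists, i.2, hj', and_self, dif_pos, Fin.eta]
    rw [List.getElem?_eq_getElem hl, Option.getD_some, h]
    rfl

theorem listDist_le_iff {A : Type*} (hn : 0 < n) (α : ℝ) (c : Fin n → A) (S : Fin n → Finset A) :
    listDist c S ≤ α ↔ ({i | c i ∉ S i} : Set (Fin n)).ncard < errorBound n α := by
  rw [listDist, div_le_iff₀ (Nat.cast_pos.2 hn), errorBound, ← Nat.succ_le_iff,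
    Nat.le_floor_iff' (Nat.succ_ne_zero _)]
  push_cast
  rw [add_le_add_iff_right]

open Classical in
theorem mem_closeCodewords_iff (hn : 0 < n) {α : ℝ} {S : Fin n → List (Fin s → F)}
    (hS : ∀ i, (S i).length = ℓ) {c : Fin n → (Fin s → F)} :
    c ∈ closeCodewords (multCode s d a) α (fun i => (S i).toFinset) ↔
      ∃ P, (RecInput.ofLists d ℓ (errorBound n α) a S).IsClose P ∧ c = multEnc s a P := by
  have key : ∀ P : F[X], listDist (multEnc s a P) (fun i => (S i).toFinset) ≤ α ↔
      (RecInput.ofLists d ℓ (errorBound n α) a S).agr ≤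
        ((RecInput.ofLists d ℓ (errorBound n α) a S).agreeSet P).card := fun P => by
    rw [listDist_le_iff hn]
    have hm : ∀ i : Fin n, (i ∈ Finset.univ.filter fun i : Fin n => multEnc s a P i ∈ S i) ↔
        multEnc s a P i ∈ S i := fun i => by simp
    have h1 : (RecInput.ofLists d ℓ (errorBound n α) a S).agreeSet P =
        Finset.univ.filter fun i : Fin n => multEnc s a P i ∈ S i :=
      Finset.ext fun i => (RecInput.mem_agreeSet _).trans
        ((ofLists_agrees_iff hS P i).trans (hm i).symm)
    have h2 := Finset.card_filter_add_card_filter_not (s := (Finset.univ : Finset (Fin n)))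
      (fun i : Fin n => multEnc s a P i ∈ S i)
    have h3 : ({i | multEnc s a P i ∉ (S i).toFinset} : Set (Fin n)).ncard =
        (Finset.univ.filter fun i : Fin n => ¬ multEnc s a P i ∈ S i).card := by
      rw [← Set.ncard_coe_finset]
      congr 1
      ext i
      simp
    have h4 : (RecInput.ofLists d ℓ (errorBound n α) a S).agr = n + 1 - errorBound n α := rfl
    rw [Finset.card_univ, Fintype.card_fin] at h2
    rw [h1, h3, h4]
    change _ ↔ n + 1 - errorBound n α ≤
      (Finset.univ.filter fun i : Fin n => multEnc s a P i ∈ S i).card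
    omega
  constructor
  · rintro ⟨⟨P, hP, rfl⟩, h⟩
    exact ⟨P, ⟨hP, (key P).1 h⟩, rfl⟩
  · rintro ⟨P, ⟨hP, h⟩, rfl⟩
    exact ⟨⟨P, hP, rfl⟩, (key P).2 h⟩

theorem ofLists_encode {e : ℕ} (S : Fin n → List (Fin s → F)) (P : F[X]) :
    (RecInput.ofLists d ℓ e a S).encode P = multEnc s a P := by
  funext i j
  have hi : (i : ℕ) < n := i.2
  show (hasseDeriv (j : ℕ) P).eval (if h : (i : ℕ) < n then a ⟨i, h⟩ else 0) = _
  rw [dif_pos hi]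
  rfl

theorem closeCodewords_eq_empty {A : Type*} (C : Set (Fin n → A)) {α : ℝ} (hα : α < 0)
    (S : Fin n → Finset A) : closeCodewords C α S = ∅ := by
  refine Set.eq_empty_of_forall_notMem fun c hc => ?_
  have : 0 ≤ listDist c S := by
    rw [listDist]
    positivity
  exact absurd hc.2 (by linarith)

end Close

end ListRec

end

noncomputable section

namespace ListRec

universe u

open Real

/-! ### List recovery of multiplicity codes -/

section Main

variable {F : Type u} [Field F] {p n s d ℓ : ℕ} {a : Fin n → F} {ε : ℝ}

theorem params_ofLists (ha : Function.Injective a) (hn : 0 < n) (hℓ : 0 < ℓ) (hε : 0 < ε)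
    (hd : d < p) (hnp : (n : ℝ) < (p : ℝ) / s) (hbig : 16 * (ℓ : ℝ) / ε ^ 2 ≤ s)
    (hα : 0 ≤ 1 - (d : ℝ) / (s * n) - ε) (S : Fin n → List (Fin s → F)) :
    (RecInput.ofLists d ℓ (errorBound n (1 - d / (s * n) - ε)) a S).Params p ε where
  n_pos := hn
  ℓ_pos := hℓ
  ε_pos := hε
  d_lt := hd
  n_lt := hnp
  big := hbig
  inj := by
    have : (fun i : Fin n => if h : (i : ℕ) < n then a ⟨i, h⟩ else 0) = a :=
      funext fun i => dif_pos i.2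
    change Function.Injective fun i : Fin n => if h : (i : ℕ) < n then a ⟨i, h⟩ else 0
    rwa [this]
  e_eq := rfl
  e_pos := Nat.floor_pos.2 (by
    have : (0 : ℝ) ≤ (1 - d / (s * n) - ε) * n := by positivity
    linarith)

theorem isListRecoverable_multCode [Fact p.Prime] [CharP F p] (ha : Function.Injective a)
    (hn : 0 < n) (hℓ : 0 < ℓ) (hε : 0 < ε) (hd : d < p) (hnp : (n : ℝ) < (p : ℝ) / s)
    (hbig : 16 * (ℓ : ℝ) / ε ^ 2 ≤ s) :
    IsListRecoverable (multCode s d a) (1 - d / (s * n) - ε) ℓ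
      ⌊((ℓ : ℝ) / ε) ^ (60 * ((1 / ε) * logb 2 (ℓ / ε)))⌋₊ := by
  classical
  intro S hS
  rcases lt_or_ge (1 - (d : ℝ) / (s * n) - ε) 0 with hα | hα
  · rw [closeCodewords_eq_empty _ hα, Set.encard_empty]
    exact bot_le
  have h := params_ofLists ha hn hℓ hε hd hnp hbig hα fun i => (S i).toList
  have hfin := RecInput.finite_isClose _ h.valid
  have h1 : closeCodewords (multCode s d a) (1 - d / (s * n) - ε) S ⊆
      multEnc s a '' {P | (RecInput.ofLists d ℓ (errorBound n (1 - d / (s * n) - ε)) a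
        fun i => (S i).toList).IsClose P} := by
    intro c hc
    have h2 : S = fun i => ((S i).toList).toFinset := funext fun i => by simp
    rw [h2] at hc
    obtain ⟨P, hP, rfl⟩ := (mem_closeCodewords_iff hn
      (fun i => by rw [Finset.length_toList, hS])).1 (by convert hc)
    exact ⟨P, hP, rfl⟩
  refine (Set.encard_le_encard h1).trans ((Set.encard_image_le _ _).trans ?_)
  rw [hfin.encard_eq_coe_toFinset_card]
  exact_mod_cast h.card_le fun P hP => hfin.mem_toFinset.1 hP

theorem two_le_base [Fintype F] {ρ : ℝ} (hρ : 0 ≤ ρ) (hn : 0 < n) (x : ℝ) :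
    2 ≤ logb 2 (Fintype.card F) + s + d + n + ρ ^ x := by
  have h1 : 1 ≤ logb 2 (Fintype.card F) := by
    rw [le_logb_iff_rpow_le one_lt_two (by exact_mod_cast Fintype.card_pos), rpow_one]
    exact_mod_cast Fintype.one_lt_card
  have h2 : (1 : ℝ) ≤ n := by exact_mod_cast hn
  have h3 : 0 ≤ ρ ^ x := by positivity
  have h4 : (0 : ℝ) ≤ s := by positivity
  have h5 : (0 : ℝ) ≤ d := by positivity
  linarith

theorem size_le_logb [Fintype F] [Fact p.Prime] [Algebra (ZMod p) F]
    (B : PowerBasis (ZMod p) F) :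
    (p.size : ℝ) ≤ logb 2 (Fintype.card F) + 1 ∧ (B.dim : ℝ) ≤ logb 2 (Fintype.card F) := by
  have hp : 2 ≤ p := (Fact.out : p.Prime).two_le
  have h1 : (Fintype.card F : ℝ) = (p : ℝ) ^ B.dim := by
    rw [Module.card_eq_pow_finrank (K := ZMod p) (V := F), ZMod.card, B.finrank]
    push_cast
    rfl
  have h2 : logb 2 (Fintype.card F) = B.dim * logb 2 p := by
    rw [h1, logb_pow]
  have h3 : ((p.size - 1 : ℕ) : ℝ) ≤ logb 2 p := by
    rw [le_logb_iff_rpow_le one_lt_two (by positivity), rpow_natCast]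
    exact_mod_cast (Nat.lt_size.1 (Nat.sub_lt (Nat.size_pos.2 (by omega)) one_pos))
  have h4 : 1 ≤ logb 2 (p : ℝ) := by
    rw [le_logb_iff_rpow_le one_lt_two (by positivity), rpow_one]
    exact_mod_cast hp
  have h5 : (1 : ℝ) ≤ B.dim := by exact_mod_cast B.dim_pos
  have h6 : (p.size : ℝ) ≤ (p.size - 1 : ℕ) + 1 := by
    exact_mod_cast (by omega : p.size ≤ p.size - 1 + 1)
  rw [h2]
  constructor <;> nlinarith

end Main

/-- Multiplicity codes are list-recovered by a program in polynomial time. -/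
theorem exists_listRecovers : ∃ (A : Prog) (k : ℕ), ∀ (F : Type u) [Field F] [Fintype F] (p : ℕ)
    [Fact p.Prime] [CharP F p] (s d n ℓ : ℕ) (ε : ℝ) (a : Fin n → F),
    Function.Injective a → 0 < n → 0 < ℓ → 0 < ε →
    d < p → (n : ℝ) < (p : ℝ) / s → 16 * (ℓ : ℝ) / ε ^ 2 ≤ s →
    ∀ [Algebra (ZMod p) F] (B : PowerBasis (ZMod p) F),
      ListRecovers A B s d a (1 - d / (s * n) - ε) ℓ
        ⌊((ℓ : ℝ) / ε) ^ (60 * ((1 / ε) * logb 2 (ℓ / ε)))⌋₊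
        ((logb 2 (Fintype.card F) + s + d + n + ((ℓ : ℝ) / ε) ^ (logb 2 (ℓ / ε) / ε)) ^ k) := by
  obtain ⟨A, k, hA⟩ := Inst.exists_prog.{u}
  refine ⟨A, 2 * k + 2, ?_⟩
  intro F _ _ p _ _ s d n ℓ ε a ha hn hℓ hε hd hnp hbig _ B S hS
  have hbase := two_le_base (F := F) (s := s) (d := d) (ρ := (ℓ : ℝ) / ε) (by positivity) hn
    (logb 2 (ℓ / ε) / ε)
  have hlog := size_le_logb B
  set base := logb 2 (Fintype.card F) + s + d + n + ((ℓ : ℝ) / ε) ^ (logb 2 (ℓ / ε) / ε)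
    with hbase_eq
  have hρ : 0 ≤ ((ℓ : ℝ) / ε) ^ (logb 2 (ℓ / ε) / ε) := by positivity
  have hs0 : (0 : ℝ) ≤ s := Nat.cast_nonneg _
  have hd0 : (0 : ℝ) ≤ d := Nat.cast_nonneg _
  have hn0 : (0 : ℝ) ≤ n := Nat.cast_nonneg _
  have hdim0 : (0 : ℝ) ≤ B.dim := Nat.cast_nonneg _
  -- The running time parameter M is the integer part of the base of T, so that p.size, dim, s, d
  -- and n are all at most M + 2.
  let x : Inst.{u} := ⟨⟨p, F, B⟩, s, d, n, ℓ, errorBound n (1 - d / (s * n) - ε), a, S,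
    ⌊base⌋₊, fun i => (hS i).2⟩
  rcases lt_or_ge (1 - (d : ℝ) / (s * n) - ε) 0 with hα | hα
  · have he : errorBound n (1 - (d : ℝ) / (s * n) - ε) = 0 := by
      rw [errorBound, Nat.floor_eq_zero]
      have : (0 : ℝ) < n := Nat.cast_pos.2 hn
      nlinarith
    have h1 : A.eval [encInput B (errorBound n (1 - d / (s * n) - ε)) d ℓ a S] =
      Comp.ret (.num 0) 4 := (hA x).1 he
    rw [h1, Comp.ret]
    refine ⟨fun z hz => ?_, ?_⟩
    · rw [PMF.support_pure, Set.mem_singleton_iff] at hz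
      subst hz
      refine ⟨?_, [], rfl, Nat.zero_le _, by simp⟩
      calc ((4 : ℕ) : ℝ) = 2 ^ 2 := by norm_num
        _ ≤ base ^ 2 := by gcongr
        _ ≤ base ^ (2 * k + 2) := pow_le_pow_right₀ (by linarith) (by omega)
    · rw [PMF.toOuterMeasure_pure_apply, if_pos]
      · exact ENNReal.div_le_of_le_mul (by norm_num)
      · refine ⟨[], rfl, List.nodup_nil, fun c => ?_⟩
        rw [closeCodewords_eq_empty _ hα]
        simp
  · have hP : x.input.Params p ε := params_ofLists ha hn hℓ hε hd hnp hbig hα S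
    have hfl : base < ⌊base⌋₊ + 1 := Nat.lt_floor_add_one base
    have hle : ∀ m : ℕ, (m : ℝ) ≤ base + 1 → m ≤ ⌊base⌋₊ + 2 := fun m hm => by
      have : (m : ℝ) < ⌊base⌋₊ + 2 := by linarith
      exact_mod_cast this.le
    have hG : x.Good := by
      refine ⟨hP.valid, hle _ ?_, hle _ ?_, hle _ ?_, hle _ ?_, hle _ ?_, ?_⟩
      · show (p.size : ℝ) ≤ _
        linarith [hlog.1]
      · show (B.dim : ℝ) ≤ _
        linarith [hlog.2]
      · show (s : ℝ) ≤ _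
        linarith [hlog.2]
      · show (d : ℝ) ≤ _
        linarith [hlog.2]
      · show (n : ℝ) ≤ _
        linarith [hlog.2]
      · show x.input.bound ≤ (⌊base⌋₊ + 2) ^ 200
        -- If ℓ/ε ≥ 2, `bound` is at most the 60th power of a summand of the base; otherwise it is
        -- at most 4^16. The exponent 200 covers both.
        rcases le_or_gt 2 ((ℓ : ℝ) / ε) with hr | hr
        · have h1 : (x.input.bound : ℝ) ≤ ((ℓ : ℝ) / ε) ^ (60 * (1 / ε * logb 2 (ℓ / ε))) :=
            hP.bound_le hr
          have h2 : 60 * (1 / ε * logb 2 ((ℓ : ℝ) / ε)) = logb 2 (ℓ / ε) / ε * (60 : ℕ) := by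
            push_cast
            ring
          rw [h2, rpow_mul_natCast (by linarith)] at h1
          have h3 : (x.input.bound : ℝ) ≤ (⌊base⌋₊ + 2 : ℝ) ^ 60 := by
            refine h1.trans (pow_le_pow_left₀ hρ ?_ _)
            linarith [hlog.2]
          refine le_trans (b := (⌊base⌋₊ + 2) ^ 60) (by exact_mod_cast h3) ?_
          exact Nat.pow_le_pow_right (by omega) (by norm_num)
        · calc x.input.bound ≤ 4 ^ 16 := hP.bound_le_of_lt hr
            _ ≤ 2 ^ 200 := by norm_num
            _ ≤ _ := Nat.pow_le_pow_left (by omega) _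
    have henc : ∀ (g : ℕ) (P : F[X]), (x.input.withSeed g).encode P = multEnc s a P :=
      fun g P => ofLists_encode (d := d) (ℓ := ℓ) (e := 0) S P
    obtain ⟨h1, h2⟩ := (hA x).2 hG
    refine ⟨fun z hz => ?_, h2 _ fun g hg t => ?_⟩
    · obtain ⟨h3, g, h4⟩ := h1 z hz
      refine ⟨?_, (x.input.withSeed g).words, h4,
        (x.input.withSeed g).length_words_le fun S' hS' => hP.card_le hS', fun c hc => ?_⟩
      · have h5 : (z.2 : ℝ) ≤ ((⌊base⌋₊ : ℝ) + 2) ^ k := by exact_mod_cast h3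
        have h6 : (⌊base⌋₊ : ℝ) ≤ base := Nat.floor_le (by linarith)
        -- This uses that the base is at least 2 and converts the bound in M + 2 into a power of the
        -- base, doubling the exponent.
        have h7 : (⌊base⌋₊ : ℝ) + 2 ≤ base ^ 2 := by nlinarith
        calc (z.2 : ℝ) ≤ ((⌊base⌋₊ : ℝ) + 2) ^ k := h5
          _ ≤ (base ^ 2) ^ k := by gcongr
          _ = base ^ (2 * k) := (pow_mul _ _ _).symm
          _ ≤ base ^ (2 * k + 2) := pow_le_pow_right₀ (by linarith) (by omega)
      · obtain ⟨P, h5, h6⟩ := (x.input.withSeed g).exists_of_mem_words hc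
        exact ⟨P, h5.1, h6.trans (henc g P)⟩
    · refine ⟨(x.input.withSeed g).words, rfl, (x.input.withSeed g).nodup_words, fun c => ?_⟩
      refine ((x.input.withSeed g).mem_words_iff (hP.valid.withSeed g) hg).trans
        (Iff.trans ?_ (mem_closeCodewords_iff hn fun i => (hS i).2).symm)
      exact exists_congr fun P => and_congr Iff.rfl (by rw [← henc g P]; rfl)

end ListRec

end

theorem theorem4p1 :
    ∃ (C : ℝ) (A : ListRec.Prog) (k : ℕ), 0 < C ∧
      ∀ (F : Type*) [Field F] [Fintype F] (p : ℕ) [Fact p.Prime] [CharP F p]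
        (s d n ℓ : ℕ) (ε : ℝ) (a : Fin n → F),
        Function.Injective a → 0 < n → 0 < ℓ → 0 < ε →
        d < p → (n : ℝ) < (p : ℝ) / s → 16 * (ℓ : ℝ) / ε ^ 2 ≤ s →
        let α : ℝ := 1 - d / (s * n) - ε
        let L : ℕ := ⌊((ℓ : ℝ) / ε) ^ (C * ((1 / ε) * Real.logb 2 (ℓ / ε)))⌋₊
        let T : ℝ := (Real.logb 2 (Fintype.card F) + s + d + n
          + ((ℓ : ℝ) / ε) ^ (Real.logb 2 (ℓ / ε) / ε)) ^ k
        ListRec.IsListRecoverable (ListRec.multCode s d a) α ℓ L ∧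
        ∀ [Algebra (ZMod p) F] (B : PowerBasis (ZMod p) F),
          ListRec.ListRecovers A B s d a α ℓ L T := by
  obtain ⟨A, k, h⟩ := ListRec.exists_listRecovers
  refine ⟨60, A, k, by norm_num, ?_⟩
  intro F _ _ p _ _ s d n ℓ ε a ha hn hℓ hε hd hnp hbig
  exact ⟨ListRec.isListRecoverable_multCode ha hn hℓ hε hd hnp hbig,
    h F p s d n ℓ ε a ha hn hℓ hε hd hnp hbig⟩
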